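/- Let $\beta>1$ and let $\mu$ be the generalized Cauchy distribution of parameter $\beta$ on $\mathbb{R}^2$, i.e. the probability measure with Lebesgue density proportional to $(1+\|x\|^2)^{-\beta}$. Let $\nu$ be its radial part, i.e. the probability measure on $(0,+\infty)$ with Lebesgue density proportional to $r(1+r^2)^{-\beta}$. With the weight $\sigma^2(x)=1+\|x\|^2$, consider the operators $$\mathcal L^\sigma_\mu h(x)=(1+\|x\|^2)\,\Delta h(x)+2(1-\beta)\,x\cdot\nabla h(x),\qquad x\in\mathbb{R}^2,$$ on smooth compactly supported functions $h$ on $\mathbb{R}^2$, and $$\mathcal L^\sigma_\nu g(r)=(1+r^2)\,g''(r)+\Big((3-2\beta)r+\frac1r\Big)g'(r),\qquad r>0,$$ on smooth compactly supported functions $g$ on $[0,+\infty)$ with the Neumann condition $g'(0)=0$. The operators $-\mathcal L^\sigma_\mu$ and $-\mathcal L^\sigma_\nu$ are symmetric and non-negative in $L^2(\mu)$ and $L^2(\nu)$ respectively; we denote in the same way their self-adjoint (Friedrichs) extensions, and by $\lambda_1$ the spectral gap, i.e. the largest real $\lambda$ such that the spectrum lies in $\{0\}\cup[\lambda,+\infty)$.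 Then: - for $1<\beta\le\frac{3+\sqrt5}{2}$, $\ \lambda_1(-\mathcal L^\sigma_\mu)=\lambda_1(-\mathcal L^\sigma_\nu)=(\beta-1)^2$; - for $\frac{3+\sqrt5}{2}<\beta\le 3$, $\ \beta\le\lambda_1(-\mathcal L^\sigma_\mu)\le\lambda_1(-\mathcal L^\sigma_\nu)=(\beta-1)^2$; - for $\beta>3$, $\ \beta\le\lambda_1(-\mathcal L^\sigma_\mu)\le 2(\beta-1)<\lambda_1(-\mathcal L^\sigma_\nu)=4(\beta-2)$. -/

import Mathlib

open MeasureTheory Filter Topology Set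
open scoped ContDiff ENNReal InnerProductSpace RealInnerProductSpace

noncomputable section

namespace WeightedGap

/-! ## Unbounded operators on a real Hilbert space: Friedrichs extension, spectrum, spectral gap -/

section Abstract

variable {E : Type*} [NormedAddCommGroup E] [InnerProductSpace ℝ E]

/-- `u` is the limit of a sequence from the domain of `A` that is Cauchy for the quadratic form
`φ ↦ ⟪A φ, φ⟫`. -/
def IsFormLimit (A : E →ₗ.[ℝ] E) (u : E) : Prop :=
  ∃ φ : ℕ → A.domain,
    Tendsto (fun k => (φ k : E)) atTop (𝓝 u) ∧
    Tendsto (fun p : ℕ × ℕ => ⟪A (φ p.1 - φ p.2), ((φ p.1 - φ p.2 : A.domain) : E)⟫_ℝ)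
      atTop (𝓝 0)

/-- The domain of the closure of the quadratic form `φ ↦ ⟪A φ, φ⟫`. When `A` is non-negative
(the only case of interest) the form limits already are a subspace, see `mem_formDomain_iff`,
and the span adds nothing. -/
def formDomain (A : E →ₗ.[ℝ] E) : Submodule ℝ E :=
  Submodule.span ℝ {u | IsFormLimit A u}

theorem mem_formDomain_iff (A : E →ₗ.[ℝ] E) (hA : ∀ φ : A.domain, 0 ≤ ⟪A φ, (φ : E)⟫_ℝ) (u : E) :
    u ∈ formDomain A ↔ IsFormLimit A u := by
  refine ⟨fun hu => ?_, fun hu => Submodule.subset_span hu⟩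
  refine Submodule.span_induction (p := fun v _ => IsFormLimit A v) (fun v hv => hv) ?_ ?_ ?_ hu
  · exact ⟨fun _ => 0, by simp, by simp⟩
  · rintro v w - - ⟨φ, hφ, hφ'⟩ ⟨ψ, hψ, hψ'⟩
    refine ⟨fun k => φ k + ψ k, by simpa using hφ.add hψ, ?_⟩
    have hlim := (hφ'.const_mul 2).add (hψ'.const_mul 2)
    simp only [mul_zero, add_zero] at hlim
    refine squeeze_zero (fun p => hA _) (fun p => ?_) hlim
    have h1 : (φ p.1 + ψ p.1) - (φ p.2 + ψ p.2) = (φ p.1 - φ p.2) + (ψ p.1 - ψ p.2) := by abel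
    rw [h1]
    generalize φ p.1 - φ p.2 = a
    generalize ψ p.1 - ψ p.2 = b
    have h2 := hA (a - b)
    simp only [LinearPMap.map_sub, LinearPMap.map_add, Submodule.coe_add, Submodule.coe_sub,
      inner_add_left, inner_add_right, inner_sub_left, inner_sub_right] at h2 ⊢
    linarith
  · rintro c v - ⟨φ, hφ, hφ'⟩
    refine ⟨fun k => c • φ k, by simpa using hφ.const_smul c, ?_⟩
    have hlim := hφ'.const_mul (c * c)
    rw [mul_zero] at hlim
    refine hlim.congr fun p => ?_
    rw [← smul_sub, LinearPMap.map_smul, Submodule.coe_smul, inner_smul_left, inner_smul_right]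
    simp [mul_assoc]

/-- The Friedrichs extension of a densely defined, symmetric, non-negative operator `A`: the
restriction of the adjoint of `A` to the domain of the closed quadratic form. It is the
self-adjoint operator attached to that closed form; if `A` is essentially self-adjoint, it is the
closure of `A`, its only self-adjoint extension. -/
def friedrichs [CompleteSpace E] (A : E →ₗ.[ℝ] E) : E →ₗ.[ℝ] E :=
  A.adjoint.domRestrict (formDomain A)

/-- `z` is in the (real part of the) resolvent set of `T`: the operator `T - z` has an everywhere
defined bounded two-sided inverse. -/
def InResolventSet (T : E →ₗ.[ℝ] E) (z : ℝ) : Prop :=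
  ∃ R : E →L[ℝ] E,
    (∀ f : E, ∃ h : R f ∈ T.domain, T ⟨R f, h⟩ - z • R f = f) ∧
    (∀ u : T.domain, R (T u - z • (u : E)) = u)

/-- The real spectrum of `T`; for a self-adjoint operator this is the whole spectrum. -/
def realSpectrum (T : E →ₗ.[ℝ] E) : Set ℝ := {z | ¬ InResolventSet T z}

/-- The spectral gap: the largest `lam` such that the spectrum lies in `{0} ∪ [lam, ∞)`. (The set
below is closed downwards and contains its supremum as soon as it is bounded above and non-empty.
If it is unbounded the value is `0`.) -/
def spectralGap (T : E →ₗ.[ℝ] E) : ℝ :=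
  sSup {lam : ℝ | realSpectrum T ⊆ {0} ∪ Ici lam}

/-- The spectral gap `λ₁(A)` of (the self-adjoint extension of) a non-negative symmetric
operator `A`. -/
def lambda1 [CompleteSpace E] (A : E →ₗ.[ℝ] E) : ℝ := spectralGap (friedrichs A)

end Abstract

/-! ## Operators on `L²(μ)` given by their action on test functions -/

section L2

variable {X : Type*} [MeasurableSpace X]

theorem toLp_eq_zero {μ : Measure X} {f : X → ℝ} (hf : MemLp f 2 μ) :
    hf.toLp f = 0 ↔ f =ᵐ[μ] 0 := by
  rw [← MemLp.toLp_zero (MemLp.zero' (ε := ℝ) (p := 2) (μ := μ)), MemLp.toLp_eq_toLp_iff]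

/-- The operator on `L²(μ)` with domain the classes of the functions in `V`, sending the class
of `φ` to the class of `L φ`. -/
def l2Operator (μ : Measure X) (V : Submodule ℝ (X → ℝ)) (L : V →ₗ[ℝ] (X → ℝ))
    (hV : ∀ φ : V, MemLp (φ : X → ℝ) 2 μ) (hL : ∀ φ : V, MemLp (L φ) 2 μ)
    (hker : ∀ φ : V, (φ : X → ℝ) =ᵐ[μ] 0 → L φ =ᵐ[μ] 0) :
    Lp ℝ 2 μ →ₗ.[ℝ] Lp ℝ 2 μ :=
  let i : V →ₗ[ℝ] Lp ℝ 2 μ :=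
    { toFun := fun φ => (hV φ).toLp φ
      map_add' := fun φ ψ => MemLp.toLp_add (hV φ) (hV ψ)
      map_smul' := fun c φ => MemLp.toLp_const_smul c (hV φ) }
  let a : V →ₗ[ℝ] Lp ℝ 2 μ :=
    { toFun := fun φ => (hL φ).toLp (L φ)
      map_add' := fun φ ψ => by
        rw [← MemLp.toLp_add (hL φ) (hL ψ)]
        exact MemLp.toLp_congr _ _ (by rw [map_add])
      map_smul' := fun c φ => by
        rw [RingHom.id_apply, ← MemLp.toLp_const_smul c (hL φ)]
        exact MemLp.toLp_congr _ _ (by rw [map_smul]) }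
  { domain := LinearMap.range i
    toFun := (LinearMap.ker i).liftQ a (fun φ hφ => by
        have h1 : (hV φ).toLp (φ : X → ℝ) = 0 := hφ
        have h2 : (φ : X → ℝ) =ᵐ[μ] 0 := (toLp_eq_zero (hV φ)).1 h1
        exact (toLp_eq_zero (hL φ)).2 (hker φ h2)) ∘ₗ i.quotKerEquivRange.symm }

theorem mem_l2Operator_domain (μ : Measure X) (V : Submodule ℝ (X → ℝ)) (L : V →ₗ[ℝ] (X → ℝ))
    (hV : ∀ φ : V, MemLp (φ : X → ℝ) 2 μ) (hL : ∀ φ : V, MemLp (L φ) 2 μ)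
    (hker : ∀ φ : V, (φ : X → ℝ) =ᵐ[μ] 0 → L φ =ᵐ[μ] 0) (u : Lp ℝ 2 μ) :
    u ∈ (l2Operator μ V L hV hL hker).domain ↔ ∃ φ : V, (hV φ).toLp φ = u :=
  Iff.rfl

theorem l2Operator_apply (μ : Measure X) (V : Submodule ℝ (X → ℝ)) (L : V →ₗ[ℝ] (X → ℝ))
    (hV : ∀ φ : V, MemLp (φ : X → ℝ) 2 μ) (hL : ∀ φ : V, MemLp (L φ) 2 μ)
    (hker : ∀ φ : V, (φ : X → ℝ) =ᵐ[μ] 0 → L φ =ᵐ[μ] 0) (φ : V) :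
    l2Operator μ V L hV hL hker
      ⟨(hV φ).toLp φ, (mem_l2Operator_domain μ V L hV hL hker _).2 ⟨φ, rfl⟩⟩
      = (hL φ).toLp (L φ) := by
  unfold l2Operator
  simp only [LinearPMap.mk_apply, LinearMap.comp_apply]
  erw [LinearMap.quotKerEquivRange_symm_apply_image]
  rfl

/-- The multiple of `m` of total mass one (when `m` is finite and non-zero). -/
def normalize (m : Measure X) : Measure X := (m univ)⁻¹ • m

instance (m : Measure X) : IsFiniteMeasure (normalize m) := by
  refine ⟨?_⟩
  simp only [normalize, Measure.smul_apply, smul_eq_mul]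
  exact lt_of_le_of_lt (ENNReal.inv_mul_le_one _) ENNReal.one_lt_top

theorem ae_zero_normalize (m : Measure X) {f g : X → ℝ} (h : f =ᵐ[m] 0 → g =ᵐ[m] 0)
    (hf : f =ᵐ[normalize m] 0) : g =ᵐ[normalize m] 0 := by
  by_cases hc : (m univ)⁻¹ = 0
  · have h0 : normalize m = 0 := by simp [normalize, hc]
    rw [h0, ae_zero]
    exact Filter.eventually_bot
  · have h1 : m ≪ normalize m := Measure.absolutelyContinuous_smul hc
    have h2 : normalize m ≪ m := Measure.smul_absolutelyContinuous
    exact h2.ae_eq (h (h1.ae_eq hf))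

end L2

/-! ## The generalized Cauchy distribution and the operator of the full dynamics -/

section Full

/-- `ℝⁿ` with its Euclidean norm. -/
abbrev Euc (n : ℕ) := EuclideanSpace ℝ (Fin n)

/-- The generalized Cauchy distribution of parameter `β` on `ℝⁿ`: the probability measure with
Lebesgue density proportional to `(1 + ‖x‖²) ^ (-β)` (here `β > n / 2`). -/
def cauchy (n : ℕ) (β : ℝ) : Measure (Euc n) :=
  normalize (volume.withDensity fun x => ENNReal.ofReal ((1 + ‖x‖ ^ 2) ^ (-β)))

instance (n : ℕ) (β : ℝ) : IsFiniteMeasure (cauchy n β) := by unfold cauchy; infer_instance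

/-- Smooth compactly supported functions on `ℝⁿ`. -/
def testFunctions (n : ℕ) : Submodule ℝ (Euc n → ℝ) where
  carrier := {h | ContDiff ℝ ∞ h ∧ HasCompactSupport h}
  zero_mem' := ⟨contDiff_const, HasCompactSupport.zero⟩
  add_mem' := fun ha hb => ⟨ha.1.add hb.1, ha.2.add hb.2⟩
  smul_mem' := fun c _ ha => ⟨contDiff_const.smul ha.1, ha.2.smul_left (f := fun _ => c)⟩

/-- `L h (x) = (1 + ‖x‖²) Δh(x) + 2 (1 - β) x · ∇h(x)`. -/
def fullExpr (n : ℕ) (β : ℝ) (h : Euc n → ℝ) (x : Euc n) : ℝ :=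
  (1 + ‖x‖ ^ 2) * Laplacian.laplacian h x + 2 * (1 - β) * ⟪x, gradient h x⟫_ℝ

theorem fullExpr_eq_zero (n : ℕ) (β : ℝ) (h : Euc n → ℝ) (x : Euc n) (hx : x ∉ tsupport h) :
    fullExpr n β h x = 0 := by
  have h0 : h =ᶠ[𝓝 x] (fun _ => 0) := notMem_tsupport_iff_eventuallyEq.1 hx
  have h1 : Laplacian.laplacian h x = 0 := by
    rw [(InnerProductSpace.laplacian_congr_nhds h0).eq_of_nhds]
    exact congrFun (InnerProductSpace.laplacian_const (E := Euc n) (c := (0 : ℝ))) x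
  have h2 : gradient h x = 0 := by
    rw [h0.gradient_eq]; exact gradient_fun_const x (0 : ℝ)
  simp [fullExpr, h1, h2]

theorem fullExpr_continuous (n : ℕ) (β : ℝ) (h : Euc n → ℝ) (hh : ContDiff ℝ ∞ h) :
    Continuous (fullExpr n β h) := by
  have h1 : Continuous (Laplacian.laplacian h) := by
    rw [InnerProductSpace.laplacian_eq_iteratedFDeriv_stdOrthonormalBasis]
    have h2 : Continuous (iteratedFDeriv ℝ 2 h) :=
      (contDiff_infty.1 hh 2).continuous_iteratedFDeriv le_rfl
    fun_prop
  have h3 : Continuous (gradient h) :=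
    (InnerProductSpace.toDual ℝ (Euc n)).symm.continuous.comp
      (hh.continuous_fderiv (by simp))
  unfold fullExpr
  fun_prop

/-- `L` as a linear map on test functions. -/
def fullMap (n : ℕ) (β : ℝ) : testFunctions n →ₗ[ℝ] (Euc n → ℝ) where
  toFun h := fullExpr n β h
  map_add' f g := by
    funext x
    have hf : ContDiff ℝ ∞ (f : Euc n → ℝ) := f.2.1
    have hg : ContDiff ℝ ∞ (g : Euc n → ℝ) := g.2.1
    have h1 := ContDiffAt.laplacian_add (x := x)
      (contDiff_infty.1 hf 2).contDiffAt
      (contDiff_infty.1 hg 2).contDiffAt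
    have hf' : DifferentiableAt ℝ (f : Euc n → ℝ) x := hf.differentiable (by simp) x
    have hg' : DifferentiableAt ℝ (g : Euc n → ℝ) x := hg.differentiable (by simp) x
    simp only [fullExpr, Submodule.coe_add, Pi.add_apply, h1, inner_gradient_right,
      fderiv_add hf' hg', add_apply, map_add]
    ring
  map_smul' c f := by
    funext x
    have hf : ContDiff ℝ ∞ (f : Euc n → ℝ) := f.2.1
    have h1 := InnerProductSpace.laplacian_smul (x := x) c
      (contDiff_infty.1 hf 2).contDiffAt
    have hf' : DifferentiableAt ℝ (f : Euc n → ℝ) x := hf.differentiable (by simp) x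
    simp only [fullExpr, Submodule.coe_smul, Pi.smul_apply, h1, inner_gradient_right,
      fderiv_const_smul hf' c, smul_apply, RingHom.id_apply, smul_eq_mul,
      map_mul, conj_trivial]
    ring

/-- The operator `L` on `L²(μ)`, `μ` the generalized Cauchy distribution, with domain the smooth
compactly supported functions. -/
def fullOperator (n : ℕ) (β : ℝ) : Lp ℝ 2 (cauchy n β) →ₗ.[ℝ] Lp ℝ 2 (cauchy n β) :=
  l2Operator (cauchy n β) (testFunctions n) (fullMap n β)
    (fun h => h.2.1.continuous.memLp_of_hasCompactSupport h.2.2)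
    (fun h => (fullExpr_continuous n β h h.2.1).memLp_of_hasCompactSupport
      (HasCompactSupport.intro h.2.2 fun x hx => fullExpr_eq_zero n β h x hx))
    (fun h => ae_zero_normalize _ fun h0 => by
      have hm : Measurable fun x : Euc n => ENNReal.ofReal ((1 + ‖x‖ ^ 2) ^ (-β)) := by fun_prop
      have h1 := (ae_withDensity_iff hm).1 h0
      have h2 : (h : Euc n → ℝ) =ᵐ[volume] 0 := by
        filter_upwards [h1] with x hx
        refine hx ?_
        have : 0 < (1 + ‖x‖ ^ 2) ^ (-β) := by positivity
        simpa using this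
      have h3 : (h : Euc n → ℝ) = 0 :=
        (Continuous.ae_eq_iff_eq volume h.2.1.continuous continuous_zero).1 h2
      have h4 : h = 0 := Subtype.ext h3
      rw [h4, map_zero])

end Full

/-! ## The radial measure and the radial operator -/

section Radial

/-- The radial part of the generalized Cauchy distribution on `ℝⁿ`, `n ≥ 1`: the probability
measure on `(0, ∞)` with Lebesgue density proportional to `r ^ (n - 1) * (1 + r²) ^ (-β)`. -/
def radialCauchy (n : ℕ) (β : ℝ) : Measure ℝ :=
  normalize ((volume.restrict (Ioi 0)).withDensity
    fun r => ENNReal.ofReal (r ^ (n - 1) * (1 + r ^ 2) ^ (-β)))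

instance (n : ℕ) (β : ℝ) : IsFiniteMeasure (radialCauchy n β) := by
  unfold radialCauchy; infer_instance

/-- Smooth compactly supported functions on `[0, ∞)` with Neumann condition `g'(0) = 0`, written
as functions on `ℝ` of which only the values on `[0, ∞)` matter. -/
def neumannFunctions : Submodule ℝ (ℝ → ℝ) where
  carrier := {g | ContDiff ℝ ∞ g ∧ HasCompactSupport g ∧ deriv g 0 = 0}
  zero_mem' := ⟨contDiff_const, HasCompactSupport.zero, deriv_const 0 (0 : ℝ)⟩
  add_mem' := fun {a b} ha hb => ⟨ha.1.add hb.1, ha.2.1.add hb.2.1, by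
    rw [deriv_add (ha.1.differentiable (by simp) 0) (hb.1.differentiable (by simp) 0),
      ha.2.2, hb.2.2, add_zero]⟩
  smul_mem' := fun c a ha => ⟨contDiff_const.smul ha.1, ha.2.1.smul_left (f := fun _ => c), by
    rw [deriv_const_smul c (ha.1.differentiable (by simp) 0), ha.2.2, smul_zero]⟩

/-- `L g (r) = (1 + r²) g''(r) + ((n + 1 - 2β) r + (n - 1) / r) g'(r)`, for `r > 0`. -/
def radialExpr (n : ℕ) (β : ℝ) (g : ℝ → ℝ) (r : ℝ) : ℝ :=
  (1 + r ^ 2) * deriv (deriv g) r + (((n : ℝ) + 1 - 2 * β) * r + ((n : ℝ) - 1) / r) * deriv g r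

/-- `L` as a linear map on test functions. -/
def radialMap (n : ℕ) (β : ℝ) : neumannFunctions →ₗ[ℝ] (ℝ → ℝ) where
  toFun g := radialExpr n β g
  map_add' f g := by
    have hf : ContDiff ℝ ∞ (f : ℝ → ℝ) := f.2.1
    have hg : ContDiff ℝ ∞ (g : ℝ → ℝ) := g.2.1
    have h1 : deriv ((f : ℝ → ℝ) + (g : ℝ → ℝ)) = deriv (f : ℝ → ℝ) + deriv (g : ℝ → ℝ) := by
      funext x
      exact deriv_add (hf.differentiable (by simp) x) (hg.differentiable (by simp) x)
    have hf' : Differentiable ℝ (deriv (f : ℝ → ℝ)) :=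
      (contDiff_infty_iff_deriv.1 hf).2.differentiable (by simp)
    have hg' : Differentiable ℝ (deriv (g : ℝ → ℝ)) :=
      (contDiff_infty_iff_deriv.1 hg).2.differentiable (by simp)
    funext x
    simp only [radialExpr, Submodule.coe_add, Pi.add_apply, h1, deriv_add (hf' x) (hg' x)]
    ring
  map_smul' c f := by
    have hf : ContDiff ℝ ∞ (f : ℝ → ℝ) := f.2.1
    have h1 : deriv (c • (f : ℝ → ℝ)) = c • deriv (f : ℝ → ℝ) := by
      funext x
      exact deriv_const_smul c (hf.differentiable (by simp) x)
    have hf' : Differentiable ℝ (deriv (f : ℝ → ℝ)) :=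
      (contDiff_infty_iff_deriv.1 hf).2.differentiable (by simp)
    funext x
    simp only [radialExpr, Submodule.coe_smul, Pi.smul_apply, h1, deriv_const_smul c (hf' x),
      RingHom.id_apply, smul_eq_mul]
    ring

theorem radialExpr_memLp (n : ℕ) (β : ℝ) (g : neumannFunctions) (μ : Measure ℝ)
    [IsFiniteMeasure μ] : MemLp (radialExpr n β g) 2 μ := by
  obtain ⟨g, hg, hs, h0⟩ := g
  have hd1 : ContDiff ℝ ∞ (deriv g) := (contDiff_infty_iff_deriv.1 hg).2
  have hd2 : ContDiff ℝ ∞ (deriv (deriv g)) := (contDiff_infty_iff_deriv.1 hd1).2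
  have hs1 : HasCompactSupport (deriv g) := hs.deriv
  have hs2 : HasCompactSupport (deriv (deriv g)) := hs1.deriv
  have e : radialExpr n β g = (fun r => (1 + r ^ 2) * deriv (deriv g) r
      + (((n : ℝ) + 1 - 2 * β) * r) * deriv g r) + fun r => ((n : ℝ) - 1) * (deriv g r / r) := by
    funext r
    simp only [radialExpr, Pi.add_apply]
    ring
  show MemLp (radialExpr n β g) 2 μ
  rw [e]
  refine MemLp.add ?_ ?_
  · refine Continuous.memLp_of_hasCompactSupport ?_ ?_
    · have := hd1.continuous
      have := hd2.continuous
      fun_prop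
    · exact (hs2.mul_left (f := fun r : ℝ => 1 + r ^ 2)).add
        (hs1.mul_left (f := fun r : ℝ => ((n : ℝ) + 1 - 2 * β) * r))
  · obtain ⟨C, hC⟩ := hd2.continuous.bounded_above_of_compact_support hs2
    refine MemLp.const_mul (MemLp.of_bound ?_ C ?_) _
    · exact (hd1.continuous.measurable.div measurable_id).aestronglyMeasurable
    · refine Eventually.of_forall fun r => ?_
      have h1 := Convex.norm_image_sub_le_of_norm_deriv_le (f := deriv g) (s := univ) (C := C)
        (fun x _ => hd1.differentiable (by simp) x) (fun x _ => hC x) convex_univ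
        (mem_univ 0) (mem_univ r)
      rw [h0, sub_zero, sub_zero] at h1
      rw [norm_div]
      exact div_le_of_le_mul₀ (norm_nonneg _) ((norm_nonneg _).trans (hC 0)) h1

/-- The (Neumann) operator `L` on `L²(ν)`, `ν` the radial part of the generalized Cauchy
distribution. -/
def radialOperator (n : ℕ) (β : ℝ) :
    Lp ℝ 2 (radialCauchy n β) →ₗ.[ℝ] Lp ℝ 2 (radialCauchy n β) :=
  l2Operator (radialCauchy n β) neumannFunctions (radialMap n β)
    (fun g => g.2.1.continuous.memLp_of_hasCompactSupport g.2.2.1)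
    (fun g => radialExpr_memLp n β g _)
    (fun g => ae_zero_normalize _ fun h0 => by
      have hm : Measurable fun r : ℝ => ENNReal.ofReal (r ^ (n - 1) * (1 + r ^ 2) ^ (-β)) := by
        fun_prop
      have h1 := (ae_withDensity_iff hm).1 h0
      have h2 : (g : ℝ → ℝ) =ᵐ[volume.restrict (Ioi 0)] 0 := by
        filter_upwards [h1, ae_restrict_mem measurableSet_Ioi] with r hr hpos
        refine hr ?_
        have hpos' : 0 < r := hpos
        have : 0 < r ^ (n - 1) * (1 + r ^ 2) ^ (-β) := by positivity
        simpa using this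
      have h3 : EqOn (g : ℝ → ℝ) 0 (Ioi 0) :=
        Measure.eqOn_open_of_ae_eq h2 isOpen_Ioi g.2.1.continuous.continuousOn
          continuousOn_const
      have h4 : EqOn (deriv (g : ℝ → ℝ)) 0 (Ioi 0) := fun r hr => by
        rw [(h3.eventuallyEq_of_mem (isOpen_Ioi.mem_nhds hr)).deriv_eq]
        exact deriv_const r (0 : ℝ)
      have h5 : EqOn (deriv (deriv (g : ℝ → ℝ))) 0 (Ioi 0) := fun r hr => by
        rw [(h4.eventuallyEq_of_mem (isOpen_Ioi.mem_nhds hr)).deriv_eq]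
        exact deriv_const r (0 : ℝ)
      have h6 : radialMap n β g =ᵐ[volume.restrict (Ioi 0)] 0 := by
        filter_upwards [ae_restrict_mem measurableSet_Ioi] with r hr
        have e1 := h4 hr
        have e2 := h5 hr
        simp only [Pi.zero_apply] at e1 e2
        show radialExpr n β g r = 0
        rw [radialExpr, e1, e2]
        ring
      exact (withDensity_absolutelyContinuous _ _).ae_eq h6)

end Radial

end WeightedGap

end

/-! All four gaps are computed exactly, which is more than the statement asks. For `1 < β ≤ 3` both
operators have gap `(β - 1)²`; for `β > 3` the full gap is `2(β - 1)` and the radial one `4(β - 2)`.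
The bounds by `β` follow by arithmetic, since `(3 + √5)/2` is the larger root of `(β - 1)² = β`.

Three numbers compete. Near infinity the radial operator sends `r^α` to `α(α + 2 - 2β) r^α`; the
extreme value `-(β - 1)²` is reached at `α = β - 1`, exactly where `r^α` just fails to be square
integrable. This gives approximate eigenfunctions (`exists_log_weyl`). The function `(β - 2) r² - 1`
is an eigenfunction for `4(β - 2)`, and the coordinate functions are eigenfunctions for `2(β - 1)`;
for `β > 3` both are square integrable and can be cut off.

`lambda1_eq` reduces a gap to facts about test functions: a Poincaré inequality with constant `lam`,
an approximation of the kernel vector, and Weyl functions for `lam`. The resolvent at `-1` of the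
Friedrichs extension is `J J*`, with `J` the map from the completed form space; the Poincaré
inequality bounds it by `1 / (1 + lam)` on the complement of the kernel vector.

`radial_poincare` passes from `g` to `W = ∫ (g - κ) ρ`, which vanishes at both ends. The claim
becomes a weighted Hardy inequality for `W`, proved by completing squares with the positive
supersolution `r² (1 + r²)^((A - 2)/2)`; the parameter `A` serves both regimes.

`full_poincare` splits a function into its angular mean, handled by the radial inequality, and a
remainder. Wirtinger's inequality and the non-negativity of the integral of `(r ∂_r - 1)²` give the
remainder the constant `2(β - 1)`, with equality for linear functions. So the constant of the whole
is the smaller of the two. -/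

noncomputable section

namespace WeightedGap

/-! ### The Friedrichs extension through its resolvent at `-1`, and an abstract gap criterion. -/

section FormSpace

variable {E : Type*} [NormedAddCommGroup E] [InnerProductSpace ℝ E]

/-- A symmetric non-negative operator. -/
structure IsNonnegSymm (A : E →ₗ.[ℝ] E) : Prop where
  symm : ∀ φ ψ : A.domain, ⟪A φ, (ψ : E)⟫_ℝ = ⟪(φ : E), A ψ⟫_ℝ
  nonneg : ∀ φ : A.domain, 0 ≤ ⟪A φ, (φ : E)⟫_ℝ

/-- The domain of `A`, to be given the inner product `⟪A φ, ψ⟫ + ⟪φ, ψ⟫`. -/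
def FormSpace {A : E →ₗ.[ℝ] E} (_ : IsNonnegSymm A) : Type _ := A.domain

variable {A : E →ₗ.[ℝ] E} (hA : IsNonnegSymm A)

instance : AddCommGroup (FormSpace hA) := inferInstanceAs (AddCommGroup A.domain)
instance : Module ℝ (FormSpace hA) := inferInstanceAs (Module ℝ A.domain)

/-- The inclusion of the domain of `A`. -/
def FormSpace.incl : FormSpace hA →ₗ[ℝ] E := A.domain.subtype

/-- The action of `A`. -/
def FormSpace.act : FormSpace hA →ₗ[ℝ] E := A.toFun

/-- The form inner product. -/
abbrev FormSpace.core : InnerProductSpace.Core ℝ (FormSpace hA) where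
  inner φ ψ := ⟪FormSpace.act hA φ, FormSpace.incl hA ψ⟫_ℝ
    + ⟪FormSpace.incl hA φ, FormSpace.incl hA ψ⟫_ℝ
  conj_inner_symm φ ψ := by
    have h := hA.symm ψ φ
    change ⟪FormSpace.act hA ψ, FormSpace.incl hA φ⟫_ℝ
      = ⟪FormSpace.incl hA ψ, FormSpace.act hA φ⟫_ℝ at h
    simp only [conj_trivial]
    rw [h, real_inner_comm, real_inner_comm (FormSpace.incl hA φ)]
  re_inner_nonneg φ := add_nonneg (hA.nonneg φ) real_inner_self_nonneg
  add_left φ ψ χ := by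
    simp only [map_add, inner_add_left]; ring
  smul_left φ ψ c := by
    simp only [map_smul, inner_smul_left, conj_trivial]; ring
  definite φ h := by
    have h1 : 0 ≤ ⟪FormSpace.act hA φ, FormSpace.incl hA φ⟫_ℝ := hA.nonneg φ
    have h2 : 0 ≤ ⟪FormSpace.incl hA φ, FormSpace.incl hA φ⟫_ℝ := real_inner_self_nonneg
    have h3 : ⟪FormSpace.incl hA φ, FormSpace.incl hA φ⟫_ℝ = 0 := by linarith
    exact Subtype.ext (inner_self_eq_zero.1 h3)

instance : NormedAddCommGroup (FormSpace hA) :=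
  @InnerProductSpace.Core.toNormedAddCommGroup ℝ _ _ _ _ (FormSpace.core hA)

instance : InnerProductSpace ℝ (FormSpace hA) := InnerProductSpace.ofCore _

theorem FormSpace.inner_def (φ ψ : FormSpace hA) :
    ⟪φ, ψ⟫_ℝ = ⟪FormSpace.act hA φ, FormSpace.incl hA ψ⟫_ℝ
      + ⟪FormSpace.incl hA φ, FormSpace.incl hA ψ⟫_ℝ := rfl

theorem FormSpace.norm_sq (φ : FormSpace hA) :
    ‖φ‖ ^ 2 = ⟪FormSpace.act hA φ, FormSpace.incl hA φ⟫_ℝ + ‖FormSpace.incl hA φ‖ ^ 2 := by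
  rw [← real_inner_self_eq_norm_sq, FormSpace.inner_def, real_inner_self_eq_norm_sq]

theorem FormSpace.norm_incl_le (φ : FormSpace hA) : ‖FormSpace.incl hA φ‖ ≤ 1 * ‖φ‖ := by
  have h1 : 0 ≤ ⟪FormSpace.act hA φ, FormSpace.incl hA φ⟫_ℝ := hA.nonneg φ
  rw [one_mul]
  refine abs_le_of_sq_le_sq' ?_ (norm_nonneg _) |>.2
  rw [FormSpace.norm_sq]; linarith

/-- The completion of the form space. -/
abbrev FormCompletion := UniformSpace.Completion (FormSpace hA)

/-- The embedding of the form space in its completion. -/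
def FormSpace.toC : FormSpace hA →ₗᵢ[ℝ] FormCompletion hA := UniformSpace.Completion.toComplₗᵢ

theorem FormSpace.denseRange_toC : DenseRange (FormSpace.toC hA) :=
  UniformSpace.Completion.denseRange_coe

theorem exists_seq_toC (v : FormCompletion hA) :
    ∃ φ : ℕ → FormSpace hA, Tendsto (fun n => FormSpace.toC hA (φ n)) atTop (𝓝 v) := by
  obtain ⟨u, hu, hlim⟩ := mem_closure_iff_seq_limit.1 (FormSpace.denseRange_toC hA v)
  choose φ hφ using hu
  exact ⟨φ, by simpa only [hφ] using hlim⟩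

variable [CompleteSpace E]

/-- The map from the completion of the form space to the ambient space. -/
def FormSpace.J : FormCompletion hA →L[ℝ] E :=
  (FormSpace.incl hA).extendOfNorm (FormSpace.toC hA).toLinearMap

theorem FormSpace.J_toC (φ : FormSpace hA) :
    FormSpace.J hA (FormSpace.toC hA φ) = FormSpace.incl hA φ :=
  LinearMap.extendOfNorm_eq (e := (FormSpace.toC hA).toLinearMap) (FormSpace.denseRange_toC hA)
    ⟨1, fun x => by
      simpa [LinearIsometry.norm_map] using FormSpace.norm_incl_le hA x⟩ φ

/-- The resolvent at `-1` of the Friedrichs extension. -/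
def FormSpace.R : E →L[ℝ] E :=
  FormSpace.J hA ∘L (ContinuousLinearMap.adjoint (FormSpace.J hA))

theorem FormSpace.inner_R (f g : E) :
    ⟪FormSpace.R hA f, g⟫_ℝ = ⟪ContinuousLinearMap.adjoint (FormSpace.J hA) f,
      ContinuousLinearMap.adjoint (FormSpace.J hA) g⟫_ℝ := by
  simp [FormSpace.R, ContinuousLinearMap.adjoint_inner_right]

theorem FormSpace.R_symm (f g : E) :
    ⟪FormSpace.R hA f, g⟫_ℝ = ⟪f, FormSpace.R hA g⟫_ℝ := by
  rw [FormSpace.inner_R, real_inner_comm (FormSpace.R hA g), FormSpace.inner_R, real_inner_comm]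

theorem tendsto_incl {φ : ℕ → FormSpace hA} {v : FormCompletion hA}
    (h : Tendsto (fun n => FormSpace.toC hA (φ n)) atTop (𝓝 v)) :
    Tendsto (fun n => FormSpace.incl hA (φ n)) atTop (𝓝 (FormSpace.J hA v)) := by
  have := ((FormSpace.J hA).continuous.tendsto v).comp h
  simpa only [Function.comp_def, FormSpace.J_toC] using this

theorem R_isFormLimit (f : E) : IsFormLimit A (FormSpace.R hA f) := by
  obtain ⟨φ, hφ⟩ := exists_seq_toC hA (ContinuousLinearMap.adjoint (FormSpace.J hA) f)
  refine ⟨φ, tendsto_incl hA hφ, ?_⟩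
  have hc := hφ.cauchySeq
  have h0 : Tendsto (fun p : ℕ × ℕ => ‖φ p.1 - φ p.2‖ ^ 2) atTop (𝓝 0) := by
    have h1 := tendsto_iff_norm_sub_tendsto_zero.1 hφ
    have h2 : Tendsto (fun p : ℕ × ℕ => dist (FormSpace.toC hA (φ p.1)) (FormSpace.toC hA (φ p.2)))
        atTop (𝓝 0) := by
      rw [cauchySeq_iff_tendsto_dist_atTop_0] at hc; exact hc
    have h3 := h2.pow 2
    simpa [dist_eq_norm, ← map_sub, LinearIsometry.norm_map] using h3
  refine squeeze_zero (fun p => hA.nonneg _) (fun p => ?_) h0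
  rw [FormSpace.norm_sq]
  have : 0 ≤ ‖FormSpace.incl hA (φ p.1 - φ p.2)‖ ^ 2 := by positivity
  exact le_add_of_nonneg_right this

/-- The weak form of `(A + 1) R f = f`. Approximating `J* f` in the form norm, the defining property
of the adjoint gives `⟪f, φ⟫` on one side; symmetry of `A` frees the approximants from `A` on the
other, so that only convergence in `E` is needed. -/
theorem inner_R_add_act (f : E) (φ : FormSpace hA) :
    ⟪FormSpace.R hA f, FormSpace.act hA φ⟫_ℝ = ⟪f - FormSpace.R hA f, FormSpace.incl hA φ⟫_ℝ := by
  obtain ⟨ψ, hψ⟩ := exists_seq_toC hA (ContinuousLinearMap.adjoint (FormSpace.J hA) f)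
  have h1 := tendsto_incl hA hψ
  have h2 : Tendsto (fun n => ⟪FormSpace.toC hA (ψ n), FormSpace.toC hA φ⟫_ℝ) atTop
      (𝓝 ⟪ContinuousLinearMap.adjoint (FormSpace.J hA) f, FormSpace.toC hA φ⟫_ℝ) :=
    hψ.inner tendsto_const_nhds
  rw [ContinuousLinearMap.adjoint_inner_left, FormSpace.J_toC] at h2
  simp only [LinearIsometry.inner_map_map, FormSpace.inner_def] at h2
  have h3 : Tendsto (fun n => ⟪FormSpace.incl hA (ψ n), FormSpace.act hA φ⟫_ℝ
      + ⟪FormSpace.incl hA (ψ n), FormSpace.incl hA φ⟫_ℝ) atTop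
      (𝓝 (⟪FormSpace.R hA f, FormSpace.act hA φ⟫_ℝ
        + ⟪FormSpace.R hA f, FormSpace.incl hA φ⟫_ℝ)) :=
    (h1.inner tendsto_const_nhds).add (h1.inner tendsto_const_nhds)
  have h4 : ∀ n, ⟪FormSpace.act hA (ψ n), FormSpace.incl hA φ⟫_ℝ
      = ⟪FormSpace.incl hA (ψ n), FormSpace.act hA φ⟫_ℝ := fun n => hA.symm (ψ n) φ
  simp only [h4] at h2
  have := tendsto_nhds_unique h2 h3
  rw [inner_sub_left]
  linarith

theorem R_mem_friedrichs (hd : Dense (A.domain : Set E)) (f : E) :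
    ∃ h : FormSpace.R hA f ∈ (friedrichs A).domain,
      friedrichs A ⟨FormSpace.R hA f, h⟩ = f - FormSpace.R hA f := by
  have hadj : ∀ φ : A.domain, ⟪f - FormSpace.R hA f, (φ : E)⟫_ℝ = ⟪FormSpace.R hA f, A φ⟫_ℝ :=
    fun φ => (inner_R_add_act hA f φ).symm
  have hm : FormSpace.R hA f ∈ A.adjoint.domain :=
    LinearPMap.mem_adjoint_domain_of_exists _ ⟨_, hadj⟩
  refine ⟨⟨Submodule.subset_span (R_isFormLimit hA f), hm⟩, ?_⟩
  exact LinearPMap.adjoint_apply_eq hd ⟨_, hm⟩ hadj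

theorem friedrichs_inner (hd : Dense (A.domain : Set E)) (u : (friedrichs A).domain) (φ : A.domain) :
    ⟪friedrichs A u, (φ : E)⟫_ℝ = ⟪(u : E), A φ⟫_ℝ :=
  LinearPMap.adjoint_isFormalAdjoint hd ⟨u, u.2.2⟩ φ

/-- If `u` is a form limit and `⟪u, (A + 1) φ⟫ = 0` for all `φ`, then `u = 0`. -/
theorem eq_zero_of_orthogonal {u : E} (hu : IsFormLimit A u)
    (h : ∀ φ : FormSpace hA, ⟪u, FormSpace.act hA φ + FormSpace.incl hA φ⟫_ℝ = 0) : u = 0 := by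
  obtain ⟨φ', hφ, hφ'⟩ := hu
  set φ : ℕ → FormSpace hA := φ' with hφdef
  have hcs : CauchySeq fun n => FormSpace.toC hA (φ n) := by
    rw [cauchySeq_iff_tendsto_dist_atTop_0]
    have h1 : Tendsto (fun p : ℕ × ℕ => ‖(φ' p.1 : E) - φ' p.2‖ ^ 2) atTop (𝓝 0) := by
      have := cauchySeq_iff_tendsto_dist_atTop_0.1 hφ.cauchySeq
      simpa [dist_eq_norm] using this.pow 2
    have h2 := (hφ'.add h1).sqrt
    simp only [add_zero, Real.sqrt_zero] at h2
    refine h2.congr fun p => ?_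
    have h3 : dist (FormSpace.toC hA (φ p.1)) (FormSpace.toC hA (φ p.2)) = ‖φ p.1 - φ p.2‖ := by
      rw [dist_eq_norm, ← map_sub, LinearIsometry.norm_map]
    rw [h3, ← Real.sqrt_sq (norm_nonneg (φ p.1 - φ p.2)), FormSpace.norm_sq]
    rfl
  obtain ⟨v, hv⟩ := cauchySeq_tendsto_of_complete hcs
  have hJ : FormSpace.J hA v = u := tendsto_nhds_unique (tendsto_incl hA hv) hφ
  -- The form product of `v` with `ψ` is the limit of `⟪φ n, (A + 1) ψ⟫`, so `v` is orthogonal to a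
  -- dense set. Since `u = J v` is recovered from `v = 0`, injectivity of `J` is not needed.
  have hz : ∀ w : FormCompletion hA, ⟪v, w⟫_ℝ = 0 := by
    intro w
    refine (FormSpace.denseRange_toC hA).induction_on w
      (isClosed_eq (by fun_prop) continuous_const) fun ψ => ?_
    have h1 : Tendsto (fun n => ⟪FormSpace.toC hA (φ n), FormSpace.toC hA ψ⟫_ℝ) atTop
      (𝓝 ⟪v, FormSpace.toC hA ψ⟫_ℝ) := hv.inner tendsto_const_nhds
    have h2 : Tendsto (fun n => ⟪(φ' n : E), FormSpace.act hA ψ + FormSpace.incl hA ψ⟫_ℝ) atTop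
      (𝓝 ⟪u, FormSpace.act hA ψ + FormSpace.incl hA ψ⟫_ℝ) := hφ.inner tendsto_const_nhds
    rw [h ψ] at h2
    refine tendsto_nhds_unique h1 (h2.congr fun n => ?_)
    have h3 : ⟪FormSpace.toC hA (φ n), FormSpace.toC hA ψ⟫_ℝ = ⟪φ n, ψ⟫_ℝ :=
      LinearIsometry.inner_map_map _ _ _
    rw [h3, FormSpace.inner_def, inner_add_right]
    congr 1
    exact (hA.symm (φ' n) ψ).symm
  have : v = 0 := inner_self_eq_zero.1 (hz v)
  rw [← hJ, this, map_zero]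

/-- The difference of the two sides is a form limit orthogonal to the range of `A + 1`, hence zero.
Here membership in the form domain, and not only in the adjoint domain, is essential. -/
theorem R_friedrichs (hd : Dense (A.domain : Set E))
    (u : (friedrichs A).domain) :
    FormSpace.R hA (friedrichs A u + u) = u := by
  have hu : IsFormLimit A (u : E) := (mem_formDomain_iff A hA.nonneg _).1 u.2.1
  set w : E := FormSpace.R hA (friedrichs A u + u) - u with hw
  have hwl : IsFormLimit A w := by
    rw [← mem_formDomain_iff A hA.nonneg]
    exact Submodule.sub_mem _ (Submodule.subset_span (R_isFormLimit hA _)) u.2.1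
  have := eq_zero_of_orthogonal hA hwl fun φ => by
    have h1 := inner_R_add_act hA (friedrichs A u + u) φ
    have h2 : ⟪friedrichs A u, FormSpace.incl hA φ⟫_ℝ = ⟪(u : E), FormSpace.act hA φ⟫_ℝ :=
      friedrichs_inner hd u φ
    rw [hw]
    simp only [inner_sub_left, inner_add_left, inner_add_right] at h1 ⊢
    linarith
  exact sub_eq_zero.1 (hw ▸ this)

theorem friedrichs_extends (hA : IsNonnegSymm A) (hd : Dense (A.domain : Set E)) (φ : A.domain) :
    ∃ h : (φ : E) ∈ (friedrichs A).domain, friedrichs A ⟨φ, h⟩ = A φ := by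
  have hadj : ∀ ψ : A.domain, ⟪A φ, (ψ : E)⟫_ℝ = ⟪(φ : E), A ψ⟫_ℝ := hA.symm φ
  have hm : (φ : E) ∈ A.adjoint.domain :=
    LinearPMap.mem_adjoint_domain_of_exists _ ⟨_, hadj⟩
  refine ⟨⟨Submodule.subset_span ⟨fun _ => φ, by simp, by simp⟩, hm⟩, ?_⟩
  exact LinearPMap.adjoint_apply_eq hd ⟨_, hm⟩ hadj

/-- Weyl's criterion with vectors from the domain of `A`. -/
theorem mem_realSpectrum_of_weyl (hA : IsNonnegSymm A)
    (hd : Dense (A.domain : Set E)) {z : ℝ}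
    (hw : ∀ ε > 0, ∃ φ : A.domain, (φ : E) ≠ 0 ∧ ‖A φ - z • (φ : E)‖ ≤ ε * ‖(φ : E)‖) :
    z ∈ realSpectrum (friedrichs A) := by
  rintro ⟨R, -, hR⟩
  obtain ⟨φ, h0, hφ⟩ := hw (1 / (2 * (‖R‖ + 1))) (by positivity)
  obtain ⟨hm, he⟩ := friedrichs_extends hA hd φ
  have h1 := hR ⟨φ, hm⟩
  rw [he] at h1
  have h2 : ‖(φ : E)‖ ≤ ‖R‖ * ‖A φ - z • (φ : E)‖ := by
    conv_lhs => rw [← h1]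
    exact R.le_opNorm _
  have h3 : 0 < ‖(φ : E)‖ := norm_pos_iff.2 h0
  have h4 : ‖R‖ * ‖A φ - z • (φ : E)‖ ≤ ‖R‖ * (1 / (2 * (‖R‖ + 1)) * ‖(φ : E)‖) := by gcongr
  have h5 : ‖R‖ * (1 / (2 * (‖R‖ + 1)) * ‖(φ : E)‖) ≤ 1 / 2 * ‖(φ : E)‖ := by
    rw [← mul_assoc]
    gcongr
    rw [mul_one_div, div_le_div_iff₀ (by positivity) (by norm_num)]
    linarith [norm_nonneg R]
  linarith

/-- A symmetric bounded operator that is bounded below is bijective. -/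
theorem exists_inverse_of_bounded_below (T : E →L[ℝ] E) (hs : ∀ x y, ⟪T x, y⟫_ℝ = ⟪x, T y⟫_ℝ)
    {c : ℝ} (hc : 0 < c) (hb : ∀ x, c * ‖x‖ ≤ ‖T x‖) :
    ∃ S : E →L[ℝ] E, (∀ x, T (S x) = x) ∧ ∀ x, S (T x) = x := by
  have hanti : AntilipschitzWith (Real.toNNReal c)⁻¹ T := by
    refine ContinuousLinearMap.antilipschitz_of_bound T fun x => ?_
    rw [NNReal.coe_inv, Real.coe_toNNReal c hc.le, inv_mul_eq_div, le_div_iff₀ hc, mul_comm]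
    exact hb x
  have hker : T.ker = ⊥ := LinearMap.ker_eq_bot.2 hanti.injective
  have hclosed : IsClosed (T.range : Set E) := hanti.isClosed_range T.uniformContinuous
  have hrange : T.range = ⊤ := by
    have := hclosed.completeSpace_coe
    rw [← T.range.orthogonal_orthogonal, Submodule.eq_top_iff']
    intro v w hw
    have h0 : T w = 0 := by
      have h1 := hw (T (T w)) ⟨T w, rfl⟩
      rw [hs] at h1
      exact inner_self_eq_zero.1 h1
    have : w = 0 := hanti.injective (by rw [h0, map_zero])
    rw [this, inner_zero_left]
  let e := ContinuousLinearEquiv.ofBijective T hker hrange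
  exact ⟨e.symm, fun x => e.apply_symm_apply x, fun x => e.symm_apply_apply x⟩

/-- With `F` the Friedrichs extension, `F - z = (F + 1) - (1 + z)`; so if `S` inverts `1 - (1 + z)
R`, the resolvent at `z` is `R S`. -/
theorem inResolventSet_of_inverse (hd : Dense (A.domain : Set E)) {z : ℝ} (S : E →L[ℝ] E)
    (h1 : ∀ x, S x - (1 + z) • FormSpace.R hA (S x) = x)
    (h2 : ∀ x, S (x - (1 + z) • FormSpace.R hA x) = x) :
    InResolventSet (friedrichs A) z := by
  refine ⟨FormSpace.R hA ∘L S, fun f => ?_, fun u => ?_⟩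
  · obtain ⟨hm, he⟩ := R_mem_friedrichs hA hd (S f)
    refine ⟨hm, ?_⟩
    simp only [ContinuousLinearMap.comp_apply]
    erw [he]
    conv_rhs => rw [← h1 f]
    module
  · have h3 := R_friedrichs hA hd u
    have h4 : friedrichs A u - z • (u : E)
        = (friedrichs A u + u) - (1 + z) • FormSpace.R hA (friedrichs A u + u) := by
      rw [h3]; module
    rw [ContinuousLinearMap.comp_apply, h4, h2, h3]

/-- The spectral gap of an operator with a Poincaré inequality that is sharp in the sense of
Weyl. -/
theorem lambda1_eq (hA : IsNonnegSymm A) (hd : Dense (A.domain : Set E))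
    {e : E} (he : ‖e‖ = 1) {lam : ℝ} (hlam : 0 < lam)
    (happrox : ∃ φ : ℕ → A.domain, Tendsto (fun n => (φ n : E)) atTop (𝓝 e) ∧
      Tendsto (fun n => A (φ n)) atTop (𝓝 0))
    (hpoinc : ∀ φ : A.domain, ∃ κ : ℝ, lam * ‖(φ : E) - κ • e‖ ^ 2 ≤ ⟪A φ, (φ : E)⟫_ℝ)
    (hw : ∀ ε > 0, ∃ φ : A.domain, (φ : E) ≠ 0 ∧ ‖A φ - lam • (φ : E)‖ ≤ ε * ‖(φ : E)‖) :
    lambda1 A = lam := by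
  have hee : ⟪e, e⟫_ℝ = 1 := by rw [real_inner_self_eq_norm_sq, he, one_pow]
  -- The optimal `κ` is `⟪φ, e⟫`. Written with the form norm and without `κ`, the inequality is
  -- closed and passes to the completion.
  have hform : ∀ φ : FormSpace hA, (1 + lam) * ‖FormSpace.incl hA φ‖ ^ 2
      - lam * ⟪FormSpace.incl hA φ, e⟫_ℝ ^ 2 ≤ ‖φ‖ ^ 2 := by
    intro φ
    obtain ⟨κ, hκ⟩ := hpoinc φ
    change lam * ‖FormSpace.incl hA φ - κ • e‖ ^ 2
      ≤ ⟪FormSpace.act hA φ, FormSpace.incl hA φ⟫_ℝ at hκ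
    rw [FormSpace.norm_sq]
    rw [norm_sub_sq_real, inner_smul_right, norm_smul, mul_pow, he] at hκ
    simp only [Real.norm_eq_abs, sq_abs, one_pow, mul_one] at hκ
    nlinarith [mul_nonneg hlam.le (sq_nonneg (⟪FormSpace.incl hA φ, e⟫_ℝ - κ))]
  have hformC : ∀ v : FormCompletion hA, (1 + lam) * ‖FormSpace.J hA v‖ ^ 2
      - lam * ⟪FormSpace.J hA v, e⟫_ℝ ^ 2 ≤ ‖v‖ ^ 2 := by
    intro v
    refine (FormSpace.denseRange_toC hA).induction_on v
      (isClosed_le (by fun_prop) (by fun_prop)) fun φ => ?_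
    rw [FormSpace.J_toC, LinearIsometry.norm_map]
    exact hform φ
  -- `e` is a form limit with `⟪e, A ψ⟫ = 0` for all `ψ`, so `R e - e` is a form limit orthogonal to
  -- the range of `A + 1`.
  have hRe : FormSpace.R hA e = e := by
    obtain ⟨φ, hφ, hAφ⟩ := happrox
    have hlim : IsFormLimit A e := by
      refine ⟨φ, hφ, ?_⟩
      have h1 : Tendsto (fun p : ℕ × ℕ => ⟪A (φ p.1) - A (φ p.2), (φ p.1 : E) - φ p.2⟫_ℝ) atTop
          (𝓝 ⟪(0 : E) - 0, e - e⟫_ℝ) := by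
        rw [← prod_atTop_atTop_eq]
        exact ((hAφ.comp tendsto_fst).sub (hAφ.comp tendsto_snd)).inner
          ((hφ.comp tendsto_fst).sub (hφ.comp tendsto_snd))
      simpa [LinearPMap.map_sub] using h1
    have h0 : ∀ ψ : FormSpace hA, ⟪e, FormSpace.act hA ψ⟫_ℝ = 0 := by
      intro ψ
      have h1 : Tendsto (fun n => ⟪(φ n : E), FormSpace.act hA ψ⟫_ℝ) atTop
        (𝓝 ⟪e, FormSpace.act hA ψ⟫_ℝ) := hφ.inner tendsto_const_nhds
      have h2 : Tendsto (fun n => ⟪A (φ n), FormSpace.incl hA ψ⟫_ℝ) atTop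
        (𝓝 ⟪(0 : E), FormSpace.incl hA ψ⟫_ℝ) := hAφ.inner tendsto_const_nhds
      rw [inner_zero_left] at h2
      exact tendsto_nhds_unique h1 (h2.congr fun n => hA.symm (φ n) ψ)
    have hwl : IsFormLimit A (FormSpace.R hA e - e) := by
      rw [← mem_formDomain_iff A hA.nonneg]
      exact Submodule.sub_mem _ (Submodule.subset_span (R_isFormLimit hA _))
        (Submodule.subset_span hlim)
    refine sub_eq_zero.1 (eq_zero_of_orthogonal hA hwl fun ψ => ?_)
    have h1 := inner_R_add_act hA e ψ
    have h2 := h0 ψ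
    simp only [inner_sub_left, inner_add_right] at h1 ⊢
    linarith
  have hR1 : ∀ f : E, ‖FormSpace.R hA f‖ ^ 2 ≤ ⟪FormSpace.R hA f, f⟫_ℝ := by
    intro f
    rw [FormSpace.inner_R, real_inner_self_eq_norm_sq]
    have h1 := hformC (ContinuousLinearMap.adjoint (FormSpace.J hA) f)
    have h2 : ⟪FormSpace.R hA f, e⟫_ℝ ^ 2 ≤ ‖FormSpace.R hA f‖ ^ 2 := by
      have := abs_real_inner_le_norm (FormSpace.R hA f) e
      rw [he, mul_one] at this
      rw [← sq_abs]; gcongr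
    change (1 + lam) * ‖FormSpace.R hA f‖ ^ 2 - lam * ⟪FormSpace.R hA f, e⟫_ℝ ^ 2 ≤ _ at h1
    nlinarith
  -- On `e^⊥` the rank-one correction drops out, because `R` is symmetric and fixes `e`. The bound
  -- is applied to `J* f`, whose squared norm is `⟪R f, f⟫`.
  have hR2 : ∀ f : E, ⟪f, e⟫_ℝ = 0 → (1 + lam) * ‖FormSpace.R hA f‖ ≤ ‖f‖ := by
    intro f hf
    have h1 := hformC (ContinuousLinearMap.adjoint (FormSpace.J hA) f)
    change (1 + lam) * ‖FormSpace.R hA f‖ ^ 2 - lam * ⟪FormSpace.R hA f, e⟫_ℝ ^ 2 ≤ _ at h1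
    rw [← real_inner_self_eq_norm_sq (ContinuousLinearMap.adjoint _ f), ← FormSpace.inner_R,
      FormSpace.R_symm hA f e, hRe, hf] at h1
    have h2 := real_inner_le_norm (FormSpace.R hA f) f
    rcases (norm_nonneg (FormSpace.R hA f)).eq_or_lt with h0 | h0
    · rw [← h0, mul_zero]; exact norm_nonneg f
    · refine le_of_mul_le_mul_right ?_ h0
      nlinarith
  have hres : ∀ z : ℝ, z ≠ 0 → z < lam → InResolventSet (friedrichs A) z := by
    intro z hz0 hz
    -- `T` is `-z` on `e`. On `e^⊥` it is bounded below: for `z ≤ -1` because there `T` is at least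
    -- the identity, otherwise because `(1 + z) / (1 + lam) < 1`. Orthogonality of the two pieces
    -- combines the bounds.
    let T : E →L[ℝ] E := ContinuousLinearMap.id ℝ E - (1 + z) • FormSpace.R hA
    have hT : ∀ x, T x = x - (1 + z) • FormSpace.R hA x := fun x => rfl
    have hTs : ∀ x y, ⟪T x, y⟫_ℝ = ⟪x, T y⟫_ℝ := fun x y => by
      simp only [hT, inner_sub_left, inner_sub_right, inner_smul_left, inner_smul_right,
        FormSpace.R_symm hA x y, conj_trivial]
    have hTe : T e = (-z) • e := by rw [hT, hRe]; module
    have hperp : ∃ c > 0, ∀ y, ⟪y, e⟫_ℝ = 0 → c * ‖y‖ ≤ ‖T y‖ := by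
      rcases le_total (1 + z) 0 with h | h
      · refine ⟨1, one_pos, fun y _ => ?_⟩
        have h1 : ‖y‖ ^ 2 ≤ ⟪T y, y⟫_ℝ := by
          rw [hT, inner_sub_left, inner_smul_left, real_inner_self_eq_norm_sq, conj_trivial]
          nlinarith [hR1 y, sq_nonneg ‖FormSpace.R hA y‖]
        have h2 := real_inner_le_norm (T y) y
        rcases (norm_nonneg y).eq_or_lt with h0 | h0
        · rw [← h0, mul_zero]; exact norm_nonneg _
        · refine le_of_mul_le_mul_right ?_ h0
          nlinarith
      · refine ⟨1 - (1 + z) / (1 + lam), ?_, fun y hy => ?_⟩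
        · rw [gt_iff_lt, sub_pos, div_lt_one (by linarith)]; linarith
        · have h1 := hR2 y hy
          have h2 : ‖y‖ - ‖(1 + z) • FormSpace.R hA y‖ ≤ ‖T y‖ := norm_sub_norm_le _ _
          rw [norm_smul, Real.norm_eq_abs, abs_of_nonneg h] at h2
          have h3 : ‖FormSpace.R hA y‖ ≤ ‖y‖ / (1 + lam) := by
            rw [le_div_iff₀ (by linarith)]; linarith
          have h4 := mul_le_mul_of_nonneg_left h3 h
          calc (1 - (1 + z) / (1 + lam)) * ‖y‖ = ‖y‖ - (1 + z) * (‖y‖ / (1 + lam)) := by ring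
            _ ≤ _ := by linarith
    obtain ⟨c, hc, hperp⟩ := hperp
    have hbelow : ∀ x, min c |z| * ‖x‖ ≤ ‖T x‖ := by
      intro x
      set a := ⟪x, e⟫_ℝ with ha
      set y := x - a • e with hy
      have hye : ⟪y, e⟫_ℝ = 0 := by
        rw [hy, inner_sub_left, inner_smul_left, hee, conj_trivial]; simp [ha]
      have hx : x = y + a • e := by rw [hy]; module
      have hTy : ⟪T y, e⟫_ℝ = 0 := by
        rw [hTs, hTe, inner_smul_right, hye, mul_zero]
      have hnx : ‖x‖ ^ 2 = ‖y‖ ^ 2 + a ^ 2 := by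
        rw [hx, norm_add_sq_real, inner_smul_right, hye, norm_smul, he]; simp
      have hnT : ‖T x‖ ^ 2 = ‖T y‖ ^ 2 + (a * z) ^ 2 := by
        have hTx : T x = T y + (-(a * z)) • e := by
          conv_lhs => rw [hx]
          rw [map_add, map_smul, hTe]; module
        rw [hTx, norm_add_sq_real, inner_smul_right, hTy, norm_smul, he, Real.norm_eq_abs, mul_one,
          sq_abs]
        ring
      refine abs_le_of_sq_le_sq' ?_ (norm_nonneg _) |>.2
      have hm0 : 0 ≤ min c |z| := le_min hc.le (abs_nonneg z)
      have h1 : (min c |z| * ‖y‖) ^ 2 ≤ ‖T y‖ ^ 2 := by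
        have := hperp y hye
        have h2 : min c |z| * ‖y‖ ≤ c * ‖y‖ := by gcongr; exact min_le_left _ _
        gcongr; linarith
      have h2 : (min c |z|) ^ 2 ≤ z ^ 2 := by
        rw [← sq_abs z]; gcongr; exact min_le_right _ _
      rw [mul_pow, hnx, hnT]
      nlinarith [sq_nonneg a]
    obtain ⟨S, hS1, hS2⟩ := exists_inverse_of_bounded_below T hTs
      (lt_min hc (abs_pos.2 hz0)) hbelow
    exact inResolventSet_of_inverse hA hd S hS1 hS2
  -- `lam` is a non-zero point of the spectrum, so no larger `l` is admissible. Whether `0` lies in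
  -- the spectrum does not matter.
  have hset : {l : ℝ | realSpectrum (friedrichs A) ⊆ {0} ∪ Ici l} = Iic lam := by
    ext l
    constructor
    · intro hl
      rcases hl (mem_realSpectrum_of_weyl hA hd hw) with h | h
      · exact absurd h hlam.ne'
      · exact h
    · intro hl z hz
      by_contra hcon
      rw [mem_union, not_or, mem_singleton_iff, mem_Ici, not_le] at hcon
      exact hz (hres z hcon.1 (hcon.2.trans_le hl))
  rw [lambda1, spectralGap, hset, csSup_Iic]

end FormSpace

/-! ### The gap criterion expressed by integrals of test functions. -/

section L2Criterion

variable {X : Type*} [MeasurableSpace X]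

theorem inner_toLp {μ : Measure X} {f g : X → ℝ} (hf : MemLp f 2 μ) (hg : MemLp g 2 μ) :
    ⟪hf.toLp f, hg.toLp g⟫_ℝ = ∫ x, f x * g x ∂μ := by
  rw [L2.inner_def]
  refine integral_congr_ae ?_
  filter_upwards [hf.coeFn_toLp, hg.coeFn_toLp] with x h1 h2
  rw [h1, h2]
  simp [mul_comm]

theorem norm_toLp_sq {μ : Measure X} {f : X → ℝ} (hf : MemLp f 2 μ) :
    ‖hf.toLp f‖ ^ 2 = ∫ x, f x ^ 2 ∂μ := by
  rw [← real_inner_self_eq_norm_sq, inner_toLp]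
  simp only [sq]

/-- A criterion for the value of the spectral gap of an operator on the `L²` space of a
probability measure. -/
theorem lambda1_neg_l2Operator (μ : Measure X) [IsProbabilityMeasure μ]
    (V : Submodule ℝ (X → ℝ)) (L : V →ₗ[ℝ] (X → ℝ))
    (hV : ∀ φ : V, MemLp (φ : X → ℝ) 2 μ) (hL : ∀ φ : V, MemLp (L φ) 2 μ)
    (hker : ∀ φ : V, (φ : X → ℝ) =ᵐ[μ] 0 → L φ =ᵐ[μ] 0) {lam : ℝ} (hlam : 0 < lam)
    (hdense : ∀ f : X → ℝ, MemLp f 2 μ → (∀ φ : V, ∫ x, (φ : X → ℝ) x * f x ∂μ = 0) → f =ᵐ[μ] 0)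
    (hsymm : ∀ φ ψ : V, ∫ x, L φ x * (ψ : X → ℝ) x ∂μ = ∫ x, (φ : X → ℝ) x * L ψ x ∂μ)
    (hpoinc : ∀ φ : V, ∃ κ : ℝ, lam * ∫ x, ((φ : X → ℝ) x - κ) ^ 2 ∂μ
      ≤ ∫ x, -(L φ x) * (φ : X → ℝ) x ∂μ)
    (hconst : ∃ φ : ℕ → V, Tendsto (fun n => ∫ x, ((φ n : X → ℝ) x - 1) ^ 2 ∂μ) atTop (𝓝 0) ∧
      Tendsto (fun n => ∫ x, (L (φ n) x) ^ 2 ∂μ) atTop (𝓝 0))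
    (hweyl : ∀ ε > 0, ∃ φ : V, 0 < ∫ x, ((φ : X → ℝ) x) ^ 2 ∂μ ∧
      ∫ x, (L φ x + lam * (φ : X → ℝ) x) ^ 2 ∂μ ≤ ε * ∫ x, ((φ : X → ℝ) x) ^ 2 ∂μ) :
    lambda1 (-l2Operator μ V L hV hL hker) = lam := by
  set A := -l2Operator μ V L hV hL hker with hAdef
  let ι : V → A.domain := fun φ => ⟨(hV φ).toLp φ, ⟨φ, rfl⟩⟩
  have hι : ∀ φ, ((ι φ : A.domain) : Lp ℝ 2 μ) = (hV φ).toLp φ := fun _ => rfl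
  have hAι : ∀ φ, A (ι φ) = -(hL φ).toLp (L φ) := fun φ => by
    exact congrArg Neg.neg (l2Operator_apply μ V L hV hL hker φ)
  have hsurj : ∀ u : A.domain, ∃ φ, u = ι φ := fun u => by
    obtain ⟨φ, hφ⟩ := (mem_l2Operator_domain μ V L hV hL hker u).1 u.2
    exact ⟨φ, Subtype.ext hφ.symm⟩
  -- The unit kernel vector is the class of the constant `1`. It need not come from `V`; `hconst`
  -- only asks that it be approximated.
  have he : MemLp (fun _ : X => (1 : ℝ)) 2 μ := memLp_const 1
  have henergy : ∀ φ : V, ⟪A (ι φ), (ι φ : Lp ℝ 2 μ)⟫_ℝ = ∫ x, -(L φ x) * (φ : X → ℝ) x ∂μ := by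
    intro φ
    rw [hAι, hι, inner_neg_left, inner_toLp, ← integral_neg]
    simp only [neg_mul]
  have hp : ∀ φ : A.domain, ∃ κ : ℝ, lam * ‖(φ : Lp ℝ 2 μ) - κ • he.toLp _‖ ^ 2
      ≤ ⟪A φ, (φ : Lp ℝ 2 μ)⟫_ℝ := by
    intro u
    obtain ⟨φ, rfl⟩ := hsurj u
    obtain ⟨κ, hκ⟩ := hpoinc φ
    refine ⟨κ, ?_⟩
    rw [henergy, hι, ← MemLp.toLp_const_smul, ← MemLp.toLp_sub, norm_toLp_sq]
    simpa using hκ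
  have hA : IsNonnegSymm A := by
    refine ⟨fun u v => ?_, fun u => ?_⟩
    · obtain ⟨φ, rfl⟩ := hsurj u
      obtain ⟨ψ, rfl⟩ := hsurj v
      rw [hAι, hAι, hι, hι, inner_neg_left, inner_neg_right, inner_toLp, inner_toLp, hsymm]
    · obtain ⟨κ, hκ⟩ := hp u
      exact le_trans (by positivity) hκ
  have hd : Dense (A.domain : Set (Lp ℝ 2 μ)) := by
    rw [Submodule.dense_iff_topologicalClosure_eq_top, Submodule.topologicalClosure_eq_top_iff,
      Submodule.eq_bot_iff]
    intro f hf
    have h1 : (f : X → ℝ) =ᵐ[μ] 0 := by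
      refine hdense f (Lp.memLp f) fun φ => ?_
      have h2 := hf _ (ι φ).2
      rw [hι] at h2
      have h3 : f = (Lp.memLp f).toLp f := (Lp.toLp_coeFn f (Lp.memLp f)).symm
      rw [h3, inner_toLp] at h2
      exact h2
    exact (Lp.eq_zero_iff_ae_eq_zero).2 h1
  refine lambda1_eq hA hd (e := he.toLp _) ?_ hlam ?_ hp ?_
  · have h1 := norm_toLp_sq he
    simp only [one_pow, integral_const, probReal_univ, smul_eq_mul, mul_one] at h1
    exact (pow_eq_one_iff_of_nonneg (norm_nonneg _) two_ne_zero).1 h1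
  · obtain ⟨φ, h1, h2⟩ := hconst
    have key : ∀ u : ℕ → Lp ℝ 2 μ, Tendsto (fun n => ‖u n‖ ^ 2) atTop (𝓝 0) →
        Tendsto (fun n => ‖u n‖) atTop (𝓝 0) := fun u hu => by
      have := hu.sqrt
      simpa [Real.sqrt_sq] using this
    refine ⟨fun n => ι (φ n), ?_, ?_⟩
    · rw [tendsto_iff_norm_sub_tendsto_zero]
      refine key _ (h1.congr fun n => ?_)
      rw [hι, ← MemLp.toLp_sub, norm_toLp_sq]
      simp
    · rw [tendsto_zero_iff_norm_tendsto_zero]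
      refine key _ (h2.congr fun n => ?_)
      rw [hAι, norm_neg, norm_toLp_sq]
  · intro ε hε
    obtain ⟨φ, h1, h2⟩ := hweyl (ε ^ 2) (by positivity)
    refine ⟨ι φ, ?_, ?_⟩
    · intro h0
      rw [← norm_toLp_sq (hV φ), ← hι, h0] at h1
      simp at h1
    · refine abs_le_of_sq_le_sq' ?_ (by positivity) |>.2
      rw [hAι, hι, ← norm_neg, mul_pow, norm_toLp_sq (hV φ)]
      refine le_trans (le_of_eq ?_) h2
      rw [show -(-(hL φ).toLp (L φ) - lam • (hV φ).toLp φ)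
        = (hL φ).toLp (L φ) + lam • (hV φ).toLp φ by module,
        ← MemLp.toLp_const_smul, ← MemLp.toLp_add, norm_toLp_sq]
      simp

theorem integral_normalize (m : Measure X) (f : X → ℝ) :
    ∫ x, f x ∂(normalize m) = ((m univ)⁻¹).toReal * ∫ x, f x ∂m := by
  rw [normalize, integral_smul_measure, smul_eq_mul]

/-- `lambda1_neg_l2Operator` for the normalization of a finite measure. -/
theorem lambda1_neg_l2Operator_normalize (m : Measure X) [IsFiniteMeasure m] (hm : m ≠ 0)
    (V : Submodule ℝ (X → ℝ)) (L : V →ₗ[ℝ] (X → ℝ))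
    (hV : ∀ φ : V, MemLp (φ : X → ℝ) 2 (normalize m)) (hL : ∀ φ : V, MemLp (L φ) 2 (normalize m))
    (hker : ∀ φ : V, (φ : X → ℝ) =ᵐ[normalize m] 0 → L φ =ᵐ[normalize m] 0)
    {lam : ℝ} (hlam : 0 < lam)
    (hdense : ∀ f : X → ℝ, MemLp f 2 m → (∀ φ : V, ∫ x, (φ : X → ℝ) x * f x ∂m = 0) → f =ᵐ[m] 0)
    (hsymm : ∀ φ ψ : V, ∫ x, L φ x * (ψ : X → ℝ) x ∂m = ∫ x, (φ : X → ℝ) x * L ψ x ∂m)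
    (hpoinc : ∀ φ : V, ∃ κ : ℝ, lam * ∫ x, ((φ : X → ℝ) x - κ) ^ 2 ∂m
      ≤ ∫ x, -(L φ x) * (φ : X → ℝ) x ∂m)
    (hconst : ∃ φ : ℕ → V, Tendsto (fun n => ∫ x, ((φ n : X → ℝ) x - 1) ^ 2 ∂m) atTop (𝓝 0) ∧
      Tendsto (fun n => ∫ x, (L (φ n) x) ^ 2 ∂m) atTop (𝓝 0))
    (hweyl : ∀ ε > 0, ∃ φ : V, 0 < ∫ x, ((φ : X → ℝ) x) ^ 2 ∂m ∧
      ∫ x, (L φ x + lam * (φ : X → ℝ) x) ^ 2 ∂m ≤ ε * ∫ x, ((φ : X → ℝ) x) ^ 2 ∂m) :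
    lambda1 (-l2Operator (normalize m) V L hV hL hker) = lam := by
  have hm0 : m univ ≠ 0 := by simpa using hm
  have hc0 : (m univ)⁻¹ ≠ 0 := ENNReal.inv_ne_zero.2 (measure_ne_top m univ)
  have hct : (m univ)⁻¹ ≠ ⊤ := ENNReal.inv_ne_top.2 hm0
  have hc : 0 < ((m univ)⁻¹).toReal := ENNReal.toReal_pos hc0 hct
  have : IsProbabilityMeasure (normalize m) :=
    ⟨by rw [normalize, Measure.smul_apply, smul_eq_mul, ENNReal.inv_mul_cancel hm0
      (measure_ne_top m univ)]⟩
  have hac : m ≪ normalize m := Measure.absolutelyContinuous_smul hc0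
  have hac' : normalize m ≪ m := Measure.smul_absolutelyContinuous
  refine lambda1_neg_l2Operator (normalize m) V L hV hL hker hlam ?_ ?_ ?_ ?_ ?_
  · intro f hf h
    have hmf : m = (m univ) • normalize m := by
      rw [normalize, smul_smul, ENNReal.mul_inv_cancel hm0 (measure_ne_top m univ), one_smul]
    have hf' : MemLp f 2 m := by
      rw [hmf]; exact hf.smul_measure (measure_ne_top m univ)
    refine hac'.ae_eq (hdense f hf' fun φ => ?_)
    have := h φ
    rw [integral_normalize] at this
    exact (mul_eq_zero.1 this).resolve_left hc.ne'
  · intro φ ψ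
    rw [integral_normalize, integral_normalize, hsymm]
  · intro φ
    obtain ⟨κ, hκ⟩ := hpoinc φ
    refine ⟨κ, ?_⟩
    rw [integral_normalize, integral_normalize, mul_left_comm]
    gcongr
  · obtain ⟨φ, h1, h2⟩ := hconst
    refine ⟨φ, ?_, ?_⟩
    · simpa only [integral_normalize, mul_zero] using h1.const_mul ((m univ)⁻¹).toReal
    · simpa only [integral_normalize, mul_zero] using h2.const_mul ((m univ)⁻¹).toReal
  · intro ε hε
    obtain ⟨φ, h1, h2⟩ := hweyl ε hε
    refine ⟨φ, ?_, ?_⟩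
    · rw [integral_normalize]; positivity
    · rw [integral_normalize, integral_normalize, mul_left_comm]
      gcongr

end L2Criterion

/-! ### The radial Poincaré inequality. -/

section RadialPoincare

/-- The radial density `r (1 + r²) ^ (-β)`. -/
def radialDensity (β r : ℝ) : ℝ := r * (1 + r ^ 2) ^ (-β)

theorem continuous_one_add_sq_rpow (c : ℝ) : Continuous fun r : ℝ => (1 + r ^ 2) ^ c :=
  Continuous.rpow_const (by fun_prop) fun r => Or.inl (by positivity)

theorem continuous_radialDensity (β : ℝ) : Continuous (radialDensity β) :=
  continuous_id.mul (continuous_one_add_sq_rpow _)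

theorem radialDensity_nonneg (β : ℝ) {r : ℝ} (hr : 0 ≤ r) : 0 ≤ radialDensity β r :=
  mul_nonneg hr (by positivity)

theorem radialDensity_pos (β : ℝ) {r : ℝ} (hr : 0 < r) : 0 < radialDensity β r :=
  mul_pos hr (by positivity)

theorem hasDerivAt_one_add_sq_rpow (c r : ℝ) :
    HasDerivAt (fun r : ℝ => (1 + r ^ 2) ^ c) (2 * c * r * (1 + r ^ 2) ^ (c - 1)) r := by
  have h1 : HasDerivAt (fun r : ℝ => 1 + r ^ 2) (2 * r) r := by
    simpa using (hasDerivAt_pow 2 r).const_add 1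
  convert h1.rpow_const (p := c) (Or.inl (by positivity)) using 1
  ring

/-- The tail integral of the radial density. -/
def radialTail (β r : ℝ) : ℝ := (1 + r ^ 2) ^ (1 - β) / (2 * (β - 1))

theorem hasDerivAt_radialTail {β : ℝ} (hβ : 1 < β) (r : ℝ) :
    HasDerivAt (radialTail β) (-radialDensity β r) r := by
  refine ((hasDerivAt_one_add_sq_rpow (1 - β) r).div_const (2 * (β - 1))).congr_deriv ?_
  have : β - 1 ≠ 0 := by linarith
  unfold radialDensity
  rw [show (1 : ℝ) - β - 1 = -β by ring]
  field_simp
  ring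

theorem tendsto_one_add_sq_rpow_atTop {c : ℝ} (hc : c < 0) :
    Tendsto (fun r : ℝ => (1 + r ^ 2) ^ c) atTop (𝓝 0) := by
  have h1 : Tendsto (fun r : ℝ => 1 + r ^ 2) atTop atTop :=
    tendsto_atTop_add_const_left _ _ (tendsto_pow_atTop two_ne_zero)
  have h2 := (tendsto_rpow_neg_atTop (y := -c) (by linarith)).comp h1
  simpa [Function.comp_def] using h2

theorem tendsto_radialTail {β : ℝ} (hβ : 1 < β) : Tendsto (radialTail β) atTop (𝓝 0) := by
  have := (tendsto_one_add_sq_rpow_atTop (c := 1 - β) (by linarith)).div_const (2 * (β - 1))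
  rw [zero_div] at this
  exact this

theorem integrableOn_radialDensity {β : ℝ} (hβ : 1 < β) :
    IntegrableOn (radialDensity β) (Ioi 0) := by
  have h := integrableOn_Ioi_deriv_of_nonneg' (a := (0 : ℝ)) (g := fun r => -radialTail β r)
    (g' := radialDensity β) (l := -0)
    (fun r _ => (hasDerivAt_radialTail hβ r).neg.congr_deriv (neg_neg _))
    (fun r hr => radialDensity_nonneg β (le_of_lt hr)) (tendsto_radialTail hβ).neg
  exact h

theorem integral_radialDensity {β : ℝ} (hβ : 1 < β) :
    ∫ r in Ioi 0, radialDensity β r = radialTail β 0 := by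
  have h := integral_Ioi_of_hasDerivAt_of_nonneg' (a := (0 : ℝ)) (g := fun r => -radialTail β r)
    (g' := radialDensity β) (l := -0)
    (fun r _ => (hasDerivAt_radialTail hβ r).neg.congr_deriv (neg_neg _))
    (fun r hr => radialDensity_nonneg β (le_of_lt hr)) (tendsto_radialTail hβ).neg
  rw [h]; ring

theorem integrableOn_Ioi_of_eventually_zero {f : ℝ → ℝ} (hf : Continuous f) {M : ℝ}
    (hM : ∀ r ≥ M, f r = 0) (a : ℝ) : IntegrableOn f (Ioi a) := by
  have h1 : Ioi a ⊆ Icc a M ∪ Ioi M := fun x hx => by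
    rcases le_or_gt x M with h | h
    · exact Or.inl ⟨le_of_lt hx, h⟩
    · exact Or.inr h
  refine IntegrableOn.mono_set (IntegrableOn.union ?_ ?_) h1
  · exact hf.continuousOn.integrableOn_Icc
  · exact (integrableOn_zero).congr_fun (fun x hx => (hM x (le_of_lt hx)).symm) measurableSet_Ioi

/-- The algebraic inequality behind the radial Poincaré inequality: with `W' = u ρ`, the
derivative of `W² q - 2 u W` is at most `(1 + r²) ρ p² / lam - ρ u²`. -/
theorem radial_pointwise {β lam A r u W p : ℝ} (hlam : 0 < lam) (hr : 0 < r)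
    (h1 : A * (A + 2 * β - 2) ≤ -lam) (h2 : 4 * A + 4 * β - 8 ≤ -lam) {T q q' ρ : ℝ}
    (hT : 0 < T) (hρ : ρ = r / T) (hq : q = (A * r ^ 2 + 2) * (T / (1 + r ^ 2)) / r ^ 2)
    (hq' : q' = ((2 * A * r * (T / (1 + r ^ 2))
      + (A * r ^ 2 + 2) * (2 * (β - 1) * r * (T / (1 + r ^ 2) ^ 2))) * r ^ 2
      - (A * r ^ 2 + 2) * (T / (1 + r ^ 2)) * (2 * r)) / (r ^ 2) ^ 2) :
    2 * W * (u * ρ) * q + W ^ 2 * q' - 2 * (p * W + u * (u * ρ))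
      ≤ (1 + r ^ 2) * p ^ 2 * ρ / lam - u ^ 2 * ρ := by
  have ht : (0 : ℝ) < 1 + r ^ 2 := by positivity
  have hρ0 : 0 < ρ := by rw [hρ]; positivity
  -- Riccati inequality. With `ψ = r² (1 + r²)^((A - 2)/2)` one has `q = ψ' / (ρ ψ)`, and the left
  -- side is `(ψ' / ρ)' / ψ`: the claim is that `ψ` is a supersolution. After factoring, `h1` and
  -- `h2` compare the coefficients of `r²` and of `1`.
  have key : q' + q ^ 2 * ρ ≤ -lam / ((1 + r ^ 2) * ρ) := by
    have e1 : q' + q ^ 2 * ρ = T / ((1 + r ^ 2) ^ 2 * r) *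
        ((A * (A + 2 * β - 2)) * r ^ 2 + (4 * A + 4 * β - 8)) := by
      rw [hq', hq, hρ]; field_simp; ring
    have e2 : -lam / ((1 + r ^ 2) * ρ) = T / ((1 + r ^ 2) ^ 2 * r) *
        (-lam * r ^ 2 + -lam) := by
      rw [hρ]; field_simp; ring
    rw [e1, e2]
    gcongr
  -- Two completed squares, plus `W²` times the defect in `key`.
  have e : (1 + r ^ 2) * p ^ 2 * ρ / lam - u ^ 2 * ρ
      - (2 * W * (u * ρ) * q + W ^ 2 * q' - 2 * (p * W + u * (u * ρ)))
      = ((1 + r ^ 2) * ρ * p + lam * W) ^ 2 / (lam * ((1 + r ^ 2) * ρ)) + ρ * (u - q * W) ^ 2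
        + W ^ 2 * (-lam / ((1 + r ^ 2) * ρ) - (q' + q ^ 2 * ρ)) := by
    field_simp; ring
  have h3 : 0 ≤ W ^ 2 * (-lam / ((1 + r ^ 2) * ρ) - (q' + q ^ 2 * ρ)) :=
    mul_nonneg (sq_nonneg _) (sub_nonneg.2 key)
  have h4 : 0 ≤ ρ * (u - q * W) ^ 2 := by positivity
  have h5 : 0 ≤ ((1 + r ^ 2) * ρ * p + lam * W) ^ 2 / (lam * ((1 + r ^ 2) * ρ)) := by positivity
  linarith

/-- By `radial_pointwise`, with `u = g - κ` and `p = g'`, the derivative of `H = W² q - 2 (g - κ) W`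
is at most the integrand of energy over `lam` minus variance. As `H` tends to zero at both ends, the
integral of that difference is non-negative. -/
theorem radial_poincare {β lam A : ℝ} (hβ : 1 < β) (hlam : 0 < lam)
    (h1 : A * (A + 2 * β - 2) ≤ -lam) (h2 : 4 * A + 4 * β - 8 ≤ -lam)
    {g g' : ℝ → ℝ} (hg : ∀ r, HasDerivAt g (g' r) r) (hg' : Continuous g') {M : ℝ}
    (hM : ∀ r ≥ M, g r = 0) :
    ∃ κ : ℝ, lam * ∫ r in Ioi 0, (g r - κ) ^ 2 * radialDensity β r
      ≤ ∫ r in Ioi 0, (1 + r ^ 2) * g' r ^ 2 * radialDensity β r := by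
  have hgc : Continuous g := continuous_iff_continuousAt.2 fun r => (hg r).continuousAt
  have hρc := continuous_radialDensity β
  have hg'M : ∀ r ≥ M + 1, g' r = 0 := by
    intro r hr
    have h : g =ᶠ[𝓝 r] fun _ => 0 := by
      filter_upwards [Ioi_mem_nhds (show M < r by linarith)] with x hx using hM x (le_of_lt hx)
    exact (hg r).unique ((hasDerivAt_const r (0 : ℝ)).congr_of_eventuallyEq h)
  have hS0 : 0 < radialTail β 0 := by
    have : 0 < β - 1 := by linarith
    rw [radialTail]; positivity
  set N := max M 1 with hN
  -- The mean of `g`; this choice makes `W` vanish at infinity as well as at `0`.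
  set κ := (∫ x in (0)..N, g x * radialDensity β x) / radialTail β 0 with hκ
  refine ⟨κ, ?_⟩
  -- `W` is the primitive of `(g - κ) ρ`. Using `radialTail` for the constant part makes `W`
  -- explicit beyond the support of `g`.
  set W : ℝ → ℝ := fun r => (∫ x in (0)..r, g x * radialDensity β x)
    - κ * (radialTail β 0 - radialTail β r) with hW
  have hWd : ∀ r, HasDerivAt W ((g r - κ) * radialDensity β r) r := by
    intro r
    have e1 : HasDerivAt (fun r => ∫ x in (0)..r, g x * radialDensity β x)
        (g r * radialDensity β r) r :=
      ((hgc.mul hρc).integral_hasStrictDerivAt 0 r).hasDerivAt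
    have e2 := (((hasDerivAt_radialTail hβ r).const_sub (radialTail β 0)).const_mul κ)
    exact (e1.sub e2).congr_deriv (by ring)
  have hW0 : W 0 = 0 := by simp [hW]
  have hWN : ∀ r ≥ N, W r = κ * radialTail β r := by
    intro r hr
    have e1 : ∫ x in (0)..r, g x * radialDensity β x
        = ∫ x in (0)..N, g x * radialDensity β x := by
      have hint : ∀ a b, IntervalIntegrable (fun x => g x * radialDensity β x) volume a b :=
        fun a b => (hgc.mul hρc).intervalIntegrable a b
      rw [← intervalIntegral.integral_add_adjacent_intervals (hint 0 N) (hint N r)]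
      have : ∫ x in N..r, g x * radialDensity β x = ∫ x in N..r, (0 : ℝ) := by
        refine intervalIntegral.integral_congr fun x hx => ?_
        rw [uIcc_of_le hr] at hx
        simp only [hM x ((le_max_left M 1).trans hx.1), zero_mul]
      rw [this]; simp
    have e2 : ∫ x in (0)..N, g x * radialDensity β x = κ * radialTail β 0 := by
      rw [hκ, div_mul_cancel₀ _ hS0.ne']
    simp only [hW]
    rw [e1, e2]; ring
  set q : ℝ → ℝ := fun r => (A * r ^ 2 + 2) * (1 + r ^ 2) ^ (β - 1) / r ^ 2 with hq
  set H : ℝ → ℝ := fun r => W r ^ 2 * q r - 2 * ((g r - κ) * W r) with hH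
  set F : ℝ → ℝ := fun r => (1 + r ^ 2) * g' r ^ 2 * radialDensity β r / lam
    - (g r - κ) ^ 2 * radialDensity β r with hF
  have hFc : Continuous F := by simp only [hF]; fun_prop
  have hFi1 : IntegrableOn (fun r => (1 + r ^ 2) * g' r ^ 2 * radialDensity β r) (Ioi 0) :=
    integrableOn_Ioi_of_eventually_zero (by fun_prop) (M := M + 1)
      (fun r hr => by rw [hg'M r hr]; ring) 0
  have hFi2 : IntegrableOn (fun r => (g r - κ) ^ 2 * radialDensity β r) (Ioi 0) := by
    have e1 : IntegrableOn (fun r => (g r ^ 2 - 2 * κ * g r) * radialDensity β r) (Ioi 0) :=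
      integrableOn_Ioi_of_eventually_zero (by fun_prop) (M := M)
        (fun r hr => by rw [hM r hr]; ring) 0
    have e2 := (integrableOn_radialDensity hβ).const_mul (κ ^ 2)
    refine (e1.add e2).congr (Eventually.of_forall fun r => ?_)
    simp only [Pi.add_apply]; ring
  have hFi : IntegrableOn F (Ioi 0) := (hFi1.div_const lam).sub hFi2
  have hHd : ∀ r, 0 < r → ∃ H', HasDerivAt H H' r ∧ H' ≤ F r := by
    intro r hr
    have ht : (0 : ℝ) < 1 + r ^ 2 := by positivity
    have d1 : HasDerivAt (fun r : ℝ => A * r ^ 2 + 2) (2 * A * r) r := by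
      exact (((hasDerivAt_pow 2 r).const_mul A).add_const 2).congr_deriv (by norm_num; ring)
    have d2 := d1.mul (hasDerivAt_one_add_sq_rpow (β - 1) r)
    have d3 : HasDerivAt (fun r : ℝ => r ^ 2) (2 * r) r := by simpa using hasDerivAt_pow 2 r
    have d4 := d2.div d3 (by positivity)
    have d5 := (((hWd r).pow 2).mul d4).sub
      ((((hg r).sub_const κ).mul (hWd r)).const_mul 2)
    refine ⟨_, d5, ?_⟩
    have hT : 0 < (1 + r ^ 2) ^ β := by positivity
    refine le_trans (le_of_eq ?_) (radial_pointwise (β := β) (A := A) (u := g r - κ) (W := W r)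
      (p := g' r) hlam hr h1 h2 hT
      (ρ := radialDensity β r) (by rw [radialDensity, Real.rpow_neg ht.le]; rfl) rfl rfl)
    simp only [Pi.mul_apply, Pi.pow_apply, Pi.div_apply, Nat.cast_ofNat]
    rw [show β - 1 - 1 = β - 2 by ring, Real.rpow_sub ht, Real.rpow_sub ht, Real.rpow_one,
      Real.rpow_two]
    ring
  -- `q` is of order `2 / r²` at the origin, but `W 0 = 0` and `ρ(0) = 0` give `W = o(r)`.
  have hH0 : Tendsto H (𝓝[>] 0) (𝓝 0) := by
    have e1 : Tendsto (fun r => W r / r) (𝓝[>] 0) (𝓝 0) := by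
      have := hasDerivAt_iff_tendsto_slope.1 (hWd 0)
      have h3 := this.mono_left (nhdsWithin_mono 0 (fun x (hx : x ∈ Ioi 0) => ne_of_gt hx))
      simp only [radialDensity, zero_mul, mul_zero] at h3
      refine h3.congr fun r => ?_
      rw [slope_def_field, hW0]; simp
    have e2 : Tendsto (fun r : ℝ => (A * r ^ 2 + 2) * (1 + r ^ 2) ^ (β - 1)) (𝓝[>] 0)
        (𝓝 ((A * 0 ^ 2 + 2) * (1 + 0 ^ 2) ^ (β - 1))) :=
      (((by fun_prop : Continuous fun r : ℝ => A * r ^ 2 + 2).mul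
        (continuous_one_add_sq_rpow (β - 1))).tendsto 0).mono_left nhdsWithin_le_nhds
    have e3 : Tendsto (fun r => 2 * ((g r - κ) * W r)) (𝓝[>] 0)
        (𝓝 (2 * ((g 0 - κ) * W 0))) := by
      have hc : Continuous fun r => 2 * ((g r - κ) * W r) := by
        have : Continuous W := continuous_iff_continuousAt.2 fun r => (hWd r).continuousAt
        fun_prop
      exact (hc.tendsto 0).mono_left nhdsWithin_le_nhds
    have e4 := ((e1.pow 2).mul e2).sub e3
    rw [hW0] at e4
    simp only [ne_eq, OfNat.ofNat_ne_zero, not_false_eq_true, zero_pow, zero_mul, mul_zero,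
      sub_zero] at e4
    refine e4.congr fun r => ?_
    simp only [hH, hq]
    ring
  -- Beyond the support `W = κ · radialTail`, so `W² q` is a constant times `(1 + r²)^(1 - β) (A + 2
  -- / r²)`.
  have hHtop : Tendsto H atTop (𝓝 0) := by
    have e1 : Tendsto (fun r : ℝ => (r ^ 2)⁻¹) atTop (𝓝 0) :=
      tendsto_inv_atTop_zero.comp (tendsto_pow_atTop two_ne_zero)
    have e2 := (((tendsto_one_add_sq_rpow_atTop (c := 1 - β) (by linarith)).mul
      ((e1.const_mul 2).const_add A)).const_mul (κ ^ 2 / (2 * (β - 1)) ^ 2)).add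
      ((tendsto_radialTail hβ).const_mul (2 * κ ^ 2))
    simp only [zero_mul, mul_zero, add_zero] at e2
    refine e2.congr' ?_
    filter_upwards [eventually_ge_atTop N] with r hr
    have hr0 : 0 < r := lt_of_lt_of_le one_pos ((le_max_right M 1).trans hr)
    have ht : (0 : ℝ) < 1 + r ^ 2 := by positivity
    simp only [hH, hq]
    rw [hWN r hr, hM r ((le_max_left M 1).trans hr), radialTail]
    have e3 : (1 + r ^ 2) ^ (β - 1) = ((1 + r ^ 2) ^ (1 - β))⁻¹ := by
      rw [← Real.rpow_neg ht.le]; congr 1; ring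
    rw [e3]
    have e4 : 0 < (1 + r ^ 2) ^ (1 - β) := by positivity
    have : β - 1 ≠ 0 := by linarith
    generalize (1 + r ^ 2) ^ (1 - β) = Y at *
    field_simp
    ring
  -- `K` is monotone with limit `0` at the origin and `∫ F` at infinity; comparing these limits
  -- avoids any integrability of `H'`.
  set K : ℝ → ℝ := fun r => (∫ x in (0)..r, F x) - H r with hK
  have hKd : ∀ r, 0 < r → ∃ K', HasDerivAt K K' r ∧ 0 ≤ K' := by
    intro r hr
    obtain ⟨H', e1, e2⟩ := hHd r hr
    exact ⟨_, (hFc.integral_hasStrictDerivAt 0 r).hasDerivAt.sub e1, sub_nonneg.2 e2⟩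
  have hKm : MonotoneOn K (Ioi 0) := by
    refine monotoneOn_of_deriv_nonneg (convex_Ioi 0) ?_ ?_ ?_
    · intro r hr
      obtain ⟨K', e1, -⟩ := hKd r hr
      exact e1.continuousAt.continuousWithinAt
    · intro r hr
      rw [interior_Ioi] at hr
      obtain ⟨K', e1, -⟩ := hKd r hr
      exact e1.differentiableAt.differentiableWithinAt
    · intro r hr
      rw [interior_Ioi] at hr
      obtain ⟨K', e1, e2⟩ := hKd r hr
      rw [e1.deriv]; exact e2
  have hK0 : Tendsto K (𝓝[>] 0) (𝓝 0) := by
    have e1 : Tendsto (fun r => ∫ x in (0)..r, F x) (𝓝[>] 0) (𝓝 (∫ x in (0)..(0 : ℝ), F x)) :=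
      ((hFc.integral_hasStrictDerivAt 0 0).hasDerivAt.continuousAt.tendsto).mono_left
        nhdsWithin_le_nhds
    simpa using e1.sub hH0
  have hKnonneg : ∀ r, 0 < r → 0 ≤ K r := by
    intro r hr
    refine le_of_tendsto hK0 ?_
    filter_upwards [Ioo_mem_nhdsGT hr] with x hx
    exact hKm hx.1 hr hx.2.le
  have hKtop : Tendsto K atTop (𝓝 (∫ x in Ioi 0, F x)) := by
    simpa using (intervalIntegral_tendsto_integral_Ioi 0 hFi tendsto_id).sub hHtop
  have hfin : 0 ≤ ∫ x in Ioi 0, F x :=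
    ge_of_tendsto hKtop (by filter_upwards [eventually_gt_atTop 0] with r hr using hKnonneg r hr)
  rw [integral_sub (hFi1.div_const lam) hFi2, integral_div, sub_nonneg, le_div_iff₀ hlam] at hfin
  linarith

end RadialPoincare

/-! ### The radial operator: symmetry, density, reduction to test functions. -/

section RadialOperator

theorem exists_forall_norm_ge_eq_zero {F : Type*} [NormedAddCommGroup F] {f : F → ℝ}
    (hf : HasCompactSupport f) : ∃ M : ℝ, ∀ x, M ≤ ‖x‖ → f x = 0 := by
  obtain ⟨R, hR⟩ := hf.isCompact.isBounded.subset_closedBall 0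
  refine ⟨R + 1, fun x hx => ?_⟩
  by_contra h
  have := hR (subset_tsupport f h)
  rw [mem_closedBall_zero_iff] at this
  linarith

theorem exists_forall_ge_eq_zero {f : ℝ → ℝ} (hf : HasCompactSupport f) :
    ∃ M : ℝ, ∀ x ≥ M, f x = 0 := by
  obtain ⟨M, hM⟩ := exists_forall_norm_ge_eq_zero hf
  exact ⟨M, fun x hx => hM x (le_trans hx (le_abs_self x))⟩

/-- The unnormalized radial measure in dimension two. -/
def radialMeasure (β : ℝ) : Measure ℝ :=
  (volume.restrict (Ioi 0)).withDensity
    fun r => ENNReal.ofReal (r ^ (2 - 1) * (1 + r ^ 2) ^ (-β))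

theorem radialMeasure_eq (β : ℝ) : radialMeasure β = (volume.restrict (Ioi 0)).withDensity
    fun r => ENNReal.ofReal (radialDensity β r) := by
  simp [radialMeasure, radialDensity]

theorem integral_radialMeasure (β : ℝ) (F : ℝ → ℝ) :
    ∫ r, F r ∂(radialMeasure β) = ∫ r in Ioi 0, F r * radialDensity β r := by
  rw [radialMeasure_eq, integral_withDensity_eq_integral_toReal_smul
    (continuous_radialDensity β).measurable.ennreal_ofReal
    (Eventually.of_forall fun _ => ENNReal.ofReal_lt_top)]
  refine setIntegral_congr_fun measurableSet_Ioi fun r hr => ?_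
  simp only [smul_eq_mul]
  rw [ENNReal.toReal_ofReal (radialDensity_nonneg β (le_of_lt hr)), mul_comm]

theorem integrable_radialMeasure_iff (β : ℝ) (F : ℝ → ℝ) :
    Integrable F (radialMeasure β) ↔ IntegrableOn (fun r => F r * radialDensity β r) (Ioi 0) := by
  rw [radialMeasure_eq, integrable_withDensity_iff_integrable_smul'
    (continuous_radialDensity β).measurable.ennreal_ofReal
    (Eventually.of_forall fun _ => ENNReal.ofReal_lt_top)]
  refine integrableOn_congr_fun (fun r hr => ?_) measurableSet_Ioi
  simp only [smul_eq_mul]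
  rw [ENNReal.toReal_ofReal (radialDensity_nonneg β (le_of_lt hr)), mul_comm]

theorem isFiniteMeasure_radialMeasure {β : ℝ} (hβ : 1 < β) : IsFiniteMeasure (radialMeasure β) := by
  rw [radialMeasure_eq]
  exact isFiniteMeasure_withDensity_ofReal (integrableOn_radialDensity hβ).2

theorem radialMeasure_ne_zero {β : ℝ} (hβ : 1 < β) : radialMeasure β ≠ 0 := by
  intro h
  have h1 := integral_radialMeasure β (fun _ => 1)
  rw [h, integral_zero_measure] at h1
  simp only [one_mul] at h1
  rw [integral_radialDensity hβ, radialTail] at h1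
  have : 0 < β - 1 := by linarith
  have : (0 : ℝ) < (1 + 0 ^ 2) ^ (1 - β) / (2 * (β - 1)) := by positivity
  linarith

theorem ae_pos_radialMeasure (β : ℝ) : ∀ᵐ r ∂(radialMeasure β), 0 < r :=
  (withDensity_absolutelyContinuous _ _).ae_le (ae_restrict_mem measurableSet_Ioi)

/-- Divergence form: `ρ L φ = (r (1 + r²)^(1 - β) φ')'`. The factor `r` kills the boundary term at
the origin. The auxiliary `a` is the integrand with `r · (1 / r)` simplified, hence continuous at
`0`. -/
theorem integral_radialExpr_mul (β : ℝ) (φ ψ : neumannFunctions) :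
    ∫ r, radialExpr 2 β φ r * (ψ : ℝ → ℝ) r ∂(radialMeasure β)
      = -∫ r in Ioi 0, (1 + r ^ 2) * (deriv φ r * deriv ψ r) * radialDensity β r := by
  obtain ⟨φ, hφ, hφs, -⟩ := φ
  obtain ⟨ψ, hψ, hψs, -⟩ := ψ
  simp only
  have dφ : ContDiff ℝ ∞ (deriv φ) := (contDiff_infty_iff_deriv.1 hφ).2
  have ddφ : ContDiff ℝ ∞ (deriv (deriv φ)) := (contDiff_infty_iff_deriv.1 dφ).2
  have dψ : ContDiff ℝ ∞ (deriv ψ) := (contDiff_infty_iff_deriv.1 hψ).2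
  have c1 := dφ.continuous
  have c2 := ddφ.continuous
  have c3 := hψ.continuous
  have c4 := dψ.continuous
  have c5 := continuous_one_add_sq_rpow (1 - β)
  have c6 := continuous_one_add_sq_rpow (-β)
  have c7 := continuous_radialDensity β
  obtain ⟨M, hM⟩ := exists_forall_ge_eq_zero hψs
  obtain ⟨M', hM'⟩ := exists_forall_ge_eq_zero hψs.deriv
  set a : ℝ → ℝ := fun r => (1 + (3 - 2 * β) * r ^ 2) * (1 + r ^ 2) ^ (-β) * deriv φ r * ψ r
    + (1 + r ^ 2) * radialDensity β r * deriv (deriv φ) r * ψ r with ha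
  set b : ℝ → ℝ := fun r => (1 + r ^ 2) * (deriv φ r * deriv ψ r) * radialDensity β r with hb
  have hai : IntegrableOn a (Ioi 0) :=
    integrableOn_Ioi_of_eventually_zero (by simp only [ha]; fun_prop) (M := M)
      (fun r hr => by simp only [ha, hM r hr]; ring) 0
  have hbi : IntegrableOn b (Ioi 0) :=
    integrableOn_Ioi_of_eventually_zero (by simp only [hb]; fun_prop) (M := M')
      (fun r hr => by simp only [hb, hM' r hr]; ring) 0
  have hpow : ∀ r : ℝ, (1 + r ^ 2) ^ (1 - β) = (1 + r ^ 2) * (1 + r ^ 2) ^ (-β) := fun r => by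
    rw [sub_eq_add_neg, Real.rpow_add (by positivity), Real.rpow_one]
  have hd : ∀ r, HasDerivAt (fun r => r * (1 + r ^ 2) ^ (1 - β) * deriv φ r * ψ r) (a r + b r) r := by
    intro r
    have e1 := (((hasDerivAt_id r).mul (hasDerivAt_one_add_sq_rpow (1 - β) r)).mul
      (dφ.differentiable (by simp) r).hasDerivAt).mul (hψ.differentiable (by simp) r).hasDerivAt
    refine e1.congr_deriv ?_
    simp only [Pi.mul_apply, id_eq, ha, hb, radialDensity]
    rw [hpow, show 1 - β - 1 = -β by ring]
    ring
  have hlim : Tendsto (fun r => r * (1 + r ^ 2) ^ (1 - β) * deriv φ r * ψ r) atTop (𝓝 0) :=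
    tendsto_const_nhds.congr' (by
      filter_upwards [eventually_ge_atTop M] with r hr
      rw [hM r hr, mul_zero])
  have hint := integral_Ioi_of_hasDerivAt_of_tendsto' (a := (0 : ℝ)) (fun r _ => hd r)
    (hai.add hbi) hlim
  rw [integral_add hai hbi] at hint
  simp only [zero_mul, sub_zero] at hint
  have hexpr : ∫ r, radialExpr 2 β φ r * ψ r ∂(radialMeasure β) = ∫ r in Ioi 0, a r := by
    rw [integral_radialMeasure]
    refine setIntegral_congr_fun measurableSet_Ioi fun r hr => ?_
    have hr' : r ≠ 0 := ne_of_gt hr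
    simp only [radialExpr, ha, radialDensity]
    push_cast
    field_simp
    ring
  rw [hexpr]
  linarith

/-- Functions with compact support inside `(0, ∞)` satisfy the Neumann condition trivially and
already separate. -/
theorem radialMeasure_ae_eq_zero {β : ℝ} (hβ : 1 < β) (f : ℝ → ℝ)
    (hf : MemLp f 2 (radialMeasure β))
    (h : ∀ φ : neumannFunctions, ∫ x, (φ : ℝ → ℝ) x * f x ∂(radialMeasure β) = 0) :
    f =ᵐ[radialMeasure β] 0 := by
  have := isFiniteMeasure_radialMeasure hβ
  have hfi : Integrable f (radialMeasure β) := hf.integrable (by norm_num)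
  have h1 := isOpen_Ioi.ae_eq_zero_of_integral_contDiff_smul_eq_zero (U := Ioi (0 : ℝ))
    (hfi.locallyIntegrable.locallyIntegrableOn _) (fun g hg hgs hgt => by
      have hz : g =ᶠ[𝓝 0] fun _ => 0 := notMem_tsupport_iff_eventuallyEq.1
        fun h0 => lt_irrefl (0 : ℝ) (hgt h0)
      exact h ⟨g, hg, hgs, by rw [hz.deriv_eq]; exact deriv_const 0 (0 : ℝ)⟩)
  filter_upwards [h1, ae_pos_radialMeasure β] with r hr hr0 using hr hr0

/-- The value of the radial spectral gap, given the parameter of the radial Poincaré inequality and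
almost constant and almost extremal functions. -/
theorem lambda1_radialOperator_eq {β lam A : ℝ} (hβ : 1 < β) (hlam : 0 < lam)
    (h1 : A * (A + 2 * β - 2) ≤ -lam) (h2 : 4 * A + 4 * β - 8 ≤ -lam)
    (hconst : ∃ φ : ℕ → neumannFunctions,
      Tendsto (fun n => ∫ x, ((φ n : ℝ → ℝ) x - 1) ^ 2 ∂(radialMeasure β)) atTop (𝓝 0) ∧
      Tendsto (fun n => ∫ x, (radialExpr 2 β (φ n) x) ^ 2 ∂(radialMeasure β)) atTop (𝓝 0))
    (hweyl : ∀ ε > 0, ∃ φ : neumannFunctions, 0 < ∫ x, ((φ : ℝ → ℝ) x) ^ 2 ∂(radialMeasure β) ∧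
      ∫ x, (radialExpr 2 β φ x + lam * (φ : ℝ → ℝ) x) ^ 2 ∂(radialMeasure β)
        ≤ ε * ∫ x, ((φ : ℝ → ℝ) x) ^ 2 ∂(radialMeasure β)) :
    lambda1 (-radialOperator 2 β) = lam := by
  have := isFiniteMeasure_radialMeasure hβ
  refine lambda1_neg_l2Operator_normalize (radialMeasure β) (radialMeasure_ne_zero hβ)
    neumannFunctions (radialMap 2 β) _ _ _ hlam (radialMeasure_ae_eq_zero hβ) ?_ ?_ hconst hweyl
  · intro φ ψ
    have e1 := integral_radialExpr_mul β φ ψ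
    have e2 := integral_radialExpr_mul β ψ φ
    simp only [mul_comm (deriv (ψ : ℝ → ℝ) _)] at e2
    refine e1.trans (e2.symm.trans ?_)
    exact integral_congr_ae (Eventually.of_forall fun x => mul_comm _ _)
  · intro φ
    obtain ⟨M, hM⟩ := exists_forall_ge_eq_zero φ.2.2.1
    obtain ⟨κ, hκ⟩ := radial_poincare hβ hlam h1 h2
      (fun r => (φ.2.1.differentiable (by simp) r).hasDerivAt)
      (contDiff_infty_iff_deriv.1 φ.2.1).2.continuous hM
    refine ⟨κ, ?_⟩
    rw [integral_radialMeasure]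
    refine hκ.trans (le_of_eq ?_)
    have e1 := integral_radialExpr_mul β φ φ
    have e2 : ∫ x, -(radialMap 2 β φ x) * (φ : ℝ → ℝ) x ∂(radialMeasure β)
        = -∫ x, radialExpr 2 β φ x * (φ : ℝ → ℝ) x ∂(radialMeasure β) := by
      rw [← integral_neg]
      exact integral_congr_ae (Eventually.of_forall fun x => neg_mul _ _)
    rw [e2, e1, neg_neg]
    simp only [sq]

end RadialOperator

/-! ### Functions of the squared radius, and cutoffs. -/

section SquareFunctions

/-- The common action of both operators on functions `G` of the squared distance `s` to the
origin. -/
def sqExpr (β : ℝ) (G : ℝ → ℝ) (s : ℝ) : ℝ :=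
  4 * s * (1 + s) * deriv (deriv G) s + (4 + (8 - 4 * β) * s) * deriv G s

theorem hasCompactSupport_of_norm_ge {F : Type*} [NormedAddCommGroup F] [ProperSpace F]
    {f : F → ℝ} {M : ℝ} (h : ∀ x, M ≤ ‖x‖ → f x = 0) : HasCompactSupport f :=
  HasCompactSupport.intro (isCompact_closedBall 0 M) fun x hx => h x (by
    rw [mem_closedBall_zero_iff, not_le] at hx; exact hx.le)

theorem hasCompactSupport_comp_norm_sq {F : Type*} [NormedAddCommGroup F] [ProperSpace F]
    {G : ℝ → ℝ} (hG : HasCompactSupport G) : HasCompactSupport fun x : F => G (‖x‖ ^ 2) := by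
  obtain ⟨M, hM⟩ := exists_forall_ge_eq_zero hG
  refine hasCompactSupport_of_norm_ge (M := max M 1) fun x hx => hM _ ?_
  have h1 : M ≤ ‖x‖ := (le_max_left _ _).trans hx
  have h2 : 1 ≤ ‖x‖ := (le_max_right _ _).trans hx
  nlinarith

theorem hasDerivAt_comp_sq {G : ℝ → ℝ} (hG : ContDiff ℝ ∞ G) (r : ℝ) :
    HasDerivAt (fun r => G (r ^ 2)) (deriv G (r ^ 2) * (2 * r)) r := by
  have h1 : HasDerivAt (fun r : ℝ => r ^ 2) (2 * r) r := by simpa using hasDerivAt_pow 2 r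
  exact (hG.differentiable (by simp) (r ^ 2)).hasDerivAt.comp r h1

theorem deriv_comp_sq {G : ℝ → ℝ} (hG : ContDiff ℝ ∞ G) :
    deriv (fun r => G (r ^ 2)) = fun r => deriv G (r ^ 2) * (2 * r) :=
  funext fun r => (hasDerivAt_comp_sq hG r).deriv

/-- A smooth compactly supported function of `r²`. -/
def neumannSq (G : ℝ → ℝ) (hG : ContDiff ℝ ∞ G) (hs : HasCompactSupport G) : neumannFunctions :=
  ⟨fun r => G (r ^ 2), hG.comp (by fun_prop), by
    simpa using hasCompactSupport_comp_norm_sq (F := ℝ) hs, by rw [deriv_comp_sq hG]; simp⟩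

theorem radialExpr_comp_sq (β : ℝ) {G : ℝ → ℝ} (hG : ContDiff ℝ ∞ G) {r : ℝ} (hr : 0 < r) :
    radialExpr 2 β (fun r => G (r ^ 2)) r = sqExpr β G (r ^ 2) := by
  have h1 : HasDerivAt (fun r => deriv G (r ^ 2) * (2 * r))
      (deriv (deriv G) (r ^ 2) * (2 * r) * (2 * r) + deriv G (r ^ 2) * (2 * 1)) r :=
    (hasDerivAt_comp_sq (contDiff_infty_iff_deriv.1 hG).2 r).mul ((hasDerivAt_id r).const_mul 2)
  rw [radialExpr, deriv_comp_sq hG, h1.deriv, sqExpr]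
  push_cast
  field_simp
  ring

theorem laplacian_eq_sum_fderiv {h : Euc 2 → ℝ} (hh : ContDiff ℝ ∞ h) (x : Euc 2) :
    Laplacian.laplacian h x = ∑ i, fderiv ℝ (fun y => fderiv ℝ h y
      (EuclideanSpace.basisFun (Fin 2) ℝ i)) x (EuclideanSpace.basisFun (Fin 2) ℝ i) := by
  rw [InnerProductSpace.laplacian_eq_iteratedFDeriv_orthonormalBasis h
    (EuclideanSpace.basisFun (Fin 2) ℝ)]
  refine Finset.sum_congr rfl fun i _ => ?_
  rw [iteratedFDeriv_two_apply]
  have h1 : DifferentiableAt ℝ (fderiv ℝ h) x :=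
    (hh.fderiv_right (m := ∞) (by simp)).differentiable (by simp) x
  rw [fderiv_clm_apply h1 (differentiableAt_const _)]
  simp

theorem fderiv_affine_mul_comp_norm_sq (c : ℝ) (L : Euc 2 →L[ℝ] ℝ) {G : ℝ → ℝ}
    (hG : ContDiff ℝ ∞ G) (x v : Euc 2) :
    fderiv ℝ (fun x : Euc 2 => (c + L x) * G (‖x‖ ^ 2)) x v
      = L v * G (‖x‖ ^ 2) + (c + L x) * (deriv G (‖x‖ ^ 2) * (2 * ⟪x, v⟫_ℝ)) := by
  have h1 : HasFDerivAt (fun x : Euc 2 => ‖x‖ ^ 2) (2 • (innerSL ℝ x)) x := by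
    simpa using (hasStrictFDerivAt_norm_sq x).hasFDerivAt
  have h2 := (hG.differentiable (by simp) (‖x‖ ^ 2)).hasDerivAt.comp_hasFDerivAt x h1
  have h3 := (L.hasFDerivAt (x := x)).const_add c
  refine (congrArg (fun T : Euc 2 →L[ℝ] ℝ => T v) (h3.mul h2).fderiv).trans ?_
  simp
  ring

/-- One computation for two symmetry types: `c = 1`, `L = 0` gives radial functions, `c = 0` the
first angular mode. For `c = 0` and `G = 1` the result is `2 (1 - β) L x`, the eigenvalue equation
of linear functions. -/
theorem fullExpr_affine_mul_comp_norm_sq (β c : ℝ) (L : Euc 2 →L[ℝ] ℝ) {G : ℝ → ℝ}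
    (hG : ContDiff ℝ ∞ G) (x : Euc 2) :
    fullExpr 2 β (fun x => (c + L x) * G (‖x‖ ^ 2)) x
      = (c + L x) * sqExpr β G (‖x‖ ^ 2) + L x * (4 * (1 + ‖x‖ ^ 2) * deriv G (‖x‖ ^ 2)
        + 2 * (1 - β) * G (‖x‖ ^ 2)) := by
  have hG' : ContDiff ℝ ∞ (deriv G) := (contDiff_infty_iff_deriv.1 hG).2
  have hh : ContDiff ℝ ∞ (fun x : Euc 2 => (c + L x) * G (‖x‖ ^ 2)) :=
    (contDiff_const.add L.contDiff).mul (hG.comp (contDiff_norm_sq ℝ))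
  have hlap : ∀ i, fderiv ℝ (fun y => fderiv ℝ (fun x : Euc 2 => (c + L x) * G (‖x‖ ^ 2)) y
      (EuclideanSpace.basisFun (Fin 2) ℝ i)) x (EuclideanSpace.basisFun (Fin 2) ℝ i)
      = L (EuclideanSpace.basisFun (Fin 2) ℝ i) * x i * (4 * deriv G (‖x‖ ^ 2))
        + (c + L x) * (4 * deriv (deriv G) (‖x‖ ^ 2) * x i ^ 2 + 2 * deriv G (‖x‖ ^ 2)) := by
    intro i
    set e := EuclideanSpace.basisFun (Fin 2) ℝ i with he
    have hxe : ⟪x, e⟫_ℝ = x i := by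
      rw [he, real_inner_comm]; simp [EuclideanSpace.inner_single_left]
    have hee : ⟪e, e⟫_ℝ = 1 := by rw [he]; simp
    have h1 : HasFDerivAt (fun x : Euc 2 => ‖x‖ ^ 2) (2 • (innerSL ℝ x)) x := by
      simpa using (hasStrictFDerivAt_norm_sq x).hasFDerivAt
    have h2 := (hG.differentiable (by simp) (‖x‖ ^ 2)).hasDerivAt.comp_hasFDerivAt x h1
    have h2' := (hG'.differentiable (by simp) (‖x‖ ^ 2)).hasDerivAt.comp_hasFDerivAt x h1
    have h3 := (L.hasFDerivAt (x := x)).const_add c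
    have h4 : HasFDerivAt (fun y : Euc 2 => 2 * ⟪y, e⟫_ℝ) ((2 : ℝ) • innerSL ℝ e) x := by
      have : (fun y : Euc 2 => 2 * ⟪y, e⟫_ℝ) = fun y => ((2 : ℝ) • innerSL ℝ e) y := by
        funext y; simp [real_inner_comm]
      rw [this]
      exact ContinuousLinearMap.hasFDerivAt _
    have h5 := (h2.const_mul (L e)).add (h3.mul (h2'.mul h4))
    have h6 : (fun y => fderiv ℝ (fun x : Euc 2 => (c + L x) * G (‖x‖ ^ 2)) y e)
        = fun y => L e * G (‖y‖ ^ 2) + (c + L y) * (deriv G (‖y‖ ^ 2) * (2 * ⟪y, e⟫_ℝ)) :=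
      funext fun y => fderiv_affine_mul_comp_norm_sq c L hG y e
    have h7 := h5.fderiv
    rw [h6]
    refine (congrArg (fun T : Euc 2 →L[ℝ] ℝ => T e) h7).trans ?_
    simp only [add_apply, smul_apply, smul_eq_mul, innerSL_apply_apply, hxe, hee,
      Function.comp_apply, nsmul_eq_mul, Pi.mul_apply]
    push_cast
    ring
  have hL : L x = ∑ i, L (EuclideanSpace.basisFun (Fin 2) ℝ i) * x i := by
    conv_lhs => rw [← (EuclideanSpace.basisFun (Fin 2) ℝ).sum_repr x]
    simp [mul_comm]
  have hx : ‖x‖ ^ 2 = ∑ i, x i ^ 2 := EuclideanSpace.real_norm_sq_eq x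
  rw [fullExpr, laplacian_eq_sum_fderiv hh, inner_gradient_right,
    fderiv_affine_mul_comp_norm_sq c L hG, real_inner_self_eq_norm_sq, conj_trivial]
  simp only [hlap, Finset.sum_add_distrib, ← Finset.sum_mul, ← Finset.mul_sum, ← hL, ← hx, sqExpr]
  simp
  ring

theorem contDiff_affine_mul_comp_norm_sq (c : ℝ) (L : Euc 2 →L[ℝ] ℝ) {G : ℝ → ℝ}
    (hG : ContDiff ℝ ∞ G) : ContDiff ℝ ∞ (fun x : Euc 2 => (c + L x) * G (‖x‖ ^ 2)) :=
  (contDiff_const.add L.contDiff).mul (hG.comp (contDiff_norm_sq ℝ))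

/-- The test function `(c + L x) G(‖x‖²)`. -/
def testAffineSq (c : ℝ) (L : Euc 2 →L[ℝ] ℝ) (G : ℝ → ℝ) (hG : ContDiff ℝ ∞ G)
    (hs : HasCompactSupport G) : testFunctions 2 :=
  ⟨fun x => (c + L x) * G (‖x‖ ^ 2), contDiff_affine_mul_comp_norm_sq c L hG,
    (hasCompactSupport_comp_norm_sq hs).mul_left⟩

/-- Smooth cutoffs at all scales. -/
theorem exists_cutoffs : ∃ (χ : ℕ → ℝ → ℝ) (M : ℝ), 0 ≤ M ∧ ∀ n, ContDiff ℝ ∞ (χ n) ∧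
    HasCompactSupport (χ n) ∧ (∀ s, |χ n s| ≤ 1) ∧
    (∀ s, 0 ≤ s → (1 + s) * |deriv (χ n) s| ≤ M) ∧
    (∀ s, 0 ≤ s → (1 + s) ^ 2 * |deriv (deriv (χ n)) s| ≤ M) ∧
    (∀ s : ℝ, |s| < n → χ n s = 1 ∧ deriv (χ n) s = 0 ∧ deriv (deriv (χ n)) s = 0) := by
  let b : ContDiffBump (0 : ℝ) := ⟨1, 2, by norm_num, by norm_num⟩
  have hb : ContDiff ℝ ∞ (b : ℝ → ℝ) := b.contDiff
  have hb' : ContDiff ℝ ∞ (deriv (b : ℝ → ℝ)) := (contDiff_infty_iff_deriv.1 hb).2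
  have hb'' : ContDiff ℝ ∞ (deriv (deriv (b : ℝ → ℝ))) := (contDiff_infty_iff_deriv.1 hb').2
  have hbs : HasCompactSupport (b : ℝ → ℝ) := b.hasCompactSupport
  obtain ⟨C1, hC1⟩ := hb'.continuous.bounded_above_of_compact_support hbs.deriv
  obtain ⟨C2, hC2⟩ := hb''.continuous.bounded_above_of_compact_support hbs.deriv.deriv
  have hz : ∀ u : ℝ, 2 < u → deriv (b : ℝ → ℝ) u = 0 ∧ deriv (deriv (b : ℝ → ℝ)) u = 0 := by
    intro u hu
    have h0 : ∀ v ∈ Ioi (2 : ℝ), (b : ℝ → ℝ) v = 0 := fun v hv =>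
      b.zero_of_le_dist (by
        rw [Real.dist_eq, sub_zero]
        exact (le_of_lt hv).trans (le_abs_self v))
    have h1 : ∀ v ∈ Ioi (2 : ℝ), deriv (b : ℝ → ℝ) v = 0 := fun v hv => by
      have : (b : ℝ → ℝ) =ᶠ[𝓝 v] fun _ => 0 := by
        filter_upwards [isOpen_Ioi.mem_nhds hv] with w hw using h0 w hw
      rw [this.deriv_eq]; exact deriv_const v (0 : ℝ)
    refine ⟨h1 u hu, ?_⟩
    have : deriv (b : ℝ → ℝ) =ᶠ[𝓝 u] fun _ => 0 := by
      filter_upwards [isOpen_Ioi.mem_nhds hu] with w hw using h1 w hw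
    rw [this.deriv_eq]; exact deriv_const u (0 : ℝ)
  have hC1' : 0 ≤ C1 := (norm_nonneg _).trans (hC1 0)
  have hC2' : 0 ≤ C2 := (norm_nonneg _).trans (hC2 0)
  have hd : ∀ (f : ℝ → ℝ), ContDiff ℝ ∞ f → ∀ (N s : ℝ),
      HasDerivAt (fun s => f (s / N)) (deriv f (s / N) / N) s := fun f hf N s => by
    have := (hf.differentiable (by simp) (s / N)).hasDerivAt.comp s ((hasDerivAt_id s).div_const N)
    exact this.congr_deriv (by ring)
  have hd1 : ∀ N : ℝ, deriv (fun s => (b : ℝ → ℝ) (s / N)) = fun s => deriv b (s / N) / N :=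
    fun N => funext fun s => (hd _ hb N s).deriv
  have hd2 : ∀ N : ℝ, deriv (deriv fun s => (b : ℝ → ℝ) (s / N))
      = fun s => deriv (deriv b) (s / N) / N / N := fun N => by
    rw [hd1]
    exact funext fun s => ((hd _ hb' N s).div_const N).deriv
  -- The derivatives vanish for `s > 2N`, and `1 + s ≤ 3N` elsewhere; so each weight `1 + s` is paid
  -- for by one factor `1 / N`, giving `3 C1` and `9 C2`.
  refine ⟨fun n s => b (s / (n + 1)), 3 * C1 + 9 * C2, by positivity, fun n => ?_⟩
  have hN : (1 : ℝ) ≤ (n : ℝ) + 1 := by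
    have : (0 : ℝ) ≤ n := Nat.cast_nonneg n
    linarith
  set N : ℝ := (n : ℝ) + 1
  have hN0 : 0 < N := by linarith
  refine ⟨hb.comp (by fun_prop), ?_, ?_, ?_, ?_, ?_⟩
  · refine hasCompactSupport_of_norm_ge (M := 2 * N) fun s hs => b.zero_of_le_dist ?_
    rw [Real.dist_eq, sub_zero, abs_div, abs_of_pos hN0, le_div_iff₀ hN0]
    exact hs
  · intro s
    rw [abs_of_nonneg b.nonneg]
    exact b.le_one
  · intro s hs
    rw [hd1]
    simp only
    rcases lt_or_ge 2 (s / N) with h | h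
    · rw [(hz _ h).1]; simp; positivity
    · rw [div_le_iff₀ hN0] at h
      have h1 := hC1 (s / N)
      rw [Real.norm_eq_abs] at h1
      rw [abs_div, abs_of_pos hN0, mul_div_assoc', div_le_iff₀ hN0]
      calc (1 + s) * |deriv b (s / N)| ≤ (3 * N) * C1 := by gcongr; linarith
        _ ≤ (3 * C1 + 9 * C2) * N := by nlinarith
  · intro s hs
    rw [hd2]
    simp only
    rcases lt_or_ge 2 (s / N) with h | h
    · rw [(hz _ h).2]; simp; positivity
    · rw [div_le_iff₀ hN0] at h
      have h1 := hC2 (s / N)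
      rw [Real.norm_eq_abs] at h1
      rw [div_div, abs_div, abs_of_pos (mul_pos hN0 hN0), mul_div_assoc',
        div_le_iff₀ (mul_pos hN0 hN0)]
      calc (1 + s) ^ 2 * |deriv (deriv b) (s / N)| ≤ (3 * N) ^ 2 * C2 := by gcongr; linarith
        _ ≤ (3 * C1 + 9 * C2) * (N * N) := by nlinarith [mul_nonneg hC1' (mul_pos hN0 hN0).le]
  · intro s hs
    have hev : (fun s => (b : ℝ → ℝ) (s / N)) =ᶠ[𝓝 s] fun _ => 1 := by
      have ho : IsOpen {s : ℝ | |s| < n} := isOpen_lt continuous_abs continuous_const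
      filter_upwards [ho.mem_nhds hs] with u hu
      have hu' : |u| < n := hu
      refine b.one_of_mem_closedBall ?_
      rw [mem_closedBall_zero_iff, Real.norm_eq_abs, abs_div, abs_of_pos hN0, div_le_iff₀ hN0]
      change |u| ≤ 1 * ((n : ℝ) + 1)
      linarith
    refine ⟨hev.eq_of_nhds, ?_, ?_⟩
    · rw [hev.deriv_eq]; exact deriv_const s (1 : ℝ)
    · rw [hev.deriv.deriv_eq]
      simp

end SquareFunctions

/-! ### Cutting off affine eigenfunctions. -/

section Cutoff

variable {X : Type*} [MeasurableSpace X]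

theorem tendsto_integral_of_eventually_eq {m : Measure X} {F : ℕ → X → ℝ} {f B : X → ℝ}
    (hF : ∀ n, AEStronglyMeasurable (F n) m) (hB : Integrable B m)
    (hb : ∀ n, ∀ᵐ x ∂m, |F n x| ≤ B x) (he : ∀ᵐ x ∂m, ∀ᶠ n in atTop, F n x = f x) :
    Tendsto (fun n => ∫ x, F n x ∂m) atTop (𝓝 (∫ x, f x ∂m)) :=
  tendsto_integral_of_dominated_convergence B hF hB hb
    (he.mono fun _ hx => tendsto_const_nhds.congr' (hx.mono fun _ h => h.symm))

theorem continuous_sqExpr (β : ℝ) {G : ℝ → ℝ} (hG : ContDiff ℝ ∞ G) :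
    Continuous (sqExpr β G) := by
  have h1 := (contDiff_infty_iff_deriv.1 hG).2
  have h2 := (contDiff_infty_iff_deriv.1 h1).2.continuous
  have h3 := h1.continuous
  unfold sqExpr
  fun_prop

theorem sqExpr_mul_affine (β p q : ℝ) {χ : ℝ → ℝ} (hχ : ContDiff ℝ ∞ χ) (s : ℝ) :
    sqExpr β (fun s => χ s * (p + q * s)) s
      = 4 * s * (1 + s) * (deriv (deriv χ) s * (p + q * s) + 2 * q * deriv χ s)
        + (4 + (8 - 4 * β) * s) * (deriv χ s * (p + q * s) + q * χ s) := by
  have hχ' := (contDiff_infty_iff_deriv.1 hχ).2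
  have ha : ∀ s, HasDerivAt (fun s => p + q * s) q s := fun s => by
    simpa using ((hasDerivAt_id s).const_mul q).const_add p
  have h1 : deriv (fun s => χ s * (p + q * s)) = fun s => deriv χ s * (p + q * s) + χ s * q :=
    funext fun s => ((hχ.differentiable (by simp) s).hasDerivAt.mul (ha s)).deriv
  have h2 : HasDerivAt (fun s => deriv χ s * (p + q * s) + χ s * q)
      (deriv (deriv χ) s * (p + q * s) + deriv χ s * q + deriv χ s * q) s :=
    ((hχ'.differentiable (by simp) s).hasDerivAt.mul (ha s)).add
      ((hχ.differentiable (by simp) s).hasDerivAt.mul_const q)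
  rw [sqExpr, h1, h2.deriv]
  ring

/-- Cutting off an affine eigenfunction of `sqExpr β` that is square integrable. -/
theorem exists_cutoff_affine {β p q lam : ℝ}
    (hq : ∀ s : ℝ, (4 + (8 - 4 * β) * s) * q = -lam * (p + q * s)) {m : Measure X} {S : X → ℝ}
    (hS : Measurable S) (hS0 : ∀ x, 0 ≤ S x)
    (hB : Integrable (fun x => (|p| + |q| * (1 + S x)) ^ 2) m) :
    ∃ G : ℕ → ℝ → ℝ, (∀ n, ContDiff ℝ ∞ (G n)) ∧ (∀ n, HasCompactSupport (G n)) ∧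
      Tendsto (fun n => ∫ x, (G n (S x) - (p + q * S x)) ^ 2 ∂m) atTop (𝓝 0) ∧
      Tendsto (fun n => ∫ x, (G n (S x)) ^ 2 ∂m) atTop (𝓝 (∫ x, (p + q * S x) ^ 2 ∂m)) ∧
      Tendsto (fun n => ∫ x, (sqExpr β (G n) (S x) + lam * G n (S x)) ^ 2 ∂m) atTop (𝓝 0) := by
  obtain ⟨χ, M, hM, hχ⟩ := exists_cutoffs
  have hf : ∀ x, |p + q * S x| ≤ |p| + |q| * (1 + S x) := fun x => by
    refine (abs_add_le _ _).trans ?_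
    rw [abs_mul, abs_of_nonneg (hS0 x)]
    nlinarith [abs_nonneg q]
  have hGc : ∀ n, ContDiff ℝ ∞ (fun s => χ n s * (p + q * s)) := fun n =>
    (hχ n).1.mul (by fun_prop)
  have hev : ∀ x, ∀ᶠ n : ℕ in atTop, |S x| < n := fun x => by
    filter_upwards [eventually_gt_atTop (Nat.ceil |S x|)] with n hn
    exact (Nat.le_ceil _).trans_lt (by exact_mod_cast hn)
  have hzero : ∫ _ : X, (0 : ℝ) ∂m = 0 := integral_zero _ _
  refine ⟨fun n s => χ n s * (p + q * s), hGc, fun n => (hχ n).2.1.mul_right, ?_, ?_, ?_⟩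
  · rw [← hzero]
    refine tendsto_integral_of_eventually_eq (fun n => ?_) (hB.const_mul 4)
      (fun n => Eventually.of_forall fun x => ?_) (Eventually.of_forall fun x => ?_)
    · exact ((((hGc n).continuous.measurable.comp hS).sub
        (by fun_prop)).pow_const 2).aestronglyMeasurable
    · rw [abs_of_nonneg (sq_nonneg _), ← sq_abs, show χ n (S x) * (p + q * S x) - (p + q * S x)
        = (χ n (S x) - 1) * (p + q * S x) by ring, abs_mul,
        show (4 : ℝ) * (|p| + |q| * (1 + S x)) ^ 2 = (2 * (|p| + |q| * (1 + S x))) ^ 2 by ring]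
      have h1 : |χ n (S x) - 1| ≤ 2 := by
        refine (abs_sub _ _).trans ?_
        rw [abs_one]
        linarith [(hχ n).2.2.1 (S x)]
      gcongr
      exact hf x
    · filter_upwards [hev x] with n hn
      rw [((hχ n).2.2.2.2.2 _ hn).1]
      ring
  · refine tendsto_integral_of_eventually_eq (fun n => ?_) hB
      (fun n => Eventually.of_forall fun x => ?_) (Eventually.of_forall fun x => ?_)
    · exact (((hGc n).continuous.measurable.comp hS).pow_const 2).aestronglyMeasurable
    · rw [abs_of_nonneg (sq_nonneg _), ← sq_abs, abs_mul]
      have h1 := (hχ n).2.2.1 (S x)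
      have h2 := hf x
      gcongr
      calc |χ n (S x)| * |p + q * S x| ≤ 1 * (|p| + |q| * (1 + S x)) := by gcongr
        _ = _ := one_mul _
    · filter_upwards [hev x] with n hn
      rw [((hχ n).2.2.2.2.2 _ hn).1]
      ring
  -- By `hq` the terms with undifferentiated `χ` cancel; only commutator terms remain, and they
  -- vanish wherever `χ n` is locally `1`.
  · have hexpr : ∀ n s, sqExpr β (fun s => χ n s * (p + q * s)) s + lam * (χ n s * (p + q * s))
        = 4 * s * (1 + s) * (deriv (deriv (χ n)) s * (p + q * s) + 2 * q * deriv (χ n) s)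
        + (4 + (8 - 4 * β) * s) * (deriv (χ n) s * (p + q * s)) := fun n s => by
      rw [sqExpr_mul_affine β p q (hχ n).1]
      linear_combination χ n s * hq s
    rw [← hzero]
    -- The growth of the coefficients is absorbed by the weights in the bounds on `χ'` and `χ''`, so
    -- the domination is uniform in `n`. The constant is `4 + 8 + (4 + |8 - 4 * β|)`, from `e1`,
    -- `e2`, `e3`.
    refine tendsto_integral_of_eventually_eq (fun n => ?_)
      (hB.const_mul ((16 + |8 - 4 * β|) ^ 2 * M ^ 2))
      (fun n => Eventually.of_forall fun x => ?_) (Eventually.of_forall fun x => ?_)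
    · exact (((((continuous_sqExpr β (hGc n)).measurable.comp hS)).add
        (((hGc n).continuous.measurable.comp hS).const_mul lam)).pow_const 2).aestronglyMeasurable
    · simp only
      rw [abs_of_nonneg (sq_nonneg _), ← sq_abs, hexpr, ← mul_pow, ← mul_pow]
      have hs := hS0 x
      set s := S x
      have h1 := (hχ n).2.2.2.1 s hs
      have h2 := (hχ n).2.2.2.2.1 s hs
      have h3 := hf x
      change |p + q * s| ≤ |p| + |q| * (1 + s) at h3
      set B := |p| + |q| * (1 + s) with hBdef
      have hB0 : 0 ≤ B := (abs_nonneg _).trans h3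
      have hqB : (1 + s) * |q| ≤ B := by
        rw [hBdef]; linarith [abs_nonneg p, mul_comm |q| (1 + s)]
      have e1 : |4 * s * (1 + s) * (deriv (deriv (χ n)) s * (p + q * s))| ≤ 4 * (M * B) := by
        rw [abs_mul, abs_of_nonneg (by positivity : 0 ≤ 4 * s * (1 + s)), abs_mul]
        calc 4 * s * (1 + s) * (|deriv (deriv (χ n)) s| * |p + q * s|)
            ≤ 4 * (1 + s) * (1 + s) * (|deriv (deriv (χ n)) s| * |p + q * s|) := by
              gcongr; linarith
          _ = 4 * (((1 + s) ^ 2 * |deriv (deriv (χ n)) s|) * |p + q * s|) := by ring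
          _ ≤ 4 * (M * B) := by gcongr
      have e2 : |4 * s * (1 + s) * (2 * q * deriv (χ n) s)| ≤ 8 * (M * B) := by
        rw [abs_mul, abs_of_nonneg (by positivity : 0 ≤ 4 * s * (1 + s)), abs_mul, abs_mul 2 q,
          abs_two]
        calc 4 * s * (1 + s) * (2 * |q| * |deriv (χ n) s|)
            ≤ 4 * (1 + s) * (1 + s) * (2 * |q| * |deriv (χ n) s|) := by gcongr; linarith
          _ = 8 * (((1 + s) * |deriv (χ n) s|) * ((1 + s) * |q|)) := by ring
          _ ≤ 8 * (M * B) := by gcongr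
      have e3 : |(4 + (8 - 4 * β) * s) * (deriv (χ n) s * (p + q * s))|
          ≤ (4 + |8 - 4 * β|) * (M * B) := by
        rw [abs_mul, abs_mul]
        have h4 : |4 + (8 - 4 * β) * s| ≤ (4 + |8 - 4 * β|) * (1 + s) := by
          refine (abs_add_le _ _).trans ?_
          rw [abs_mul, abs_of_nonneg hs, abs_of_pos (by norm_num : (0 : ℝ) < 4)]
          nlinarith [abs_nonneg (8 - 4 * β)]
        calc |4 + (8 - 4 * β) * s| * (|deriv (χ n) s| * |p + q * s|)
            ≤ (4 + |8 - 4 * β|) * (1 + s) * (|deriv (χ n) s| * |p + q * s|) := by gcongr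
          _ = (4 + |8 - 4 * β|) * (((1 + s) * |deriv (χ n) s|) * |p + q * s|) := by ring
          _ ≤ (4 + |8 - 4 * β|) * (M * B) := by gcongr
      refine pow_le_pow_left₀ (abs_nonneg _) ?_ 2
      rw [mul_add (4 * s * (1 + s))]
      have := abs_add_three (4 * s * (1 + s) * (deriv (deriv (χ n)) s * (p + q * s)))
        (4 * s * (1 + s) * (2 * q * deriv (χ n) s))
        ((4 + (8 - 4 * β) * s) * (deriv (χ n) s * (p + q * s)))
      calc _ ≤ _ := this
        _ ≤ 4 * (M * B) + 8 * (M * B) + (4 + |8 - 4 * β|) * (M * B) := by gcongr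
        _ = _ := by ring
    · filter_upwards [hev x] with n hn
      obtain ⟨-, h1, h2⟩ := (hχ n).2.2.2.2.2 _ hn
      rw [hexpr, h1, h2]
      ring

/-- Turns residuals tending to zero, with norms tending to a positive limit, into Weyl's condition.
-/
theorem exists_le_mul_of_tendsto {a b : ℕ → ℝ} {c : ℝ} (ha : Tendsto a atTop (𝓝 0))
    (hb : Tendsto b atTop (𝓝 c)) (hc : 0 < c) {ε : ℝ} (hε : 0 < ε) :
    ∃ n, 0 < b n ∧ a n ≤ ε * b n := by
  have h1 := hb.eventually (eventually_gt_nhds (show c / 2 < c by linarith))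
  have h2 := ha.eventually (eventually_lt_nhds (show 0 < ε * (c / 2) by positivity))
  obtain ⟨n, h3, h4⟩ := (h1.and h2).exists
  exact ⟨n, by linarith, by nlinarith⟩

end Cutoff

/-! ### Weyl functions spread over logarithmic scales. -/

section LogScale

theorem integral_inv_Icc_exp {x y : ℝ} (h : x ≤ y) :
    ∫ r in Icc (Real.exp x) (Real.exp y), r⁻¹ = y - x := by
  rw [integral_Icc_eq_integral_Ioc, ← intervalIntegral.integral_of_le (Real.exp_le_exp.2 h),
    integral_inv_of_pos (Real.exp_pos x) (Real.exp_pos y), ← Real.exp_sub, Real.log_exp]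

theorem integrableOn_inv_Icc_exp (x y : ℝ) :
    IntegrableOn (fun r : ℝ => r⁻¹) (Icc (Real.exp x) (Real.exp y)) :=
  ContinuousOn.integrableOn_Icc (continuousOn_inv₀.mono fun _ hr =>
    ne_of_gt (lt_of_lt_of_le (Real.exp_pos x) hr.1))

/-- Integration against `dr / r` measures length in `log r`; this bound and the next one compare the
squared residual and the mass with such lengths. -/
theorem setIntegral_le_of_le_inv {f : ℝ → ℝ} {K x y : ℝ} (hxy : x ≤ y)
    (hf0 : ∀ r, 0 < r → 0 ≤ f r)
    (hf : ∀ r ∈ Icc (Real.exp x) (Real.exp y), f r ≤ K * r⁻¹)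
    (hz : ∀ r, 0 < r → r ∉ Icc (Real.exp x) (Real.exp y) → f r = 0) :
    ∫ r in Ioi 0, f r ≤ K * (y - x) := by
  have hsub : Icc (Real.exp x) (Real.exp y) ⊆ Ioi 0 := fun r hr =>
    lt_of_lt_of_le (Real.exp_pos x) hr.1
  have h1 : ∫ r in Ioi 0, f r = ∫ r in Icc (Real.exp x) (Real.exp y), f r :=
    (setIntegral_eq_of_subset_of_forall_sdiff_eq_zero measurableSet_Ioi hsub
      fun r hr => hz r hr.1 hr.2)
  rw [h1, ← integral_inv_Icc_exp hxy, ← integral_const_mul]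
  refine integral_mono_of_nonneg ?_ ((integrableOn_inv_Icc_exp x y).const_mul K) ?_
  · filter_upwards [ae_restrict_mem measurableSet_Icc] with r hr using hf0 r (hsub hr)
  · filter_upwards [ae_restrict_mem measurableSet_Icc] with r hr using hf r hr

theorem le_setIntegral_of_inv_le {f : ℝ → ℝ} {K x y : ℝ} (hxy : x ≤ y)
    (hf0 : ∀ r, 0 < r → 0 ≤ f r) (hfi : IntegrableOn f (Ioi 0))
    (hf : ∀ r ∈ Icc (Real.exp x) (Real.exp y), K * r⁻¹ ≤ f r) :
    K * (y - x) ≤ ∫ r in Ioi 0, f r := by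
  have hsub : Icc (Real.exp x) (Real.exp y) ⊆ Ioi 0 := fun r hr =>
    lt_of_lt_of_le (Real.exp_pos x) hr.1
  calc K * (y - x) = ∫ r in Icc (Real.exp x) (Real.exp y), K * r⁻¹ := by
        rw [integral_const_mul, integral_inv_Icc_exp hxy]
    _ ≤ ∫ r in Icc (Real.exp x) (Real.exp y), f r :=
        setIntegral_mono_on ((integrableOn_inv_Icc_exp x y).const_mul K) (hfi.mono_set hsub)
          measurableSet_Icc hf
    _ ≤ ∫ r in Ioi 0, f r :=
        setIntegral_mono_set hfi (by
          filter_upwards [ae_restrict_mem measurableSet_Ioi] with r hr using hf0 r hr)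
          hsub.eventuallyLE

/-- The function `s ^ a b(log s / N)` on `(0, ∞)`, extended by zero. -/
def logProfile (a N : ℝ) (b : ℝ → ℝ) (s : ℝ) : ℝ :=
  if 0 < s then s ^ a * b (Real.log s / N) else 0

variable {a N : ℝ} {b : ℝ → ℝ}

theorem logProfile_eq_zero_of_lt (hN : 0 < N) (hb1 : ∀ u < 1, b u = 0) {s : ℝ}
    (hs : s < Real.exp N) : logProfile a N b s = 0 := by
  unfold logProfile
  split_ifs with h
  · rw [hb1 _ ((div_lt_one hN).2 ((Real.log_lt_iff_lt_exp h).2 hs)), mul_zero]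
  · rfl

theorem logProfile_eq_zero_of_gt (hN : 0 < N) (hb2 : ∀ u > 2, b u = 0) {s : ℝ}
    (hs : Real.exp (2 * N) < s) : logProfile a N b s = 0 := by
  have h : 0 < s := (Real.exp_pos _).trans hs
  rw [logProfile, if_pos h, hb2 _ ((lt_div_iff₀ hN).2 ((Real.lt_log_iff_exp_lt h).2 hs)), mul_zero]

theorem contDiff_logProfile (hN : 0 < N) (hb : ContDiff ℝ ∞ b) (hb1 : ∀ u < 1, b u = 0) :
    ContDiff ℝ ∞ (logProfile a N b) := by
  rw [contDiff_iff_contDiffAt]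
  intro s
  rcases le_or_gt s 0 with h | h
  · have : logProfile a N b =ᶠ[𝓝 s] fun _ => 0 := by
      filter_upwards [Iio_mem_nhds (h.trans_lt (Real.exp_pos N))] with u hu
        using logProfile_eq_zero_of_lt hN hb1 hu
    exact contDiffAt_const.congr_of_eventuallyEq this
  · have : logProfile a N b =ᶠ[𝓝 s] fun s => s ^ a * b (Real.log s / N) := by
      filter_upwards [Ioi_mem_nhds h] with u hu using if_pos hu
    refine ContDiffAt.congr_of_eventuallyEq ?_ this
    exact (Real.contDiffAt_rpow_const_of_ne h.ne').mul
      (hb.contDiffAt.comp s ((Real.contDiffAt_log.2 h.ne').div_const N))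

theorem hasCompactSupport_logProfile (hN : 0 < N) (hb2 : ∀ u > 2, b u = 0) :
    HasCompactSupport (logProfile a N b) := by
  refine hasCompactSupport_of_norm_ge (M := Real.exp (2 * N) + 1) fun s hs => ?_
  rcases le_or_gt s 0 with h | h
  · exact if_neg (not_lt.2 h)
  · rw [Real.norm_eq_abs, abs_of_pos h] at hs
    exact logProfile_eq_zero_of_gt hN hb2 (by linarith)

/-- Differentiation stays in the family, lowering the exponent and changing the profile, so second
derivatives come from a second application. -/
theorem hasDerivAt_logProfile (hb : ContDiff ℝ ∞ b) {s : ℝ} (hs : 0 < s) :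
    HasDerivAt (logProfile a N b)
      (logProfile (a - 1) N (fun u => a * b u + deriv b u / N) s) s := by
  have : logProfile a N b =ᶠ[𝓝 s] fun s => s ^ a * b (Real.log s / N) := by
    filter_upwards [Ioi_mem_nhds hs] with u hu using if_pos hu
  refine HasDerivAt.congr_of_eventuallyEq ?_ this
  have h1 := (hb.differentiable (by simp) (Real.log s / N)).hasDerivAt.comp s
    ((Real.hasDerivAt_log hs.ne').div_const N)
  refine ((Real.hasDerivAt_rpow_const (p := a) (Or.inl hs.ne')).mul h1).congr_deriv ?_
  rw [logProfile, if_pos hs, Real.rpow_sub_one hs.ne', Function.comp_apply]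
  ring

/-- In `t = log s` the leading part of `sqExpr` is `4 ∂_t² + 4 (1 - β) ∂_t`. Conjugated by `s^a` it
has zeroth-order coefficient `4a(a + 1 - β)` and first-order coefficient `4(2a + 1 - β)`. At `a = (β
- 1)/2` the former is `-(β - 1)²` and the latter vanishes, leaving `b'' / N²` and terms carrying `1
/ s`. -/
theorem sqExpr_logProfile {β : ℝ} (hN : 0 < N) (hb : ContDiff ℝ ∞ b) {s : ℝ} (hs : 0 < s) :
    sqExpr β (logProfile ((β - 1) / 2) N b) s + (β - 1) ^ 2 * logProfile ((β - 1) / 2) N b s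
      = s ^ ((β - 1) / 2) * (4 * (deriv (deriv b) (Real.log s / N) / N / N)
        + 4 * (deriv (deriv b) (Real.log s / N) / N / N
          + (β - 1) * (deriv b (Real.log s / N) / N)
          + ((β - 1) / 2) ^ 2 * b (Real.log s / N)) / s) := by
  have hb' := (contDiff_infty_iff_deriv.1 hb).2
  set a := (β - 1) / 2 with ha
  set c : ℝ → ℝ := fun u => a * b u + deriv b u / N with hc
  have hcc : ContDiff ℝ ∞ c := (contDiff_const.mul hb).add (hb'.div_const N)
  have hcd : ∀ u, deriv c u = a * deriv b u + deriv (deriv b) u / N := fun u =>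
    (((hb.differentiable (by simp) u).hasDerivAt.const_mul a).add
      ((hb'.differentiable (by simp) u).hasDerivAt.div_const N)).deriv
  have hd1 : deriv (logProfile a N b) =ᶠ[𝓝 s] logProfile (a - 1) N c := by
    filter_upwards [Ioi_mem_nhds hs] with u hu using (hasDerivAt_logProfile hb hu).deriv
  rw [sqExpr, hd1.deriv_eq, (hasDerivAt_logProfile hcc hs).deriv, hd1.eq_of_nhds]
  simp only [logProfile, if_pos hs, hcd]
  simp only [hc]
  rw [Real.rpow_sub_one hs.ne', Real.rpow_sub_one hs.ne']
  have hβ : β = 2 * a + 1 := by rw [ha]; ring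
  rw [hβ]
  field_simp
  ring

/-- Weyl functions at the bottom `(β - 1)²` of the essential spectrum. -/
theorem exists_log_weyl (β : ℝ) (hβ : 1 < β) {ε : ℝ} (hε : 0 < ε) :
    ∃ G : ℝ → ℝ, ContDiff ℝ ∞ G ∧ HasCompactSupport G ∧
      0 < ∫ r in Ioi 0, (G (r ^ 2)) ^ 2 * radialDensity β r ∧
      ∫ r in Ioi 0, (sqExpr β G (r ^ 2) + (β - 1) ^ 2 * G (r ^ 2)) ^ 2 * radialDensity β r
        ≤ ε * ∫ r in Ioi 0, (G (r ^ 2)) ^ 2 * radialDensity β r := by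
  -- Supported in `[1, 2]`, equal to `1` on `[4/3, 5/3]`; in the radius, `log r` runs over `[N/2,
  -- N]` and `[2N/3, 5N/6]`.
  let b : ContDiffBump (3 / 2 : ℝ) := ⟨1 / 6, 1 / 2, by norm_num, by norm_num⟩
  have hb : ContDiff ℝ ∞ (b : ℝ → ℝ) := b.contDiff
  have hb' : ContDiff ℝ ∞ (deriv (b : ℝ → ℝ)) := (contDiff_infty_iff_deriv.1 hb).2
  have hb'' : ContDiff ℝ ∞ (deriv (deriv (b : ℝ → ℝ))) := (contDiff_infty_iff_deriv.1 hb').2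
  have hbs : HasCompactSupport (b : ℝ → ℝ) := b.hasCompactSupport
  obtain ⟨C1, hC1⟩ := hb'.continuous.bounded_above_of_compact_support hbs.deriv
  obtain ⟨C2, hC2⟩ := hb''.continuous.bounded_above_of_compact_support hbs.deriv.deriv
  have hC1' : 0 ≤ C1 := (norm_nonneg _).trans (hC1 0)
  have hC2' : 0 ≤ C2 := (norm_nonneg _).trans (hC2 0)
  have hts : tsupport (b : ℝ → ℝ) = Metric.closedBall (3 / 2) (1 / 2) := b.tsupport_eq
  have hout : ∀ u, u ∉ Icc (1 : ℝ) 2 →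
      b u = 0 ∧ deriv b u = 0 ∧ deriv (deriv (b : ℝ → ℝ)) u = 0 := by
    intro u hu
    have h1 : u ∉ tsupport (b : ℝ → ℝ) := by
      rw [hts, Real.closedBall_eq_Icc]
      norm_num
      simpa [mem_Icc] using hu
    have h2 : u ∉ tsupport (deriv (b : ℝ → ℝ)) := fun h => h1 (tsupport_deriv_subset h)
    have h3 : u ∉ tsupport (deriv (deriv (b : ℝ → ℝ))) := fun h => h2 (tsupport_deriv_subset h)
    exact ⟨image_eq_zero_of_notMem_tsupport h1, image_eq_zero_of_notMem_tsupport h2,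
      image_eq_zero_of_notMem_tsupport h3⟩
  have hb1 : ∀ u < 1, (b : ℝ → ℝ) u = 0 := fun u hu => (hout u fun h => not_lt.2 h.1 hu).1
  have hb2 : ∀ u > 2, (b : ℝ → ℝ) u = 0 := fun u hu => (hout u fun h => not_lt.2 h.2 hu).1
  have hbI : ∀ u ∈ Icc (4 / 3 : ℝ) (5 / 3), (b : ℝ → ℝ) u = 1 := fun u hu => by
    refine b.one_of_mem_closedBall ?_
    rw [Real.closedBall_eq_Icc]
    constructor <;> norm_num <;> linarith [hu.1, hu.2]
  set C : ℝ := 4 * C2 + 4 * (C2 + (β - 1) * C1 + ((β - 1) / 2) ^ 2) with hC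
  have hβ0 : 0 ≤ β - 1 := by linarith
  have hC0 : 0 ≤ C := by positivity
  -- The squared residual is at most `(C/N)² · N/2 ≤ C²/2` and the mass at least `2^(-β) N / 6`;
  -- this `N` makes the quotient at most `ε`.
  set N : ℝ := max 1 (3 * C ^ 2 * 2 ^ β / ε) with hNdef
  have hN1 : 1 ≤ N := le_max_left _ _
  have hN : 0 < N := by linarith
  set G := logProfile ((β - 1) / 2) N b with hG
  have hGc : ContDiff ℝ ∞ G := contDiff_logProfile hN hb hb1
  have hGs : HasCompactSupport G := hasCompactSupport_logProfile hN hb2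
  have hpos : ∀ (F : ℝ → ℝ) (r : ℝ), 0 < r → 0 ≤ F r ^ 2 * radialDensity β r := fun F r hr =>
    mul_nonneg (sq_nonneg _) (radialDensity_nonneg β hr.le)
  -- For `r ≥ 1` the square of the critical power times the density lies between `2^(-β) / r` and `1
  -- / r`: every logarithmic scale carries comparable mass.
  have hweight : ∀ r : ℝ, 0 < r → ((r ^ 2) ^ ((β - 1) / 2)) ^ 2 * radialDensity β r ≤ 1 * r⁻¹ ∧
      (2 : ℝ) ^ (-β) * r⁻¹ ≤ ((r ^ 2) ^ ((β - 1) / 2)) ^ 2 * radialDensity β r ∨ r < 1 := by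
    intro r hr
    rcases lt_or_ge r 1 with h | h
    · exact Or.inr h
    refine Or.inl ?_
    have hr2 : (0 : ℝ) < r ^ 2 := by positivity
    have e1 : ((r ^ 2) ^ ((β - 1) / 2)) ^ 2 = (r ^ 2) ^ β / r ^ 2 := by
      rw [← Real.rpow_natCast, ← Real.rpow_mul hr2.le, ← Real.rpow_sub_one hr2.ne']
      congr 1
      push_cast
      ring
    have e2 : (r ^ 2) ^ β * (r ^ 2) ^ (-β) = 1 := by
      rw [← Real.rpow_add hr2]; simp
    have e3 : (1 + r ^ 2) ^ (-β) ≤ (r ^ 2) ^ (-β) :=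
      Real.rpow_le_rpow_of_nonpos hr2 (by linarith) (by linarith)
    have e4 : (2 : ℝ) ^ (-β) * (r ^ 2) ^ (-β) ≤ (1 + r ^ 2) ^ (-β) := by
      rw [← Real.mul_rpow (by norm_num) hr2.le]
      exact Real.rpow_le_rpow_of_nonpos (by positivity) (by nlinarith) (by linarith)
    have e5 : 0 < (r ^ 2) ^ β := by positivity
    have e6 : ((r ^ 2) ^ ((β - 1) / 2)) ^ 2 * radialDensity β r
        = ((r ^ 2) ^ β * (1 + r ^ 2) ^ (-β)) * r⁻¹ := by
      rw [e1, radialDensity]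
      field_simp
    rw [e6]
    constructor
    · refine mul_le_mul_of_nonneg_right ?_ (by positivity)
      exact (mul_le_mul_of_nonneg_left e3 e5.le).trans e2.le
    · gcongr
      calc (2 : ℝ) ^ (-β) = (r ^ 2) ^ β * (2 ^ (-β) * (r ^ 2) ^ (-β)) := by
            rw [mul_left_comm, e2, mul_one]
        _ ≤ _ := by gcongr
  have hmem : ∀ {x y r : ℝ}, 0 < r → (Real.log (r ^ 2) / N ∈ Icc (2 * x) (2 * y) ↔
      r ∈ Icc (Real.exp (x * N)) (Real.exp (y * N))) := by
    intro x y r hr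
    rw [mem_Icc, mem_Icc, ← Real.le_log_iff_exp_le hr, ← Real.log_le_iff_le_exp hr, Real.log_pow,
      le_div_iff₀ hN, div_le_iff₀ hN]
    push_cast
    constructor
    · rintro ⟨h1, h2⟩; constructor <;> nlinarith
    · rintro ⟨h1, h2⟩; constructor <;> nlinarith
  have hge1 : ∀ {x r : ℝ}, 0 ≤ x → Real.exp (x * N) ≤ r → 1 ≤ r := fun hx h =>
    (Real.one_le_exp (mul_nonneg hx hN.le)).trans h
  have hup : ∫ r in Ioi 0, (sqExpr β G (r ^ 2) + (β - 1) ^ 2 * G (r ^ 2)) ^ 2 * radialDensity β r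
      ≤ (C / N) ^ 2 * (1 * N - 1 / 2 * N) := by
    refine setIntegral_le_of_le_inv (by linarith) (hpos _) ?_ ?_
    · intro r hr
      have hr1 : 1 ≤ r := hge1 (by norm_num) hr.1
      have hr0 : 0 < r := by linarith
      have hs : 0 < r ^ 2 := by positivity
      -- On the support `r² ≥ exp N ≥ N`, so the terms with `1 / s` are of order `1 / N` too.
      have hsN : N ≤ r ^ 2 := by
        have h1 : Real.exp (1 / 2 * N) ^ 2 ≤ r ^ 2 := by gcongr; exact hr.1
        have h2 : Real.exp (1 / 2 * N) ^ 2 = Real.exp N := by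
          rw [← Real.exp_nat_mul]; congr 1; push_cast; ring
        linarith [Real.add_one_le_exp N]
      rw [sqExpr_logProfile hN hb hs]
      set u := Real.log (r ^ 2) / N
      have hw := ((hweight r hr0).resolve_right (not_lt.2 hr1)).1
      rw [one_mul] at hw
      have k0 : |(b : ℝ → ℝ) u| ≤ 1 := by rw [abs_of_nonneg b.nonneg]; exact b.le_one
      have k1 : |deriv (b : ℝ → ℝ) u| ≤ C1 := hC1 u
      have k2 : |deriv (deriv (b : ℝ → ℝ)) u| ≤ C2 := hC2 u
      have k3 : |deriv (deriv (b : ℝ → ℝ)) u / N / N| ≤ C2 / N := by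
        rw [abs_div, abs_div, abs_of_pos hN]
        calc |deriv (deriv (b : ℝ → ℝ)) u| / N / N ≤ C2 / N / 1 := by gcongr
          _ = C2 / N := div_one _
      have k4 : |deriv (b : ℝ → ℝ) u / N| ≤ C1 := by
        rw [abs_div, abs_of_pos hN]
        calc |deriv (b : ℝ → ℝ) u| / N ≤ C1 / 1 := by gcongr
          _ = C1 := div_one _
      have k5 : |deriv (deriv (b : ℝ → ℝ)) u / N / N| ≤ C2 := by
        refine k3.trans ?_
        exact div_le_self hC2' hN1
      have k6 : |4 * (deriv (deriv (b : ℝ → ℝ)) u / N / N)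
          + 4 * (deriv (deriv (b : ℝ → ℝ)) u / N / N + (β - 1) * (deriv (b : ℝ → ℝ) u / N)
          + ((β - 1) / 2) ^ 2 * (b : ℝ → ℝ) u) / r ^ 2| ≤ C / N := by
        have h1 : |deriv (deriv (b : ℝ → ℝ)) u / N / N + (β - 1) * (deriv (b : ℝ → ℝ) u / N)
          + ((β - 1) / 2) ^ 2 * (b : ℝ → ℝ) u| ≤ C2 + (β - 1) * C1 + ((β - 1) / 2) ^ 2 := by
          refine (abs_add_three _ _ _).trans ?_
          rw [abs_mul, abs_mul, abs_of_nonneg hβ0, abs_of_nonneg (sq_nonneg ((β - 1) / 2))]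
          calc _ ≤ C2 + (β - 1) * C1 + ((β - 1) / 2) ^ 2 * 1 := by gcongr
            _ = _ := by ring
        refine (abs_add_le _ _).trans ?_
        rw [abs_div, abs_mul, abs_mul, abs_of_pos (by norm_num : (0 : ℝ) < 4), abs_of_pos hs]
        calc _ ≤ 4 * (C2 / N) + 4 * (C2 + (β - 1) * C1 + ((β - 1) / 2) ^ 2) / N := by gcongr
          _ = C / N := by rw [hC]; ring
      rw [mul_pow, mul_right_comm, mul_comm]
      refine mul_le_mul ?_ hw (mul_nonneg (sq_nonneg _) (radialDensity_nonneg β hr0.le))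
        (sq_nonneg _)
      rw [← sq_abs]
      gcongr
    · intro r hr0 hr
      have hs : 0 < r ^ 2 := by positivity
      rw [sqExpr_logProfile hN hb hs]
      have : Real.log (r ^ 2) / N ∉ Icc (1 : ℝ) 2 := fun h => hr ((hmem hr0).1 (by
        rwa [show (2 : ℝ) * (1 / 2) = 1 by norm_num, mul_one]))
      obtain ⟨h1, h2, h3⟩ := hout _ this
      rw [h1, h2, h3]
      ring
  have hlow : (2 : ℝ) ^ (-β) * (5 / 6 * N - 2 / 3 * N)
      ≤ ∫ r in Ioi 0, (G (r ^ 2)) ^ 2 * radialDensity β r := by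
    refine le_setIntegral_of_inv_le (by linarith) (hpos _) ?_ ?_
    · obtain ⟨M, hM⟩ := exists_forall_ge_eq_zero (hasCompactSupport_comp_norm_sq (F := ℝ) hGs)
      refine integrableOn_Ioi_of_eventually_zero (M := M) ?_ (fun r hr => ?_) 0
      · have := hGc.continuous
        have := continuous_radialDensity β
        fun_prop
      · have := hM r hr
        rw [Real.norm_eq_abs, sq_abs] at this
        rw [this]; ring
    · intro r hr
      have hr1 : 1 ≤ r := hge1 (by norm_num) hr.1
      have hr0 : 0 < r := by linarith
      have hs : 0 < r ^ 2 := by positivity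
      have hu := (hmem hr0).2 hr
      rw [show (2 : ℝ) * (2 / 3) = 4 / 3 by norm_num,
        show (2 : ℝ) * (5 / 6) = 5 / 3 by norm_num] at hu
      have hGr : G (r ^ 2) = (r ^ 2) ^ ((β - 1) / 2) := by
        rw [hG, logProfile, if_pos hs, hbI _ hu, mul_one]
      rw [hGr]
      exact ((hweight r hr0).resolve_right (not_lt.2 hr1)).2
  have h2β : 0 < (2 : ℝ) ^ (-β) := by positivity
  refine ⟨G, hGc, hGs, lt_of_lt_of_le (mul_pos h2β (by linarith)) hlow, hup.trans ?_⟩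
  refine le_trans ?_ (mul_le_mul_of_nonneg_left hlow hε.le)
  have hNε : 3 * C ^ 2 * 2 ^ β ≤ N * ε := (div_le_iff₀ hε).1 (le_max_right _ _)
  have h22 : (2 : ℝ) ^ β * 2 ^ (-β) = 1 := by rw [← Real.rpow_add (by norm_num)]; simp
  have h3 : 3 * C ^ 2 ≤ ε * 2 ^ (-β) * N := by
    calc 3 * C ^ 2 = 3 * C ^ 2 * 2 ^ β * 2 ^ (-β) := by rw [mul_assoc, h22, mul_one]
      _ ≤ N * ε * 2 ^ (-β) := by gcongr
      _ = _ := by ring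
  have h4 : (C / N) ^ 2 * (1 * N - 1 / 2 * N) ≤ C ^ 2 / 2 := by
    rw [div_pow, div_mul_eq_mul_div, div_le_iff₀ (by positivity)]
    nlinarith [mul_nonneg (sq_nonneg C) (mul_nonneg hN.le (sub_nonneg.2 hN1))]
  linarith

end LogScale

/-! ### The exact radial gap. -/

section RadialGap

theorem integral_radialExpr_comp_sq (β lam : ℝ) {G : ℝ → ℝ} (hG : ContDiff ℝ ∞ G) :
    ∫ r, (radialExpr 2 β (fun r => G (r ^ 2)) r + lam * G (r ^ 2)) ^ 2 ∂(radialMeasure β)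
      = ∫ r, (sqExpr β G (r ^ 2) + lam * G (r ^ 2)) ^ 2 ∂(radialMeasure β) := by
  refine integral_congr_ae ?_
  filter_upwards [ae_pos_radialMeasure β] with r hr
  rw [radialExpr_comp_sq β hG hr]

theorem exists_radial_almost_constant {β : ℝ} (hβ : 1 < β) : ∃ φ : ℕ → neumannFunctions,
    Tendsto (fun n => ∫ x, ((φ n : ℝ → ℝ) x - 1) ^ 2 ∂(radialMeasure β)) atTop (𝓝 0) ∧
    Tendsto (fun n => ∫ x, (radialExpr 2 β (φ n) x) ^ 2 ∂(radialMeasure β)) atTop (𝓝 0) := by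
  have := isFiniteMeasure_radialMeasure hβ
  obtain ⟨G, hG, hGs, h1, -, h2⟩ := exists_cutoff_affine (β := β) (p := 1) (q := 0) (lam := 0)
    (fun s => by ring) (m := radialMeasure β) (S := fun r => r ^ 2) (by fun_prop)
    (fun r => sq_nonneg r) (by simp)
  refine ⟨fun n => neumannSq (G n) (hG n) (hGs n), ?_, ?_⟩
  · simpa [neumannSq] using h1
  · refine h2.congr fun n => ?_
    rw [← integral_radialExpr_comp_sq β 0 (hG n)]
    simp [neumannSq]

/-- `A = 1 - β` minimises `A (A + 2β - 2)`, with minimum `-(β - 1)²`. The other condition reads `(β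
- 1)² ≤ 4`, which is `β ≤ 3`. -/
theorem lambda1_radialOperator_of_le {β : ℝ} (hβ : 1 < β) (hβ3 : β ≤ 3) :
    lambda1 (-radialOperator 2 β) = (β - 1) ^ 2 := by
  have h0 : 0 < β - 1 := by linarith
  refine lambda1_radialOperator_eq (A := 1 - β) hβ (by positivity) (by nlinarith) (by nlinarith)
    (exists_radial_almost_constant hβ) fun ε hε => ?_
  obtain ⟨G, hG, hGs, h1, h2⟩ := exists_log_weyl β hβ hε
  refine ⟨neumannSq G hG hGs, ?_, ?_⟩
  · rw [integral_radialMeasure]; exact h1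
  · rw [integral_radialMeasure β fun x => (neumannSq G hG hGs : ℝ → ℝ) x ^ 2]
    refine le_trans (le_of_eq ?_) h2
    rw [← integral_radialMeasure β fun r => (sqExpr β G (r ^ 2) + (β - 1) ^ 2 * G (r ^ 2)) ^ 2]
    exact integral_radialExpr_comp_sq β _ hG

/-- `A = 4 - 2β` turns both conditions into equalities: the supersolution `r² (1 + r²)^(1 - β)` is
then, up to a factor, the flux `(1 + r²) ρ g'` of the eigenfunction `g = (β - 2) r² - 1`. -/
theorem lambda1_radialOperator_of_lt {β : ℝ} (hβ3 : 3 < β) :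
    lambda1 (-radialOperator 2 β) = 4 * (β - 2) := by
  have hβ : 1 < β := by linarith
  refine lambda1_radialOperator_eq (A := 4 - 2 * β) hβ (by linarith) (by nlinarith) (by nlinarith)
    (exists_radial_almost_constant hβ) fun ε hε => ?_
  have := isFiniteMeasure_radialMeasure hβ
  have hB : Integrable (fun r : ℝ => (|(-1 : ℝ)| + |β - 2| * (1 + r ^ 2)) ^ 2)
      (radialMeasure β) := by
    -- Multiplying by `(1 + r²)²` replaces `β` by `β - 2`, which exceeds `1` exactly when `β > 3`.
    have h1 : Integrable (fun r : ℝ => (1 + r ^ 2) ^ 2) (radialMeasure β) := by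
      rw [integrable_radialMeasure_iff]
      refine (integrableOn_radialDensity (β := β - 2) (by linarith)).congr
        (Eventually.of_forall fun r => ?_)
      have ht : (0 : ℝ) < 1 + r ^ 2 := by positivity
      simp only [radialDensity]
      rw [show -(β - 2) = -β + 2 by ring, Real.rpow_add ht, Real.rpow_two]
      ring
    refine (h1.const_mul ((1 + |β - 2|) ^ 2)).mono' (by fun_prop) (Eventually.of_forall fun r => ?_)
    rw [Real.norm_of_nonneg (sq_nonneg _), ← mul_pow, abs_neg, abs_one]
    refine pow_le_pow_left₀ (by positivity) ?_ 2
    nlinarith [sq_nonneg r, abs_nonneg (β - 2)]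
  obtain ⟨G, hG, hGs, -, h1, h2⟩ := exists_cutoff_affine (β := β) (p := -1) (q := β - 2)
    (lam := 4 * (β - 2)) (fun s => by ring) (m := radialMeasure β) (S := fun r => r ^ 2)
    (by fun_prop) (fun r => sq_nonneg r) hB
  have hpos : 0 < ∫ r : ℝ, (-1 + (β - 2) * r ^ 2) ^ 2 ∂(radialMeasure β) := by
    have hint : Integrable (fun r : ℝ => (-1 + (β - 2) * r ^ 2) ^ 2) (radialMeasure β) := by
      refine hB.mono' (by fun_prop) (Eventually.of_forall fun r => ?_)
      rw [Real.norm_of_nonneg (sq_nonneg _), ← sq_abs]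
      refine pow_le_pow_left₀ (abs_nonneg _) ?_ 2
      refine (abs_add_le _ _).trans ?_
      rw [abs_mul, abs_of_nonneg (sq_nonneg r)]
      nlinarith [abs_nonneg (β - 2)]
    rw [integrable_radialMeasure_iff] at hint
    rw [integral_radialMeasure, setIntegral_pos_iff_support_of_nonneg_ae ?_ hint]
    · have hsub : Ioi (1 : ℝ) ⊆ Function.support
          (fun r : ℝ => (-1 + (β - 2) * r ^ 2) ^ 2 * radialDensity β r) ∩ Ioi 0 := by
        intro r hr
        have hr1 : 1 < r := hr
        have hr0 : 0 < r := by linarith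
        refine ⟨?_, hr0⟩
        have h3 : 0 < -1 + (β - 2) * r ^ 2 := by nlinarith
        exact (mul_pos (by positivity) (radialDensity_pos β hr0)).ne'
      refine lt_of_lt_of_le ?_ (measure_mono hsub)
      simp
    · filter_upwards [ae_restrict_mem measurableSet_Ioi] with r hr
      exact mul_nonneg (sq_nonneg _) (radialDensity_nonneg β (le_of_lt hr))
  obtain ⟨n, h3, h4⟩ := exists_le_mul_of_tendsto h2 h1 hpos hε
  refine ⟨neumannSq (G n) (hG n) (hGs n), h3, le_trans (le_of_eq ?_) h4⟩
  exact integral_radialExpr_comp_sq β _ (hG n)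

end RadialGap

/-! ### Wirtinger's inequality and differentiation under angular integrals. -/

section Angular

/-- Wirtinger's inequality. -/
theorem wirtinger {f f' : ℝ → ℝ} (hf : ∀ x, HasDerivAt f (f' x) x) (hf' : Continuous f')
    (hper : f (-Real.pi) = f Real.pi) (hmean : ∫ x in (-Real.pi)..Real.pi, f x = 0) :
    ∫ x in (-Real.pi)..Real.pi, f x ^ 2 ≤ ∫ x in (-Real.pi)..Real.pi, f' x ^ 2 := by
  have hab : -Real.pi < Real.pi := by linarith [Real.pi_pos]
  have hfc : Continuous f := continuous_iff_continuousAt.2 fun x => (hf x).continuousAt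
  have hmem : ∀ g : ℝ → ℝ, Continuous g →
      MemLp (fun x => (g x : ℂ)) 2 (volume.restrict (Ioc (-Real.pi) Real.pi)) := fun g hg => by
    have hgc : Continuous fun x => (g x : ℂ) := Complex.continuous_ofReal.comp hg
    obtain ⟨C, hC⟩ := (isCompact_Icc (a := -Real.pi) (b := Real.pi)).exists_bound_of_continuousOn
      hgc.continuousOn
    refine MemLp.of_bound hgc.aestronglyMeasurable C ?_
    filter_upwards [ae_restrict_mem measurableSet_Ioc] with x hx using hC x ⟨hx.1.le, hx.2⟩
  have s1 := hasSum_sq_fourierCoeffOn hab (hmem f hfc)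
  have s2 := hasSum_sq_fourierCoeffOn hab (hmem f' hf')
  -- By periodicity the coefficient of `f'` is `i n` times that of `f`, and `|n| ≥ 1` unless `n =
  -- 0`, where the zero mean applies. Parseval then sums the inequalities.
  have hle : ∀ n : ℤ, ‖fourierCoeffOn hab (fun x => (f x : ℂ)) n‖ ^ 2
      ≤ ‖fourierCoeffOn hab (fun x => (f' x : ℂ)) n‖ ^ 2 := by
    intro n
    rcases eq_or_ne n 0 with rfl | hn
    · have : fourierCoeffOn hab (fun x => (f x : ℂ)) 0 = 0 := by
        rw [fourierCoeffOn_eq_integral]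
        simp only [neg_zero, fourier_zero, one_smul]
        rw [intervalIntegral.integral_ofReal, hmean]
        simp
      rw [this]; simp
    · rw [fourierCoeffOn_of_hasDerivAt hab hn (f' := fun x => (f' x : ℂ))
        (fun x _ => (hf x).ofReal_comp)
        ((Complex.continuous_ofReal.comp hf').intervalIntegrable _ _)]
      rw [hper, sub_self, mul_zero, zero_sub, norm_mul, norm_neg, norm_mul]
      have hn1 : (1 : ℝ) ≤ |(n : ℝ)| := by
        have := Int.one_le_abs hn
        exact_mod_cast this
      have h2 : ‖(1 : ℂ) / (-2 * Real.pi * Complex.I * n)‖ = 1 / (2 * Real.pi * |(n : ℝ)|) := by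
        simp [abs_of_pos Real.pi_pos]
      have h3 : ‖((Real.pi : ℂ) - ((-Real.pi : ℝ) : ℂ))‖ = 2 * Real.pi := by
        rw [← Complex.ofReal_sub, Complex.norm_real, Real.norm_of_nonneg (by linarith)]
        ring
      rw [h2, h3]
      refine pow_le_pow_left₀ (by positivity) ?_ 2
      rw [← mul_assoc]
      refine mul_le_of_le_one_left (norm_nonneg _) ?_
      rw [div_mul_eq_mul_div, one_mul]
      refine div_le_one_of_le₀ ?_ (by positivity)
      nlinarith [Real.pi_pos]
  have h := hasSum_le hle s1 s2
  simp only [Complex.norm_real, Real.norm_eq_abs, sq_abs, smul_eq_mul] at h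
  have h0 : 0 < (Real.pi - -Real.pi)⁻¹ := by
    rw [inv_pos]; linarith
  exact le_of_mul_le_mul_left h h0

theorem hasDerivAt_angular_integral {f f' : ℝ → ℝ → ℝ}
    (hf : Continuous (Function.uncurry f)) (hf' : Continuous (Function.uncurry f'))
    (hd : ∀ r θ, HasDerivAt (fun r => f r θ) (f' r θ) r) (r : ℝ) :
    HasDerivAt (fun r => ∫ θ in (-Real.pi)..Real.pi, f r θ)
      (∫ θ in (-Real.pi)..Real.pi, f' r θ) r := by
  obtain ⟨C, hC⟩ := ((isCompact_Icc (a := r - 1) (b := r + 1)).prod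
    (isCompact_Icc (a := -Real.pi) (b := Real.pi))).exists_bound_of_continuousOn hf'.continuousOn
  have hcr : ∀ x, Continuous (f x) := fun x => hf.comp (by fun_prop : Continuous fun θ => (x, θ))
  have hcr' : Continuous (f' r) := hf'.comp (by fun_prop : Continuous fun θ => (r, θ))
  refine (intervalIntegral.hasDerivAt_integral_of_dominated_loc_of_deriv_le
    (F := f) (F' := f') (bound := fun _ => C) (s := Icc (r - 1) (r + 1))
    (Icc_mem_nhds (by linarith) (by linarith)) ?_ ?_ ?_ ?_ ?_ ?_).2
  · exact Eventually.of_forall fun x => (hcr x).aestronglyMeasurable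
  · exact (hcr r).intervalIntegrable _ _
  · exact hcr'.aestronglyMeasurable
  · refine Eventually.of_forall fun θ hθ x hx => ?_
    rw [uIoc_of_le (by linarith [Real.pi_pos])] at hθ
    exact hC (x, θ) ⟨hx, ⟨hθ.1.le, hθ.2⟩⟩
  · exact intervalIntegrable_const
  · exact Eventually.of_forall fun θ _ x _ => hd x θ

theorem continuous_angular_integral {f : ℝ → ℝ → ℝ} (hf : Continuous (Function.uncurry f)) :
    Continuous fun r => ∫ θ in (-Real.pi)..Real.pi, f r θ :=
  intervalIntegral.continuous_parametric_intervalIntegral_of_continuous' hf _ _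

end Angular

/-! ### Polar coordinates in the Euclidean plane. -/

section Polar

/-- The unit vector at angle `θ`. -/
def unitVec (θ : ℝ) : Euc 2 := !₂[Real.cos θ, Real.sin θ]

/-- The derivative of `unitVec`. -/
def unitVec' (θ : ℝ) : Euc 2 := !₂[-Real.sin θ, Real.cos θ]

theorem norm_unitVec (θ : ℝ) : ‖unitVec θ‖ = 1 := by
  have h := EuclideanSpace.real_norm_sq_eq (unitVec θ)
  rw [Fin.sum_univ_two] at h
  simp only [unitVec] at h
  simp only [Matrix.cons_val_zero, Matrix.cons_val_one,
    Real.cos_sq_add_sin_sq] at h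
  exact (pow_eq_one_iff_of_nonneg (norm_nonneg _) two_ne_zero).1 h

theorem norm_smul_unitVec {r : ℝ} (hr : 0 ≤ r) (θ : ℝ) : ‖r • unitVec θ‖ = r := by
  rw [norm_smul, norm_unitVec, mul_one, Real.norm_of_nonneg hr]

theorem hasDerivAt_unitVec (θ : ℝ) : HasDerivAt unitVec (unitVec' θ) θ := by
  have h : HasDerivAt (fun θ => ![Real.cos θ, Real.sin θ]) ![-Real.sin θ, Real.cos θ] θ := by
    rw [hasDerivAt_pi]
    intro i
    fin_cases i
    · exact Real.hasDerivAt_cos θ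
    · exact Real.hasDerivAt_sin θ
  exact (PiLp.continuousLinearEquiv 2 ℝ fun _ : Fin 2 =>
    ℝ).symm.toContinuousLinearMap.hasFDerivAt.comp_hasDerivAt θ h

theorem continuous_unitVec : Continuous unitVec :=
  continuous_iff_continuousAt.2 fun θ => (hasDerivAt_unitVec θ).continuousAt

theorem continuous_unitVec' : Continuous unitVec' := by
  refine (PiLp.continuous_toLp 2 _).comp (continuous_pi fun i => ?_)
  fin_cases i
  · exact Real.continuous_sin.neg
  · exact Real.continuous_cos

theorem integral_euc_eq_polar (F : Euc 2 → ℝ) :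
    ∫ x, F x = ∫ p in Ioi (0 : ℝ) ×ˢ Ioo (-Real.pi) Real.pi, p.1 * F (p.1 • unitVec p.2) := by
  let e : Euc 2 ≃ᵐ ℝ × ℝ :=
    (MeasurableEquiv.toLp 2 (Fin 2 → ℝ)).symm.trans MeasurableEquiv.finTwoArrow
  have he : MeasurePreserving e :=
    (EuclideanSpace.volume_preserving_symm_measurableEquiv_toLp (Fin 2)).trans
      (volume_preserving_finTwoArrow ℝ)
  have h1 := he.integral_comp e.measurableEmbedding (fun q => F (e.symm q))
  simp only [MeasurableEquiv.symm_apply_apply] at h1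
  rw [h1, ← integral_comp_polarCoord_symm]
  refine setIntegral_congr_fun (measurableSet_Ioi.prod measurableSet_Ioo) fun p _ => ?_
  have h2 : e.symm (polarCoord.symm p) = p.1 • unitVec p.2 := by
    ext i
    fin_cases i <;> rfl
  simp only [smul_eq_mul, h2]

theorem integral_euc_radial (F : ℝ → ℝ) :
    ∫ x : Euc 2, F ‖x‖ = 2 * Real.pi * ∫ r in Ioi 0, r * F r := by
  rw [integral_euc_eq_polar fun x => F ‖x‖]
  have h1 : ∫ p in Ioi (0 : ℝ) ×ˢ Ioo (-Real.pi) Real.pi, p.1 * F ‖p.1 • unitVec p.2‖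
      = ∫ p in Ioi (0 : ℝ) ×ˢ Ioo (-Real.pi) Real.pi, (p.1 * F p.1) * (fun _ => (1 : ℝ)) p.2 := by
    refine setIntegral_congr_fun (measurableSet_Ioi.prod measurableSet_Ioo) fun p hp => ?_
    simp only
    rw [norm_smul_unitVec (le_of_lt hp.1), mul_one]
  rw [h1, Measure.volume_eq_prod,
    setIntegral_prod_mul (fun r : ℝ => r * F r) (fun _ : ℝ => (1 : ℝ))]
  simp [Real.pi_pos.le]
  ring

theorem integral_euc_eq_iterated {F : Euc 2 → ℝ} (hF : Continuous F) {M : ℝ}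
    (hM : ∀ x, M ≤ ‖x‖ → F x = 0) :
    ∫ x, F x = ∫ r in Ioi 0, r * ∫ θ in (-Real.pi)..Real.pi, F (r • unitVec θ) := by
  have hc : Continuous fun p : ℝ × ℝ => p.1 * F (p.1 • unitVec p.2) :=
    continuous_fst.mul (hF.comp (continuous_fst.smul (continuous_unitVec.comp continuous_snd)))
  have hint : IntegrableOn (fun p : ℝ × ℝ => p.1 * F (p.1 • unitVec p.2))
      (Ioi (0 : ℝ) ×ˢ Ioo (-Real.pi) Real.pi) := by
    have h1 : Ioi (0 : ℝ) ×ˢ Ioo (-Real.pi) Real.pi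
        ⊆ (Icc 0 M ×ˢ Icc (-Real.pi) Real.pi) ∪ (Ioi (max 0 M) ×ˢ univ) := by
      rintro ⟨r, θ⟩ ⟨hr, hθ⟩
      rcases le_or_gt r M with h | h
      · exact Or.inl ⟨⟨le_of_lt hr, h⟩, ⟨hθ.1.le, hθ.2.le⟩⟩
      · exact Or.inr ⟨max_lt hr h, mem_univ _⟩
    refine IntegrableOn.mono_set (IntegrableOn.union ?_ ?_) h1
    · exact hc.continuousOn.integrableOn_compact (isCompact_Icc.prod isCompact_Icc)
    · refine integrableOn_zero.congr_fun (fun p hp => ?_) (measurableSet_Ioi.prod MeasurableSet.univ)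
      have hp1 : max 0 M < p.1 := hp.1
      rw [hM _ (by
        rw [norm_smul_unitVec ((le_max_left _ _).trans hp1.le)]
        exact (le_max_right _ _).trans hp1.le), mul_zero]
  rw [integral_euc_eq_polar, Measure.volume_eq_prod, setIntegral_prod _ (by
    rwa [← Measure.volume_eq_prod])]
  refine setIntegral_congr_fun measurableSet_Ioi fun r _ => ?_
  simp only
  rw [integral_const_mul, intervalIntegral.integral_of_le (by linarith [Real.pi_pos]),
    integral_Ioc_eq_integral_Ioo]

end Polar

/-! ### The Poincaré inequality in the plane. -/

section FullPoincare

/-- The Cauchy weight `(1 + ‖x‖²) ^ (-β)`. -/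
def cauchyWeight (β : ℝ) (x : Euc 2) : ℝ := (1 + ‖x‖ ^ 2) ^ (-β)

theorem cauchyWeight_pos (β : ℝ) (x : Euc 2) : 0 < cauchyWeight β x := by
  unfold cauchyWeight; positivity

theorem continuous_cauchyWeight (β : ℝ) : Continuous (cauchyWeight β) :=
  (continuous_one_add_sq_rpow (-β)).comp continuous_norm

theorem integrable_cauchyWeight {β : ℝ} (hβ : 1 < β) : Integrable (cauchyWeight β) := by
  have h := integrable_rpow_neg_one_add_norm_sq (E := Euc 2) (μ := volume) (r := 2 * β) (by
    rw [finrank_euclideanSpace_fin]; push_cast; linarith)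
  have e : cauchyWeight β = fun x : Euc 2 => (1 + ‖x‖ ^ 2) ^ (-(2 * β) / 2) := by
    funext x
    rw [cauchyWeight, show -(2 * β) / 2 = -β by ring]
  rw [e]; exact h

/-- Used with `q = 0` for the angular variance, and with `u = ∂_r h`, `v = h` for the square in
`hNA`. -/
theorem integral_affine_sq_angular {u v : ℝ → ℝ} (hu : Continuous u) (hv : Continuous v)
    (p q c : ℝ) :
    ∫ θ in (-Real.pi)..Real.pi, (p * u θ + q * v θ + c) ^ 2
      = p ^ 2 * (∫ θ in (-Real.pi)..Real.pi, u θ ^ 2)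
        + 2 * p * q * (∫ θ in (-Real.pi)..Real.pi, u θ * v θ)
        + q ^ 2 * (∫ θ in (-Real.pi)..Real.pi, v θ ^ 2)
        + 2 * p * c * (∫ θ in (-Real.pi)..Real.pi, u θ)
        + 2 * q * c * (∫ θ in (-Real.pi)..Real.pi, v θ) + 2 * Real.pi * c ^ 2 := by
  have hi : ∀ {f : ℝ → ℝ}, Continuous f → IntervalIntegrable f volume (-Real.pi) Real.pi :=
    fun hf => hf.intervalIntegrable _ _
  have e : ∀ θ, (p * u θ + q * v θ + c) ^ 2 = p ^ 2 * u θ ^ 2 + 2 * p * q * (u θ * v θ)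
      + q ^ 2 * v θ ^ 2 + 2 * p * c * u θ + 2 * q * c * v θ + c ^ 2 := fun θ => by ring
  simp only [e]
  rw [intervalIntegral.integral_add (hi (by fun_prop)) (hi (by fun_prop)),
    intervalIntegral.integral_add (hi (by fun_prop)) (hi (by fun_prop)),
    intervalIntegral.integral_add (hi (by fun_prop)) (hi (by fun_prop)),
    intervalIntegral.integral_add (hi (by fun_prop)) (hi (by fun_prop)),
    intervalIntegral.integral_add (hi (by fun_prop)) (hi (by fun_prop))]
  simp only [intervalIntegral.integral_const_mul, intervalIntegral.integral_const, smul_eq_mul]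
  ring

/-- For each `θ` the two vectors are an orthonormal basis, so this splits the squared gradient into
its radial and angular parts. -/
theorem sum_apply_basisFun_sq (L : Euc 2 →L[ℝ] ℝ) (θ : ℝ) :
    ∑ i, L (EuclideanSpace.basisFun (Fin 2) ℝ i) ^ 2 = L (unitVec θ) ^ 2 + L (unitVec' θ) ^ 2 := by
  have h1 : unitVec θ = Real.cos θ • EuclideanSpace.basisFun (Fin 2) ℝ 0
      + Real.sin θ • EuclideanSpace.basisFun (Fin 2) ℝ 1 := by
    ext i; fin_cases i <;> simp [unitVec]
  have h2 : unitVec' θ = -Real.sin θ • EuclideanSpace.basisFun (Fin 2) ℝ 0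
      + Real.cos θ • EuclideanSpace.basisFun (Fin 2) ℝ 1 := by
    ext i; fin_cases i <;> simp [unitVec']
  rw [h1, h2, Fin.sum_univ_two]
  simp only [map_add, map_smul, smul_eq_mul]
  linear_combination (-(L (EuclideanSpace.basisFun (Fin 2) ℝ 0) ^ 2)
    - L (EuclideanSpace.basisFun (Fin 2) ℝ 1) ^ 2) * Real.sin_sq_add_cos_sq θ

/-- The squared norm of the gradient. -/
def gradSq (h : Euc 2 → ℝ) (x : Euc 2) : ℝ :=
  ∑ i, fderiv ℝ h x (EuclideanSpace.basisFun (Fin 2) ℝ i) ^ 2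

/-- The Poincaré inequality for the full dynamics. -/
theorem full_poincare {β lam A : ℝ} (hβ : 1 < β) (hlam : 0 < lam) (hlam2 : lam ≤ 2 * (β - 1))
    (h1 : A * (A + 2 * β - 2) ≤ -lam) (h2 : 4 * A + 4 * β - 8 ≤ -lam)
    {h : Euc 2 → ℝ} (hh : ContDiff ℝ ∞ h) (hs : HasCompactSupport h) :
    ∃ κ : ℝ, lam * ∫ x, (h x - κ) ^ 2 * cauchyWeight β x
      ≤ ∫ x, (1 + ‖x‖ ^ 2) * gradSq h x * cauchyWeight β x := by
  have hpi := Real.pi_pos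
  have hh1 : Continuous (fderiv ℝ h) := hh.continuous_fderiv (by simp)
  have hhc := hh.continuous
  obtain ⟨M0, hM0⟩ := exists_forall_norm_ge_eq_zero hs
  obtain ⟨M1, hM1⟩ : ∃ M : ℝ, ∀ x, M ≤ ‖x‖ → fderiv ℝ h x = 0 := by
    obtain ⟨R, hR⟩ := (hs.fderiv ℝ).isCompact.isBounded.subset_closedBall 0
    refine ⟨R + 1, fun x hx => ?_⟩
    by_contra hne
    have := hR (subset_tsupport _ hne)
    rw [mem_closedBall_zero_iff] at this
    linarith
  set M := max 0 (max M0 M1) with hM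
  have hM0' : 0 ≤ M := le_max_left _ _
  have hz0 : ∀ r ≥ M, ∀ θ, h (r • unitVec θ) = 0 := fun r hr θ => hM0 _ (by
    rw [norm_smul_unitVec (hM0'.trans hr)]
    exact ((le_max_left _ _).trans (le_max_right _ _)).trans hr)
  have hz1 : ∀ r ≥ M, ∀ θ, fderiv ℝ h (r • unitVec θ) = 0 := fun r hr θ => hM1 _ (by
    rw [norm_smul_unitVec (hM0'.trans hr)]
    exact ((le_max_right _ _).trans (le_max_right _ _)).trans hr)
  -- polar coordinates
  set Φ : ℝ → ℝ → ℝ := fun r θ => h (r • unitVec θ) with hΦ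
  -- `a` is `∂_r h`, and `r * b` is `∂_θ h`.
  set a : ℝ → ℝ → ℝ := fun r θ => fderiv ℝ h (r • unitVec θ) (unitVec θ) with ha
  set b : ℝ → ℝ → ℝ := fun r θ => fderiv ℝ h (r • unitVec θ) (unitVec' θ) with hb
  have cu := continuous_unitVec
  have cu' := continuous_unitVec'
  have cp : Continuous fun p : ℝ × ℝ => p.1 • unitVec p.2 := by fun_prop
  have cΦ : Continuous (Function.uncurry Φ) := hhc.comp cp
  have ca : Continuous (Function.uncurry a) :=
    (hh1.comp cp).clm_apply (cu.comp continuous_snd)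
  have cb : Continuous (Function.uncurry b) :=
    (hh1.comp cp).clm_apply (cu'.comp continuous_snd)
  have sec : ∀ {f : ℝ → ℝ → ℝ}, Continuous (Function.uncurry f) → ∀ r, Continuous (f r) :=
    fun hf r => hf.comp (by fun_prop : Continuous fun θ => (r, θ))
  have hdΦ : ∀ r θ, HasDerivAt (fun r => Φ r θ) (a r θ) r := fun r θ => by
    have e1 : HasDerivAt (fun r : ℝ => r • unitVec θ) (unitVec θ) r := by
      simpa using (hasDerivAt_id r).smul_const (unitVec θ)
    exact (hh.differentiable (by simp) (r • unitVec θ)).hasFDerivAt.comp_hasDerivAt r e1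
  have hdΦ' : ∀ r θ, HasDerivAt (Φ r) (r * b r θ) θ := fun r θ => by
    have e1 : HasDerivAt (fun θ : ℝ => r • unitVec θ) (r • unitVec' θ) θ :=
      (hasDerivAt_unitVec θ).const_smul r
    have e2 := (hh.differentiable (by simp) (r • unitVec θ)).hasFDerivAt.comp_hasDerivAt θ e1
    exact e2.congr_deriv (by simp [hb])
  set h0 : ℝ → ℝ := fun r => (2 * Real.pi)⁻¹ * ∫ θ in (-Real.pi)..Real.pi, Φ r θ with hh0
  set h0' : ℝ → ℝ := fun r => (2 * Real.pi)⁻¹ * ∫ θ in (-Real.pi)..Real.pi, a r θ with hh0'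
  have hI0 : ∀ r, ∫ θ in (-Real.pi)..Real.pi, Φ r θ = 2 * Real.pi * h0 r := fun r => by
    rw [hh0]; field_simp
  have hI0' : ∀ r, ∫ θ in (-Real.pi)..Real.pi, a r θ = 2 * Real.pi * h0' r := fun r => by
    rw [hh0']; field_simp
  have hdh0 : ∀ r, HasDerivAt h0 (h0' r) r := fun r =>
    (hasDerivAt_angular_integral cΦ ca hdΦ r).const_mul _
  have ch0' : Continuous h0' := (continuous_angular_integral ca).const_mul _
  have ch0 : Continuous h0 := (continuous_angular_integral cΦ).const_mul _
  have hh0z : ∀ r ≥ M, h0 r = 0 := fun r hr => by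
    simp only [hh0, hΦ, hz0 r hr]; simp
  have hh0'z : ∀ r ≥ M, h0' r = 0 := fun r hr => by
    simp only [hh0', ha, hz1 r hr]; simp
  set P2 : ℝ → ℝ := fun r => ∫ θ in (-Real.pi)..Real.pi, Φ r θ ^ 2 with hP2
  set PA : ℝ → ℝ := fun r => ∫ θ in (-Real.pi)..Real.pi, Φ r θ * a r θ with hPA
  set A2 : ℝ → ℝ := fun r => ∫ θ in (-Real.pi)..Real.pi, a r θ ^ 2 with hA2
  set B2 : ℝ → ℝ := fun r => ∫ θ in (-Real.pi)..Real.pi, b r θ ^ 2 with hB2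
  have cP2 : Continuous P2 :=
    continuous_angular_integral (f := fun r θ => Φ r θ ^ 2) (cΦ.pow 2)
  have cPA : Continuous PA :=
    continuous_angular_integral (f := fun r θ => Φ r θ * a r θ) (cΦ.mul ca)
  have cA2 : Continuous A2 :=
    continuous_angular_integral (f := fun r θ => a r θ ^ 2) (ca.pow 2)
  have cB2 : Continuous B2 :=
    continuous_angular_integral (f := fun r θ => b r θ ^ 2) (cb.pow 2)
  have zP2 : ∀ r ≥ M, P2 r = 0 := fun r hr => by simp only [hP2, hΦ, hz0 r hr]; simp
  have zPA : ∀ r ≥ M, PA r = 0 := fun r hr => by simp only [hPA, hΦ, hz0 r hr]; simp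
  have zA2 : ∀ r ≥ M, A2 r = 0 := fun r hr => by simp only [hA2, ha, hz1 r hr]; simp
  have zB2 : ∀ r ≥ M, B2 r = 0 := fun r hr => by simp only [hB2, hb, hz1 r hr]; simp
  have hdP2 : ∀ r, HasDerivAt P2 (2 * PA r) r := fun r => by
    have c1 : Continuous (Function.uncurry fun r θ => Φ r θ ^ 2) := cΦ.pow 2
    have c2 : Continuous (Function.uncurry fun r θ => 2 * (Φ r θ * a r θ)) :=
      (cΦ.mul ca).const_mul 2
    have e1 := hasDerivAt_angular_integral (f := fun r θ => Φ r θ ^ 2)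
      (f' := fun r θ => 2 * (Φ r θ * a r θ)) c1 c2
      (fun r θ => ((hdΦ r θ).pow 2).congr_deriv (by ring)) r
    exact e1.congr_deriv (by rw [intervalIntegral.integral_const_mul])
  -- Expanded form of `∫ (Φ - h0)² dθ`, the angular variance on the circle of radius `r`.
  set N : ℝ → ℝ := fun r => P2 r - 2 * Real.pi * h0 r ^ 2 with hN
  have cN : Continuous N := by simp only [hN]; fun_prop
  have zN : ∀ r ≥ M, N r = 0 := fun r hr => by simp only [hN, zP2 r hr, hh0z r hr]; ring
  set N' : ℝ → ℝ := fun r => 2 * PA r - 2 * Real.pi * (2 * h0 r * h0' r) with hN'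
  have cN' : Continuous N' := by simp only [hN']; fun_prop
  have zN' : ∀ r ≥ M, N' r = 0 := fun r hr => by simp only [hN', zPA r hr, hh0z r hr]; ring
  have hdN : ∀ r, HasDerivAt N (N' r) r := fun r =>
    ((hdP2 r).sub (((hdh0 r).pow 2).const_mul (2 * Real.pi))).congr_deriv (by
      simp only [hN']; ring)
  -- At the origin `Φ` does not depend on the angle; this kills the boundary term of the later
  -- integration by parts.
  have hN0 : N 0 = 0 := by
    have e1 : h0 0 = h 0 := by
      simp only [hh0, hΦ, zero_smul, intervalIntegral.integral_const, smul_eq_mul]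
      field_simp
      ring
    simp only [hN, e1, hP2, hΦ, zero_smul, intervalIntegral.integral_const, smul_eq_mul]
    ring
  have hNW : ∀ r, N r ≤ r ^ 2 * B2 r := fun r => by
    have e1 := wirtinger (f := fun θ => Φ r θ - h0 r) (f' := fun θ => r * b r θ)
      (fun θ => (hdΦ' r θ).sub_const _) (continuous_const.mul (sec cb r))
      (by simp [hΦ, unitVec])
      (by rw [intervalIntegral.integral_sub ((sec cΦ r).intervalIntegrable _ _)
            intervalIntegrable_const, hI0, intervalIntegral.integral_const, smul_eq_mul]; ring)
    have e2 := integral_affine_sq_angular (sec cΦ r) (sec cΦ r) 1 0 (-h0 r)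
    have e3 : ∫ θ in (-Real.pi)..Real.pi, (r * b r θ) ^ 2 = r ^ 2 * B2 r := by
      simp only [mul_pow, hB2, intervalIntegral.integral_const_mul]
    rw [e3] at e1
    refine le_trans (le_of_eq ?_) e1
    have e4 : ∀ θ, Φ r θ - h0 r = 1 * Φ r θ + 0 * Φ r θ + -h0 r := fun θ => by ring
    simp only [e4]
    rw [e2, hI0]
    simp only [hN, hP2]
    ring
  -- For `w = Φ - h0`, expanding `∫ (r ∂_r w - w)² dθ ≥ 0` gives `r N' ≤ r² ∫ (∂_r w)² + N`, and
  -- Wirtinger bounds `N` by `r² B2`. Linear functions give equality in both.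
  have hNA : ∀ r, 0 < r → 2 * Real.pi * r * h0' r ^ 2 + N' r ≤ r * (A2 r + B2 r) := fun r hr => by
    have e1 := integral_affine_sq_angular (sec ca r) (sec cΦ r) r (-1) (-(r * h0' r) + h0 r)
    have e2 : 0 ≤ ∫ θ in (-Real.pi)..Real.pi,
        (r * a r θ + -1 * Φ r θ + (-(r * h0' r) + h0 r)) ^ 2 :=
      intervalIntegral.integral_nonneg (by linarith) fun θ _ => sq_nonneg _
    have e3 : ∫ θ in (-Real.pi)..Real.pi, a r θ * Φ r θ = PA r := by
      simp only [hPA, mul_comm]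
    rw [e1, e3, hI0, hI0'] at e2
    change 0 ≤ r ^ 2 * A2 r + 2 * r * (-1) * PA r + (-1) ^ 2 * P2 r + _ + _ + _ at e2
    have e4 := hNW r
    simp only [hN, hN'] at e4 ⊢
    refine le_of_mul_le_mul_left ?_ hr
    nlinarith
  -- the radial part
  obtain ⟨κ, hκ⟩ := radial_poincare hβ hlam h1 h2 hdh0 ch0' hh0z
  refine ⟨κ, ?_⟩
  have cρ := continuous_radialDensity β
  have cw := continuous_cauchyWeight β
  have ct := continuous_one_add_sq_rpow (1 - β)
  have ct' := continuous_one_add_sq_rpow (-β)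
  have hpow : ∀ r : ℝ, (1 + r ^ 2) ^ (1 - β) = (1 + r ^ 2) * (1 + r ^ 2) ^ (-β) := fun r => by
    rw [sub_eq_add_neg, Real.rpow_add (by positivity), Real.rpow_one]
  have hwr : ∀ r, 0 < r → ∀ θ, cauchyWeight β (r • unitVec θ) = (1 + r ^ 2) ^ (-β) :=
    fun r hr θ => by rw [cauchyWeight, norm_smul_unitVec hr.le]
  have cgrad : Continuous (gradSq h) := by unfold gradSq; fun_prop
  have energy : ∫ x, (1 + ‖x‖ ^ 2) * gradSq h x * cauchyWeight β x
      = ∫ r in Ioi 0, (1 + r ^ 2) * (A2 r + B2 r) * radialDensity β r := by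
    rw [integral_euc_eq_iterated (M := M1) (by fun_prop)
      (fun x hx => by simp [gradSq, hM1 x hx])]
    refine setIntegral_congr_fun measurableSet_Ioi fun r hr => ?_
    have hr' : 0 < r := hr
    have e1 : ∀ θ, (1 + ‖r • unitVec θ‖ ^ 2) * gradSq h (r • unitVec θ)
        * cauchyWeight β (r • unitVec θ)
        = ((1 + r ^ 2) * (1 + r ^ 2) ^ (-β)) * (a r θ ^ 2 + b r θ ^ 2) := fun θ => by
      rw [norm_smul_unitVec hr'.le, hwr r hr' θ, gradSq, sum_apply_basisFun_sq _ θ]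
      ring
    simp only [e1]
    have i1 : IntervalIntegrable (fun θ => a r θ ^ 2) volume (-Real.pi) Real.pi :=
      ((sec ca r).pow 2).intervalIntegrable _ _
    have i2 : IntervalIntegrable (fun θ => b r θ ^ 2) volume (-Real.pi) Real.pi :=
      ((sec cb r).pow 2).intervalIntegrable _ _
    rw [intervalIntegral.integral_const_mul, intervalIntegral.integral_add i1 i2, radialDensity]
    ring
  have variance : ∫ x, (h x - κ) ^ 2 * cauchyWeight β x
      = 2 * Real.pi * (∫ r in Ioi 0, (h0 r - κ) ^ 2 * radialDensity β r)
        + ∫ r in Ioi 0, N r * radialDensity β r := by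
    have e1 : ∫ x, (h x ^ 2 - 2 * κ * h x) * cauchyWeight β x
        = ∫ r in Ioi 0, (P2 r - 2 * κ * (2 * Real.pi * h0 r)) * radialDensity β r := by
      rw [integral_euc_eq_iterated (M := M0) (by fun_prop) (fun x hx => by simp [hM0 x hx])]
      refine setIntegral_congr_fun measurableSet_Ioi fun r hr => ?_
      have hr' : 0 < r := hr
      simp only [hwr r hr']
      have i1 : IntervalIntegrable (fun θ => h (r • unitVec θ) ^ 2) volume
          (-Real.pi) Real.pi := ((sec cΦ r).pow 2).intervalIntegrable _ _
      have i2 : IntervalIntegrable (fun θ => 2 * κ * h (r • unitVec θ)) volume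
          (-Real.pi) Real.pi := ((sec cΦ r).const_mul (2 * κ)).intervalIntegrable _ _
      rw [intervalIntegral.integral_mul_const, intervalIntegral.integral_sub i1 i2,
        intervalIntegral.integral_const_mul]
      change r * ((P2 r - 2 * κ * ∫ θ in (-Real.pi)..Real.pi, Φ r θ) * _) = _
      rw [hI0, radialDensity]
      ring
    have e2 : ∫ x, cauchyWeight β x = 2 * Real.pi * ∫ r in Ioi 0, radialDensity β r :=
      integral_euc_radial fun r => (1 + r ^ 2) ^ (-β)
    have i1 : Integrable fun x => (h x ^ 2 - 2 * κ * h x) * cauchyWeight β x :=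
      Continuous.integrable_of_hasCompactSupport (by fun_prop)
        (hasCompactSupport_of_norm_ge (M := M0) fun x hx => by simp [hM0 x hx])
    have i2 := (integrable_cauchyWeight hβ).const_mul (κ ^ 2)
    have e3 : ∫ x, (h x - κ) ^ 2 * cauchyWeight β x
        = (∫ x, (h x ^ 2 - 2 * κ * h x) * cauchyWeight β x)
          + κ ^ 2 * ∫ x, cauchyWeight β x := by
      rw [← integral_const_mul, ← integral_add i1 i2]
      congr 1
      funext x
      ring
    have j1 : IntegrableOn (fun r => (h0 r ^ 2 - 2 * κ * h0 r) * radialDensity β r) (Ioi 0) :=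
      integrableOn_Ioi_of_eventually_zero (M := M) (by fun_prop)
        (fun r hr => by rw [hh0z r hr]; ring) 0
    have j2 := (integrableOn_radialDensity hβ).const_mul (κ ^ 2)
    have j3 : IntegrableOn (fun r => N r * radialDensity β r) (Ioi 0) :=
      integrableOn_Ioi_of_eventually_zero (M := M) (by fun_prop)
        (fun r hr => by rw [zN r hr]; ring) 0
    have e4 : ∫ r in Ioi 0, (h0 r - κ) ^ 2 * radialDensity β r
        = (∫ r in Ioi 0, (h0 r ^ 2 - 2 * κ * h0 r) * radialDensity β r)
          + κ ^ 2 * ∫ r in Ioi 0, radialDensity β r := by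
      rw [← integral_const_mul, ← integral_add j1 j2]
      congr 1
      funext r
      ring
    have e5 : ∫ r in Ioi 0, (P2 r - 2 * κ * (2 * Real.pi * h0 r)) * radialDensity β r
        = 2 * Real.pi * (∫ r in Ioi 0, (h0 r ^ 2 - 2 * κ * h0 r) * radialDensity β r)
          + ∫ r in Ioi 0, N r * radialDensity β r := by
      rw [← integral_const_mul, ← integral_add (j1.const_mul _) j3]
      congr 1
      funext r
      simp only [hN]
      ring
    rw [e3, e1, e2, e4, e5]
    ring
  rw [energy, variance]
  have k1 : IntegrableOn (fun r => (1 + r ^ 2) * (A2 r + B2 r) * radialDensity β r) (Ioi 0) :=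
    integrableOn_Ioi_of_eventually_zero (M := M) (by fun_prop)
      (fun r hr => by rw [zA2 r hr, zB2 r hr]; ring) 0
  have k2 : IntegrableOn (fun r => (1 + r ^ 2) * h0' r ^ 2 * radialDensity β r) (Ioi 0) :=
    integrableOn_Ioi_of_eventually_zero (M := M) (by fun_prop)
      (fun r hr => by rw [hh0'z r hr]; ring) 0
  have k3 : IntegrableOn (fun r => N r * radialDensity β r) (Ioi 0) :=
    integrableOn_Ioi_of_eventually_zero (M := M) (by fun_prop)
      (fun r hr => by rw [zN r hr]; ring) 0
  -- The derivative of `(1 + r²)^(1 - β) N`. Its zero integral trades the weighted `N'` for `2 (β -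
  -- 1) N ρ`, which is where the constant of the non-radial part arises.
  set D : ℝ → ℝ := fun r => (1 + r ^ 2) ^ (1 - β) * N' r - 2 * (β - 1) * (N r * radialDensity β r)
    with hD
  have k4 : IntegrableOn D (Ioi 0) :=
    integrableOn_Ioi_of_eventually_zero (M := M) (by simp only [hD]; fun_prop)
      (fun r hr => by simp only [hD]; rw [zN r hr, zN' r hr]; ring) 0
  have hDint : ∫ r in Ioi 0, D r = 0 := by
    have e1 := integral_Ioi_of_hasDerivAt_of_tendsto' (a := (0 : ℝ)) (m := 0)
      (f := fun r => (1 + r ^ 2) ^ (1 - β) * N r) (f' := D)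
      (fun r _ => ((hasDerivAt_one_add_sq_rpow (1 - β) r).mul (hdN r)).congr_deriv (by
        simp only [hD, radialDensity]
        rw [show 1 - β - 1 = -β by ring]
        ring)) k4
      (tendsto_const_nhds.congr' (by
        filter_upwards [eventually_ge_atTop M] with r hr
        rw [zN r hr, mul_zero]))
    rw [e1, hN0]
    ring
  have hNpos : 0 ≤ ∫ r in Ioi 0, N r * radialDensity β r := by
    refine setIntegral_nonneg measurableSet_Ioi fun r hr => mul_nonneg ?_
      (radialDensity_nonneg β (le_of_lt hr))
    have e2 := integral_affine_sq_angular (sec cΦ r) (sec cΦ r) 1 0 (-h0 r)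
    have e3 : 0 ≤ ∫ θ in (-Real.pi)..Real.pi, (1 * Φ r θ + 0 * Φ r θ + -h0 r) ^ 2 :=
      intervalIntegral.integral_nonneg (by linarith) fun θ _ => sq_nonneg _
    rw [e2, hI0] at e3
    simp only [hN, hP2]
    linarith
  have hmain : 2 * Real.pi * (∫ r in Ioi 0, (1 + r ^ 2) * h0' r ^ 2 * radialDensity β r)
      + 2 * (β - 1) * (∫ r in Ioi 0, N r * radialDensity β r) + ∫ r in Ioi 0, D r
      ≤ ∫ r in Ioi 0, (1 + r ^ 2) * (A2 r + B2 r) * radialDensity β r := by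
    have k5 : IntegrableOn (fun r => 2 * Real.pi * ((1 + r ^ 2) * h0' r ^ 2 * radialDensity β r)
        + 2 * (β - 1) * (N r * radialDensity β r)) (Ioi 0) :=
      (k2.const_mul _).add (k3.const_mul _)
    rw [← integral_const_mul, ← integral_const_mul,
      ← integral_add (k2.const_mul _) (k3.const_mul _), ← integral_add k5 k4]
    refine setIntegral_mono_on (k5.add k4) k1
      measurableSet_Ioi fun r hr => ?_
    have hr' : 0 < r := hr
    have e1 : (1 + r ^ 2) * (A2 r + B2 r) * radialDensity β r
        = (1 + r ^ 2) ^ (1 - β) * (r * (A2 r + B2 r)) := by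
      rw [hpow, radialDensity]; ring
    have e2 := mul_le_mul_of_nonneg_left (hNA r hr')
      (by positivity : 0 ≤ (1 + r ^ 2) ^ (1 - β))
    rw [e1]
    refine le_trans (le_of_eq ?_) e2
    simp only [hD, radialDensity]
    rw [hpow]
    ring
  rw [hDint, add_zero] at hmain
  -- The mean is controlled by `hκ`, the remainder by `lam ≤ 2 (β - 1)`; variance and energy bound
  -- are both additive over this splitting.
  have f1 := mul_le_mul_of_nonneg_left hκ (by positivity : 0 ≤ 2 * Real.pi)
  have f2 := mul_le_mul_of_nonneg_right hlam2 hNpos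
  linarith

end FullPoincare

/-! ### The exact gap of the full operator. -/

section FullOperator

/-- The unnormalized Cauchy measure in dimension two. -/
def fullMeasure (β : ℝ) : Measure (Euc 2) :=
  volume.withDensity fun x => ENNReal.ofReal ((1 + ‖x‖ ^ 2) ^ (-β))

theorem fullMeasure_eq (β : ℝ) : fullMeasure β = (volume : Measure (Euc 2)).withDensity
    fun x => ENNReal.ofReal (cauchyWeight β x) := rfl

theorem integral_fullMeasure (β : ℝ) (F : Euc 2 → ℝ) :
    ∫ x, F x ∂(fullMeasure β) = ∫ x, F x * cauchyWeight β x := by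
  rw [fullMeasure_eq, integral_withDensity_eq_integral_toReal_smul
    (continuous_cauchyWeight β).measurable.ennreal_ofReal
    (Eventually.of_forall fun _ => ENNReal.ofReal_lt_top)]
  refine integral_congr_ae (Eventually.of_forall fun x => ?_)
  simp only [smul_eq_mul]
  rw [ENNReal.toReal_ofReal (cauchyWeight_pos β x).le, mul_comm]

theorem integrable_fullMeasure_iff (β : ℝ) (F : Euc 2 → ℝ) :
    Integrable F (fullMeasure β) ↔ Integrable fun x => F x * cauchyWeight β x := by
  rw [fullMeasure_eq, integrable_withDensity_iff_integrable_smul'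
    (continuous_cauchyWeight β).measurable.ennreal_ofReal
    (Eventually.of_forall fun _ => ENNReal.ofReal_lt_top)]
  refine integrable_congr (Eventually.of_forall fun x => ?_)
  simp only [smul_eq_mul]
  rw [ENNReal.toReal_ofReal (cauchyWeight_pos β x).le, mul_comm]

theorem isFiniteMeasure_fullMeasure {β : ℝ} (hβ : 1 < β) : IsFiniteMeasure (fullMeasure β) := by
  rw [fullMeasure_eq]
  exact isFiniteMeasure_withDensity_ofReal (integrable_cauchyWeight hβ).2

/-- A continuous non-negative function that is positive somewhere has positive integral. -/
theorem integral_fullMeasure_pos {β : ℝ} {F : Euc 2 → ℝ} (hF : Continuous F)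
    (hi : Integrable F (fullMeasure β)) (h0 : ∀ x, 0 ≤ F x) {x₀ : Euc 2} (hx : F x₀ ≠ 0) :
    0 < ∫ x, F x ∂(fullMeasure β) := by
  rw [integral_fullMeasure]
  exact integral_pos_of_integrable_nonneg_nonzero (hF.mul (continuous_cauchyWeight β))
    ((integrable_fullMeasure_iff β F).1 hi)
    (fun x => mul_nonneg (h0 x) (cauchyWeight_pos β x).le)
    (mul_ne_zero hx (cauchyWeight_pos β x₀).ne')

theorem fullMeasure_ne_zero {β : ℝ} (hβ : 1 < β) : fullMeasure β ≠ 0 := by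
  intro h
  have := isFiniteMeasure_fullMeasure hβ
  have h1 := integral_fullMeasure_pos (β := β) (F := fun _ => 1) continuous_const
    (integrable_const 1) (fun _ => zero_le_one) (x₀ := 0) one_ne_zero
  rw [h, integral_zero_measure] at h1
  exact lt_irrefl _ h1

theorem fderiv_cauchyWeight_mul (β : ℝ) {u : Euc 2 → ℝ} {x : Euc 2} (hu : DifferentiableAt ℝ u x)
    (v : Euc 2) :
    fderiv ℝ (fun y => cauchyWeight (β - 1) y * u y) x v
      = ((1 + ‖x‖ ^ 2) * fderiv ℝ u x v + 2 * (1 - β) * ⟪x, v⟫_ℝ * u x) * cauchyWeight β x := by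
  have h1 : HasFDerivAt (fun x : Euc 2 => 1 + ‖x‖ ^ 2) (2 • (innerSL ℝ x)) x := by
    simpa using (hasStrictFDerivAt_norm_sq x).hasFDerivAt.const_add 1
  have h2 := h1.rpow_const (p := -(β - 1)) (Or.inl (by positivity))
  have h3 := (h2.mul hu.hasFDerivAt).fderiv
  have h4 : (1 + ‖x‖ ^ 2) ^ (-(β - 1)) = (1 + ‖x‖ ^ 2) * (1 + ‖x‖ ^ 2) ^ (-β) := by
    rw [show -(β - 1) = 1 + -β by ring, Real.rpow_add (by positivity), Real.rpow_one]
  have h5 : fderiv ℝ (fun y => cauchyWeight (β - 1) y * u y) x = _ := h3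
  rw [h5]
  simp only [add_apply, smul_apply, innerSL_apply_apply, smul_eq_mul, nsmul_eq_mul]
  rw [h4, show -(β - 1) - 1 = -β by ring, cauchyWeight]
  push_cast
  ring

/-- Divergence form: the weighted operator is the divergence of `(1 + ‖x‖²)^(1 - β) ∇h`, ready for
integration by parts in each coordinate. -/
theorem fullExpr_eq_sum {β : ℝ} {h : Euc 2 → ℝ} (hh : ContDiff ℝ ∞ h) (x : Euc 2) :
    fullExpr 2 β h x * cauchyWeight β x
      = ∑ i, fderiv ℝ (fun y => cauchyWeight (β - 1) y
          * fderiv ℝ h y (EuclideanSpace.basisFun (Fin 2) ℝ i)) x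
          (EuclideanSpace.basisFun (Fin 2) ℝ i) := by
  have hd : ∀ v, DifferentiableAt ℝ (fun y => fderiv ℝ h y v) x := fun v =>
    ((hh.fderiv_right (m := ∞) (by simp)).clm_apply contDiff_const).differentiable (by simp) x
  simp only [fderiv_cauchyWeight_mul β (hd _)]
  rw [fullExpr, laplacian_eq_sum_fderiv hh, inner_gradient_right]
  have e : fderiv ℝ h x x = ∑ i, ⟪x, EuclideanSpace.basisFun (Fin 2) ℝ i⟫_ℝ
      * fderiv ℝ h x (EuclideanSpace.basisFun (Fin 2) ℝ i) := by
    have e1 := congrArg (fderiv ℝ h x) ((EuclideanSpace.basisFun (Fin 2) ℝ).sum_repr' x)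
    rw [← e1, map_sum]
    refine Finset.sum_congr rfl fun i _ => ?_
    rw [map_smul, smul_eq_mul, real_inner_comm]
  rw [e, conj_trivial, ← Finset.sum_mul, Finset.sum_add_distrib, Finset.mul_sum, Finset.mul_sum]
  simp only [mul_assoc]

/-- The quadratic form of the full operator. -/
theorem integral_fullExpr_mul (β : ℝ) (φ ψ : testFunctions 2) :
    ∫ x, fullExpr 2 β φ x * (ψ : Euc 2 → ℝ) x ∂(fullMeasure β)
      = -∫ x, (1 + ‖x‖ ^ 2) * (∑ i, fderiv ℝ φ x (EuclideanSpace.basisFun (Fin 2) ℝ i)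
          * fderiv ℝ ψ x (EuclideanSpace.basisFun (Fin 2) ℝ i)) * cauchyWeight β x := by
  obtain ⟨φ, hφ, hφs⟩ := φ
  obtain ⟨ψ, hψ, hψs⟩ := ψ
  simp only
  have cw := continuous_cauchyWeight (β - 1)
  have cw1 : ContDiff ℝ ∞ (cauchyWeight (β - 1)) :=
    (contDiff_const.add (contDiff_norm_sq ℝ)).rpow_const_of_ne fun x => by positivity
  have cφ' : ∀ v, ContDiff ℝ ∞ fun y => fderiv ℝ φ y v := fun v =>
    (hφ.fderiv_right (m := ∞) (by simp)).clm_apply contDiff_const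
  have cψ' : ∀ v, Continuous fun y => fderiv ℝ ψ y v := fun v =>
    ((hψ.fderiv_right (m := ∞) (by simp)).clm_apply contDiff_const).continuous
  have cf : ∀ v, ContDiff ℝ ∞ fun y => cauchyWeight (β - 1) y * fderiv ℝ φ y v := fun v =>
    cw1.mul (cφ' v)
  have cf' : ∀ v, Continuous fun x => fderiv ℝ (fun y => cauchyWeight (β - 1) y
      * fderiv ℝ φ y v) x v := fun v =>
    (((cf v).fderiv_right (m := ∞) (by simp)).clm_apply contDiff_const).continuous
  have s' : ∀ v, HasCompactSupport fun y => fderiv ℝ ψ y v := fun v =>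
    hψs.fderiv_apply (𝕜 := ℝ) v
  have i1 : ∀ v, Integrable fun x => fderiv ℝ (fun y => cauchyWeight (β - 1) y
      * fderiv ℝ φ y v) x v * ψ x := fun v =>
    ((cf' v).mul hψ.continuous).integrable_of_hasCompactSupport hψs.mul_left
  have i2 : ∀ v, Integrable fun x => cauchyWeight (β - 1) x * fderiv ℝ φ x v * fderiv ℝ ψ x v :=
    fun v => ((cf v).continuous.mul (cψ' v)).integrable_of_hasCompactSupport (s' v).mul_left
  have ibp : ∀ v, ∫ x, fderiv ℝ (fun y => cauchyWeight (β - 1) y * fderiv ℝ φ y v) x v * ψ x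
      = -∫ x, cauchyWeight (β - 1) x * fderiv ℝ φ x v * fderiv ℝ ψ x v := fun v => by
    rw [integral_mul_fderiv_eq_neg_fderiv_mul_of_integrable (i1 v) (i2 v)
      (((cf v).continuous.mul hψ.continuous).integrable_of_hasCompactSupport hψs.mul_left)
      (fun x _ => (cf v).differentiable (by simp) x)
      (fun x _ => hψ.differentiable (by simp) x), neg_neg]
  have hpow : ∀ x, cauchyWeight (β - 1) x = (1 + ‖x‖ ^ 2) * cauchyWeight β x := fun x => by
    rw [cauchyWeight, cauchyWeight, show -(β - 1) = 1 + -β by ring, Real.rpow_add (by positivity),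
      Real.rpow_one]
  rw [integral_fullMeasure]
  have e1 : ∀ x, fullExpr 2 β φ x * ψ x * cauchyWeight β x
      = ∑ i, fderiv ℝ (fun y => cauchyWeight (β - 1) y
          * fderiv ℝ φ y (EuclideanSpace.basisFun (Fin 2) ℝ i)) x
          (EuclideanSpace.basisFun (Fin 2) ℝ i) * ψ x := fun x => by
    rw [mul_right_comm, fullExpr_eq_sum hφ, Finset.sum_mul]
  have e2 : ∀ x, (1 + ‖x‖ ^ 2) * (∑ i, fderiv ℝ φ x (EuclideanSpace.basisFun (Fin 2) ℝ i)
          * fderiv ℝ ψ x (EuclideanSpace.basisFun (Fin 2) ℝ i)) * cauchyWeight β x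
      = ∑ i, cauchyWeight (β - 1) x * fderiv ℝ φ x (EuclideanSpace.basisFun (Fin 2) ℝ i)
          * fderiv ℝ ψ x (EuclideanSpace.basisFun (Fin 2) ℝ i) := fun x => by
    rw [mul_right_comm, ← hpow, Finset.mul_sum]
    exact Finset.sum_congr rfl fun i _ => (mul_assoc _ _ _).symm
  simp only [e1, e2]
  rw [integral_finsetSum _ fun i _ => i1 _, integral_finsetSum _ fun i _ => i2 _,
    ← Finset.sum_neg_distrib]
  exact Finset.sum_congr rfl fun i _ => ibp _

theorem fullMeasure_ae_eq_zero {β : ℝ} (hβ : 1 < β) (f : Euc 2 → ℝ)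
    (hf : MemLp f 2 (fullMeasure β))
    (h : ∀ φ : testFunctions 2, ∫ x, (φ : Euc 2 → ℝ) x * f x ∂(fullMeasure β) = 0) :
    f =ᵐ[fullMeasure β] 0 := by
  have := isFiniteMeasure_fullMeasure hβ
  have hfi : Integrable f (fullMeasure β) := hf.integrable (by norm_num)
  exact ae_eq_zero_of_integral_contDiff_smul_eq_zero hfi.locallyIntegrable
    fun g hg hgs => h ⟨g, hg, hgs⟩

/-- The spectral gap of the full operator, given the parameter of the Poincaré inequality and
almost extremal functions. -/
theorem lambda1_fullOperator_eq {β lam A : ℝ} (hβ : 1 < β) (hlam : 0 < lam)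
    (hlam2 : lam ≤ 2 * (β - 1))
    (h1 : A * (A + 2 * β - 2) ≤ -lam) (h2 : 4 * A + 4 * β - 8 ≤ -lam)
    (hweyl : ∀ ε > 0, ∃ φ : testFunctions 2, 0 < ∫ x, ((φ : Euc 2 → ℝ) x) ^ 2 ∂(fullMeasure β) ∧
      ∫ x, (fullExpr 2 β φ x + lam * (φ : Euc 2 → ℝ) x) ^ 2 ∂(fullMeasure β)
        ≤ ε * ∫ x, ((φ : Euc 2 → ℝ) x) ^ 2 ∂(fullMeasure β)) :
    lambda1 (-fullOperator 2 β) = lam := by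
  have := isFiniteMeasure_fullMeasure hβ
  refine lambda1_neg_l2Operator_normalize (fullMeasure β) (fullMeasure_ne_zero hβ)
    (testFunctions 2) (fullMap 2 β) _ _ _ hlam (fullMeasure_ae_eq_zero hβ) ?_ ?_ ?_ hweyl
  · intro φ ψ
    have e1 := integral_fullExpr_mul β φ ψ
    have e2 := integral_fullExpr_mul β ψ φ
    simp only [mul_comm (fderiv ℝ (ψ : Euc 2 → ℝ) _ _)] at e2
    refine e1.trans (e2.symm.trans ?_)
    exact integral_congr_ae (Eventually.of_forall fun x => mul_comm _ _)
  · intro φ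
    obtain ⟨κ, hκ⟩ := full_poincare hβ hlam hlam2 h1 h2 φ.2.1 φ.2.2
    refine ⟨κ, ?_⟩
    rw [integral_fullMeasure]
    refine hκ.trans (le_of_eq ?_)
    have e1 := integral_fullExpr_mul β φ φ
    have e2 : ∫ x, -(fullMap 2 β φ x) * (φ : Euc 2 → ℝ) x ∂(fullMeasure β)
        = -∫ x, fullExpr 2 β φ x * (φ : Euc 2 → ℝ) x ∂(fullMeasure β) := by
      rw [← integral_neg]
      exact integral_congr_ae (Eventually.of_forall fun x => neg_mul _ _)
    rw [e2, e1, neg_neg]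
    simp only [gradSq, sq]
  · obtain ⟨G, hG, hGs, h3, -, h4⟩ := exists_cutoff_affine (β := β) (p := 1) (q := 0) (lam := 0)
      (fun s => by ring) (m := fullMeasure β) (S := fun x => ‖x‖ ^ 2) (by fun_prop)
      (fun x => sq_nonneg _) (by simp)
    refine ⟨fun n => testAffineSq 1 0 (G n) (hG n) (hGs n), ?_, ?_⟩
    · simpa [testAffineSq] using h3
    · refine h4.congr fun n => integral_congr_ae (Eventually.of_forall fun x => ?_)
      have e := fullExpr_affine_mul_comp_norm_sq β 1 0 (hG n) x
      change _ = (fullExpr 2 β (fun x => (1 + (0 : Euc 2 →L[ℝ] ℝ) x) * G n (‖x‖ ^ 2)) x) ^ 2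
      rw [e]
      simp

/-- For `β ≤ 3` one has `(β - 1)² ≤ 2 (β - 1)`, so the radial constant decides, and the radial Weyl
functions serve again; both integrals just acquire the factor `2π`. -/
theorem lambda1_fullOperator_of_le {β : ℝ} (hβ : 1 < β) (hβ3 : β ≤ 3) :
    lambda1 (-fullOperator 2 β) = (β - 1) ^ 2 := by
  have h0 : 0 < β - 1 := by linarith
  refine lambda1_fullOperator_eq (A := 1 - β) hβ (by positivity) (by nlinarith) (by nlinarith)
    (by nlinarith) fun ε hε => ?_
  obtain ⟨G, hG, hGs, h1, h2⟩ := exists_log_weyl β hβ hε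
  have hrad : ∀ F : ℝ → ℝ, ∫ x, F (‖x‖ ^ 2) ∂(fullMeasure β)
      = 2 * Real.pi * ∫ r in Ioi 0, F (r ^ 2) * radialDensity β r := fun F => by
    rw [integral_fullMeasure]
    refine (integral_euc_radial fun r => F (r ^ 2) * (1 + r ^ 2) ^ (-β)).trans ?_
    congr 2
    funext r
    rw [radialDensity]
    ring
  have e1 : ∫ x, ((testAffineSq 1 0 G hG hGs : Euc 2 → ℝ) x) ^ 2 ∂(fullMeasure β)
      = 2 * Real.pi * ∫ r in Ioi 0, (G (r ^ 2)) ^ 2 * radialDensity β r := by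
    rw [← hrad fun s => G s ^ 2]
    simp [testAffineSq]
  have e2 : ∫ x, (fullExpr 2 β (testAffineSq 1 0 G hG hGs) x
        + (β - 1) ^ 2 * (testAffineSq 1 0 G hG hGs : Euc 2 → ℝ) x) ^ 2 ∂(fullMeasure β)
      = 2 * Real.pi * ∫ r in Ioi 0,
        (sqExpr β G (r ^ 2) + (β - 1) ^ 2 * G (r ^ 2)) ^ 2 * radialDensity β r := by
    rw [← hrad fun s => (sqExpr β G s + (β - 1) ^ 2 * G s) ^ 2]
    refine integral_congr_ae (Eventually.of_forall fun x => ?_)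
    have e := fullExpr_affine_mul_comp_norm_sq β 1 0 hG x
    change (fullExpr 2 β (fun x => (1 + (0 : Euc 2 →L[ℝ] ℝ) x) * G (‖x‖ ^ 2)) x
      + (β - 1) ^ 2 * ((1 + (0 : Euc 2 →L[ℝ] ℝ) x) * G (‖x‖ ^ 2))) ^ 2 = _
    rw [e]
    simp
  refine ⟨testAffineSq 1 0 G hG hGs, ?_, ?_⟩
  · rw [e1]; exact mul_pos Real.two_pi_pos h1
  · rw [e1, e2]
    nlinarith [mul_le_mul_of_nonneg_left h2 Real.two_pi_pos.le]

/-- For `β > 3` the radial constant `4(β - 2)` from `A = 4 - 2β` exceeds `2(β - 1)`, so the first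
angular mode decides. Its witness is a coordinate function, cut off. -/
theorem lambda1_fullOperator_of_lt {β : ℝ} (hβ3 : 3 < β) :
    lambda1 (-fullOperator 2 β) = 2 * (β - 1) := by
  have hβ : 1 < β := by linarith
  refine lambda1_fullOperator_eq (A := 4 - 2 * β) hβ (by linarith) le_rfl (by nlinarith)
    (by nlinarith) fun ε hε => ?_
  have := isFiniteMeasure_fullMeasure hβ
  obtain ⟨χ, M, hM, hχ⟩ := exists_cutoffs
  set L : Euc 2 →L[ℝ] ℝ := EuclideanSpace.proj 0 with hL
  have hLx : ∀ x : Euc 2, L x ^ 2 ≤ 1 + ‖x‖ ^ 2 := fun x => by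
    have e1 : L x = x 0 := rfl
    rw [EuclideanSpace.norm_sq_eq, Fin.sum_univ_two, e1]
    simp only [Real.norm_eq_abs, sq_abs]
    nlinarith [sq_nonneg (x 1)]
  have hi : Integrable (fun x : Euc 2 => 1 + ‖x‖ ^ 2) (fullMeasure β) := by
    rw [integrable_fullMeasure_iff]
    refine (integrable_cauchyWeight (β := β - 1) (by linarith)).congr
      (Eventually.of_forall fun x => ?_)
    simp only [cauchyWeight]
    rw [show -(β - 1) = 1 + -β by ring, Real.rpow_add (by positivity), Real.rpow_one]
  have hiL : Integrable (fun x : Euc 2 => L x ^ 2) (fullMeasure β) :=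
    hi.mono' (by fun_prop) (Eventually.of_forall fun x => by
      rw [Real.norm_of_nonneg (sq_nonneg _)]; exact hLx x)
  have hpos : 0 < ∫ x, L x ^ 2 ∂(fullMeasure β) :=
    integral_fullMeasure_pos (by fun_prop) hiL (fun x => sq_nonneg _)
      (x₀ := EuclideanSpace.single 0 1) (by simp [hL])
  -- The residual of the cut-off coordinate function: the eigenvalue terms cancel and each remaining
  -- term contains a derivative of `χ n`.
  set K : ℕ → Euc 2 → ℝ := fun n x =>
    L x * (sqExpr β (χ n) (‖x‖ ^ 2) + 4 * (1 + ‖x‖ ^ 2) * deriv (χ n) (‖x‖ ^ 2)) with hK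
  have hKe : ∀ n x, fullExpr 2 β (testAffineSq 0 L (χ n) (hχ n).1 (hχ n).2.1) x
      + 2 * (β - 1) * (testAffineSq 0 L (χ n) (hχ n).1 (hχ n).2.1 : Euc 2 → ℝ) x = K n x :=
    fun n x => by
      have e := fullExpr_affine_mul_comp_norm_sq β 0 L (hχ n).1 x
      change fullExpr 2 β (fun x => (0 + L x) * χ n (‖x‖ ^ 2)) x
        + 2 * (β - 1) * ((0 + L x) * χ n (‖x‖ ^ 2)) = K n x
      rw [e, hK]
      ring
  have hlarge : ∀ x : Euc 2, ∀ᶠ n : ℕ in atTop, |‖x‖ ^ 2| < n := fun x =>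
    tendsto_natCast_atTop_atTop.eventually_gt_atTop _
  have lim1 : Tendsto (fun n => ∫ x, ((testAffineSq 0 L (χ n) (hχ n).1 (hχ n).2.1 : Euc 2 → ℝ) x)
      ^ 2 ∂(fullMeasure β)) atTop (𝓝 (∫ x, L x ^ 2 ∂(fullMeasure β))) := by
    refine tendsto_integral_of_eventually_eq (fun n => ?_) hi (fun n => ?_) ?_
    · exact ((testAffineSq 0 L (χ n) (hχ n).1 (hχ n).2.1).2.1.continuous.pow 2).aestronglyMeasurable
    · refine Eventually.of_forall fun x => ?_
      change |((0 + L x) * χ n (‖x‖ ^ 2)) ^ 2| ≤ _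
      rw [abs_of_nonneg (sq_nonneg _), zero_add, mul_pow]
      have e1 : χ n (‖x‖ ^ 2) ^ 2 ≤ 1 := (sq_le_one_iff_abs_le_one _).2 ((hχ n).2.2.1 _)
      nlinarith [hLx x, sq_nonneg (L x)]
    · refine Eventually.of_forall fun x => ?_
      filter_upwards [hlarge x] with n hn
      change ((0 + L x) * χ n (‖x‖ ^ 2)) ^ 2 = _
      rw [((hχ n).2.2.2.2.2 _ hn).1]
      ring
  set C : ℝ := 4 * M + (4 + |8 - 4 * β|) * M + 4 * M with hC
  have hC0 : 0 ≤ C := by positivity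
  have lim2 : Tendsto (fun n => ∫ x, K n x ^ 2 ∂(fullMeasure β)) atTop (𝓝 0) := by
    rw [show (0 : ℝ) = ∫ _x : Euc 2, (0 : ℝ) ∂(fullMeasure β) by simp]
    refine tendsto_integral_of_eventually_eq (B := fun x => C ^ 2 * (1 + ‖x‖ ^ 2)) (fun n => ?_)
      (hi.const_mul _) (fun n => ?_) ?_
    · have c1 := continuous_sqExpr β (hχ n).1
      have c2 := (contDiff_infty_iff_deriv.1 (hχ n).1).2.continuous
      refine Continuous.aestronglyMeasurable ?_
      simp only [hK]
      fun_prop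
    · refine Eventually.of_forall fun x => ?_
      set s : ℝ := ‖x‖ ^ 2 with hs
      have hs0 : 0 ≤ s := sq_nonneg _
      obtain ⟨-, -, -, b1, b2, -⟩ := hχ n
      have b1 := b1 s hs0
      have b2 := b2 s hs0
      have d1 : |4 * s * (1 + s) * deriv (deriv (χ n)) s| ≤ 4 * M := by
        rw [abs_mul, abs_of_nonneg (by positivity)]
        nlinarith [abs_nonneg (deriv (deriv (χ n)) s),
          mul_nonneg (by positivity : 0 ≤ 1 + s) (abs_nonneg (deriv (deriv (χ n)) s))]
      have d2 : |(4 + (8 - 4 * β) * s) * deriv (χ n) s| ≤ (4 + |8 - 4 * β|) * M := by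
        have d3 : |4 + (8 - 4 * β) * s| ≤ (4 + |8 - 4 * β|) * (1 + s) := by
          refine (abs_add_le _ _).trans ?_
          rw [abs_mul, abs_of_nonneg hs0, abs_of_nonneg (by norm_num : (0 : ℝ) ≤ 4)]
          nlinarith [abs_nonneg (8 - 4 * β)]
        rw [abs_mul]
        refine (mul_le_mul_of_nonneg_right d3 (abs_nonneg _)).trans ?_
        rw [mul_assoc]
        exact mul_le_mul_of_nonneg_left b1 (by positivity)
      have d4 : |4 * (1 + s) * deriv (χ n) s| ≤ 4 * M := by
        rw [abs_mul, abs_of_nonneg (by positivity)]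
        linarith
      have d5 : |sqExpr β (χ n) s + 4 * (1 + s) * deriv (χ n) s| ≤ C :=
        (abs_add_le _ _).trans (add_le_add ((abs_add_le _ _).trans (add_le_add d1 d2)) d4)
      have d6 : (sqExpr β (χ n) s + 4 * (1 + s) * deriv (χ n) s) ^ 2 ≤ C ^ 2 := by
        rw [← sq_abs]
        exact pow_le_pow_left₀ (abs_nonneg _) d5 2
      rw [abs_of_nonneg (sq_nonneg _), hK]
      simp only
      rw [mul_pow, mul_comm]
      exact mul_le_mul d6 (hLx x) (sq_nonneg _) (sq_nonneg _)
    · refine Eventually.of_forall fun x => ?_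
      filter_upwards [hlarge x] with n hn
      obtain ⟨-, e1, e2⟩ := (hχ n).2.2.2.2.2 _ hn
      simp only [hK, sqExpr, e1, e2]
      ring
  obtain ⟨n, h3, h4⟩ := exists_le_mul_of_tendsto lim2 lim1 hpos hε
  refine ⟨testAffineSq 0 L (χ n) (hχ n).1 (hχ n).2.1, h3, ?_⟩
  simp only [hKe]
  exact h4

end FullOperator

end WeightedGap

end


/-! ### Comparison of the exact values. -/

theorem mainTheorem7 (β : ℝ) :
    (1 < β → β ≤ (3 + √(5 : ℝ)) / 2 →
      WeightedGap.lambda1 (-WeightedGap.fullOperator 2 β)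
          = WeightedGap.lambda1 (-WeightedGap.radialOperator 2 β) ∧
      WeightedGap.lambda1 (-WeightedGap.radialOperator 2 β) = (β - 1) ^ 2) ∧
    ((3 + √(5 : ℝ)) / 2 < β → β ≤ 3 →
      β ≤ WeightedGap.lambda1 (-WeightedGap.fullOperator 2 β) ∧
      WeightedGap.lambda1 (-WeightedGap.fullOperator 2 β)
          ≤ WeightedGap.lambda1 (-WeightedGap.radialOperator 2 β) ∧
      WeightedGap.lambda1 (-WeightedGap.radialOperator 2 β) = (β - 1) ^ 2) ∧
    (3 < β →
      β ≤ WeightedGap.lambda1 (-WeightedGap.fullOperator 2 β) ∧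
      WeightedGap.lambda1 (-WeightedGap.fullOperator 2 β) ≤ 2 * (β - 1) ∧
      2 * (β - 1) < WeightedGap.lambda1 (-WeightedGap.radialOperator 2 β) ∧
      WeightedGap.lambda1 (-WeightedGap.radialOperator 2 β) = 4 * (β - 2)) := by
  have h5 : √(5 : ℝ) ^ 2 = 5 := Real.sq_sqrt (by norm_num)
  have h50 : 0 ≤ √(5 : ℝ) := Real.sqrt_nonneg 5
  refine ⟨fun h1 h2 => ?_, fun h1 h2 => ?_, fun h1 => ?_⟩
  · have h3 : β ≤ 3 := by nlinarith
    rw [WeightedGap.lambda1_fullOperator_of_le h1 h3, WeightedGap.lambda1_radialOperator_of_le h1 h3]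
    exact ⟨rfl, rfl⟩
  · have h3 : 1 < β := by linarith
    rw [WeightedGap.lambda1_fullOperator_of_le h3 h2, WeightedGap.lambda1_radialOperator_of_le h3 h2]
    -- Above the larger root of `β² - 3β + 1` one has `β ≤ (β - 1)²`; the two gaps are in fact equal
    -- here.
    exact ⟨by nlinarith, le_rfl, rfl⟩
  · rw [WeightedGap.lambda1_fullOperator_of_lt h1, WeightedGap.lambda1_radialOperator_of_lt h1]
    exact ⟨by linarith, le_rfl, by linarith, rfl⟩
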